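/- Let $M$ be a connected, Hausdorff, second countable smooth manifold of dimension $n$ without boundary, and let $(M,\Omega)$ be locally conformal symplectic with Lee $1$-form $\omega$: $\Omega$ is a nondegenerate $2$-form, $\omega$ is a closed $1$-form, and $d\Omega=\omega\wedge\Omega$. Write $\Omega^k(M)$ and $\mathcal V^k(M)$ for the spaces of $k$-forms and $k$-vectors (both zero for $k=-1$). Let $\flat:\mathcal V^1(M)\to\Omega^1(M)$, $\flat(X)=i_X\Omega$, and extend it to isomorphisms $\flat:\mathcal V^k(M)\to\Omega^k(M)$ of $C^\infty(M,\mathbb R)$-modules by $\flat(X_1\wedge\dots\wedge X_k)=\flat(X_1)\wedge\dots\wedge\flat(X_k)$. Let $(\Lambda,E)$ be the associated Jacobi structure, $\Lambda(\alpha,\beta)=\Omega(\flat^{-1}\alpha,\flat^{-1}\beta)$ and $E=\flat^{-1}(\omega)$. Let $\#_\Lambda:\Omega^k(M)\to\mathcal V^k(M)$ be given by $\beta(\#_\Lambda\alpha)=\Lambda(\alpha,\beta)$ for $1$-forms $\alpha,\beta$, by $\#_\Lambda f=f$ for functions, and by $(\#_\Lambda\alpha)(\alpha_1,\dots,\alpha_k)=(-1)^k\alpha(\#_\Lambda\alpha_1,\dots,\#_\Lambda\alpha_k)$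 for a $k$-form $\alpha$. The LJ-cohomology operator $\sigma:\mathcal V^k(M)\oplus\mathcal V^{k-1}(M)\to\mathcal V^{k+1}(M)\oplus\mathcal V^k(M)$ is $$\sigma(P,Q)=\bigl(-[\Lambda,P]+kE\wedge P+\Lambda\wedge Q,\ [\Lambda,Q]-(k-1)E\wedge Q+[E,P]\bigr),$$ where $[\cdot,\cdot]$ is the Schouten–Nijenhuis bracket, with the sign convention that $[X,P]=\mathcal L_XP$ for vector fields $X$ and $[P,Q]=(-1)^{pq}[Q,P]$ for $P\in\mathcal V^p(M)$, $Q\in\mathcal V^q(M)$. Let $d_\omega\alpha=d\alpha+\omega\wedge\alpha$. The cohomologies of $d$, $\sigma$ and $d_\omega$ are denoted by $H^*_{dR}(M)$, $H^*_{LJ}(M)$ and $H^*_\omega(M)$. Define homomorphisms of $C^\infty(M,\mathbb R)$-modules $$\bar F^k:\Omega^k(M)\to\mathcal V^k(M)\oplus\mathcal V^{k-1}(M),\qquad \bar F^k(\alpha)=(\#_\Lambda\alpha,\,-\#_\Lambda(i_E\alpha)),$$ $$\bar G^k:\mathcal V^k(M)\oplus\mathcal V^{k-1}(M)\to\Omega^{k-1}(M),\qquad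 \bar G^k(P,Q)=(-1)^k\bigl(-\flat(Q)+i_E\flat(P)\bigr).$$ Then: 1. $d^2=0$, $\sigma^2=0$, $d_\omega^2=0$, and $\bar F$ and $\bar G$ are morphisms of complexes forming a short exact sequence of complexes $$0\to(\Omega^*(M),d)\xrightarrow{\bar F}(\mathcal V^*(M)\oplus\mathcal V^{*-1}(M),-\sigma)\xrightarrow{\bar G}(\Omega^{*-1}(M),-d_\omega)\to0.$$ 2. There is a long exact sequence in cohomology, beginning with $0\to H^0_{dR}(M)\to H^0_{LJ}(M)$, $$\cdots\to H^k_{dR}(M)\xrightarrow{\bar F^k_*}H^k_{LJ}(M)\xrightarrow{\bar G^k_*}H^{k-1}_\omega(M)\xrightarrow{L^{k-1}}H^{k+1}_{dR}(M)\to\cdots,$$ where $L^{k-1}([\alpha])=[\alpha\wedge\Omega]$ is well defined. It is the connecting homomorphism in the following sense: if $c\in\mathcal V^k(M)\oplus\mathcal V^{k-1}(M)$ satisfies $d_\omega\bar G^k(c)=0$, and $\beta\in\Omega^{k+1}(M)$ is closed with $\bar F^{k+1}(\beta)=\sigma(c)$, then $L^{k-1}([\bar G^k(c)])=[\beta]$.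 Equivalently, $-L^{k-1}$ is the connecting homomorphism obtained when $-\sigma$ is used in place of $\sigma$. -/

import Mathlib

open scoped Manifold ContDiff

noncomputable section

namespace LJ

/-! ### Smooth functions and vector fields -/

/-- The ring `C^∞(M, ℝ)` of smooth functions on the `n`-dimensional manifold `M`. -/
abbrev Fn (n : ℕ) (M : Type*) [TopologicalSpace M] [ChartedSpace (EuclideanSpace ℝ (Fin n)) M] :=
  C^∞⟮𝓡 n, M; ℝ⟯

/-- Smooth vector fields on `M`: smooth sections of the tangent bundle. -/
abbrev VF (n : ℕ) (M : Type*) [TopologicalSpace M] [ChartedSpace (EuclideanSpace ℝ (Fin n)) M] 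
   [IsManifold (𝓡 n) ∞ M] :=
  Cₛ^∞⟮𝓡 n; EuclideanSpace ℝ (Fin n), (TangentSpace (𝓡 n) : M → Type _)⟯

variable {n : ℕ} {M : Type*} [TopologicalSpace M] [ChartedSpace (EuclideanSpace ℝ (Fin n)) M]
  [IsManifold (𝓡 n) ∞ M]

/-- Pointwise product of a function and a vector field. -/
instance : SMul (Fn n M) (VF n M) :=
  ⟨fun f X ↦ ⟨fun x ↦ f x • X x, f.contMDiff.smul_section X.contMDiff⟩⟩

@[simp] theorem smul_apply (f : Fn n M) (X : VF n M) (x : M) : (f • X) x = f x • X x := rfl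

instance : Module (Fn n M) (VF n M) where
  one_smul X := by ext x : 1; simp
  mul_smul f g X := by ext x : 1; simp [mul_smul]
  smul_zero f := by ext x : 1; simp
  smul_add f X Y := by ext x : 1; simp
  add_smul f g X := by ext x : 1; simp [add_smul]
  zero_smul X := by ext x : 1; simp

instance : IsScalarTower ℝ (Fn n M) (VF n M) where
  smul_assoc c f X := by ext x : 1; simp [mul_smul]

theorem fn_mdiffAt (f : Fn n M) (x : M) : MDifferentiableAt (𝓡 n) 𝓘(ℝ, ℝ) f x :=
  f.contMDiff.mdifferentiable (by simp) x

/-- The derivative `X f = df(X)` of a function along a vector field. -/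
def deriv (X : VF n M) : Fn n M →ₗ[ℝ] Fn n M where
  toFun f := ⟨fun x ↦ mvfderiv (𝓡 n) f x (X x), by
    have h1 : ContMDiff (𝓡 n).tangent 𝓘(ℝ, ℝ).tangent ∞ (tangentMap (𝓡 n) 𝓘(ℝ, ℝ) f) := 
      f.contMDiff.contMDiff_tangentMap (by simp)
    exact (contMDiff_snd_tangentBundle_modelSpace ℝ 𝓘(ℝ, ℝ)).comp (h1.comp X.contMDiff)⟩
  map_add' f g := by
    ext x
    change mvfderiv (𝓡 n) (⇑f + ⇑g) x (X x) = _
    rw [mvfderiv_add (fn_mdiffAt f x) (fn_mdiffAt g x)]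
    rfl
  map_smul' c f := by
    ext x
    change mvfderiv (𝓡 n) ((fun _ : M ↦ c) • ⇑f) x (X x) = _
    rw [mvfderiv_smul mdifferentiableAt_const (fn_mdiffAt f x)]
    simp [mvfderiv_const]
    rfl

theorem deriv_apply (X : VF n M) (f : Fn n M) (x : M) :
    deriv X f x = mvfderiv (𝓡 n) f x (X x) := rfl

theorem deriv_mul (X : VF n M) (f g : Fn n M) :
    deriv X (f * g) = f * deriv X g + deriv X f * g := by
  ext x
  change mvfderiv (𝓡 n) (⇑f * ⇑g) x (X x) = _
  rw [mvfderiv_mul (fn_mdiffAt f x) (fn_mdiffAt g x)]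
  simp [deriv_apply, mul_comm]

theorem deriv_add_left (X Y : VF n M) (f : Fn n M) :
    deriv (X + Y) f = deriv X f + deriv Y f := by
  ext x; simp [deriv_apply]

theorem deriv_smul_left (g : Fn n M) (X : VF n M) (f : Fn n M) :
    deriv (g • X) f = g * deriv X f := by
  ext x; simp [deriv_apply]

/-- The Lie bracket `[X, Y]` of vector fields. -/
def bracket (X Y : VF n M) : VF n M :=
  ⟨VectorField.mlieBracket (𝓡 n) X Y, by
    have : IsManifold (𝓡 n) ((⊤ : ℕ∞) + 1) M := by simpa
    have : IsManifold (𝓡 n) (minSmoothness ℝ 2) M := by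
      rw [minSmoothness_of_isRCLikeNormedField]; exact IsManifold.of_le (n := ∞) (WithTop.coe_le_coe.2 le_top)
    exact ContDiff.mlieBracket_vectorField (n := ⊤) (m := ⊤) X.contMDiff Y.contMDiff (by simp)⟩

theorem bracket_add_right (X Y Z : VF n M) : bracket X (Y + Z) = bracket X Y + bracket X Z := by
  ext x : 1
  exact VectorField.mlieBracket_add_right Y.mdifferentiableAt Z.mdifferentiableAt

theorem bracket_swap (X Y : VF n M) : bracket X Y = - bracket Y X := by
  ext x : 1
  exact VectorField.mlieBracket_swap_apply

theorem bracket_smul_right (f : Fn n M) (X Y : VF n M) :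
    bracket X (f • Y) = deriv X f • Y + f • bracket X Y := by
  ext x : 1
  exact VectorField.mlieBracket_smul_right (fn_mdiffAt f x) Y.mdifferentiableAt


/-- The Lie bracket `[X, ·]` as an `ℝ`-linear map. -/
def lieBracketL (X : VF n M) : VF n M →ₗ[ℝ] VF n M where
  toFun Y := bracket X Y
  map_add' := bracket_add_right X
  map_smul' c Y := by
    ext x : 1
    exact VectorField.mlieBracket_const_smul_right Y.mdifferentiableAt

theorem lieBracketL_apply (X Y : VF n M) : lieBracketL X Y = bracket X Y := rfl

/-! ### Differential forms and the exterior derivative -/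

/-- Differential `k`-forms on `M`: alternating `C^∞(M)`-multilinear maps from `k` vector fields to
functions. -/
abbrev Form (n : ℕ) (M : Type*) [TopologicalSpace M]
    [ChartedSpace (EuclideanSpace ℝ (Fin n)) M] [IsManifold (𝓡 n) ∞ M] (k : ℕ) :=
  VF n M [⋀^Fin k]→ₗ[Fn n M] Fn n M


/-- A form, regarded as an alternating map over `ℝ`. -/
def restrictReal {k : ℕ} (α : Form n M k) : VF n M [⋀^Fin k]→ₗ[ℝ] Fn n M where
  toMultilinearMap := α.toMultilinearMap.restrictScalars ℝ
  map_eq_zero_of_eq' := α.map_eq_zero_of_eq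

@[simp] theorem restrictReal_apply {k : ℕ} (α : Form n M k) (v : Fin k → VF n M) :
    restrictReal α v = α v := rfl

theorem real_smul_eq (c : ℝ) (X : VF n M) : c • X = (algebraMap ℝ (Fn n M) c) • X :=
  (algebraMap_smul _ _ _).symm


theorem form_cons_real_smul {k : ℕ} (α : Form n M (k + 1)) (c : ℝ) (X : VF n M)
    (v : Fin k → VF n M) :
    α (Matrix.vecCons (c • X) v) = c • α (Matrix.vecCons X v) := by
  have h := (α.curryLeft).map_smul (algebraMap ℝ (Fn n M) c) X
  have h' := congrArg (fun β ↦ β v) h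
  rw [real_smul_eq]
  simpa [Algebra.smul_def] using h'

/-- The map `X ↦ (Y ↦ ι_{[X, Y]} α)`. -/
def adContract {k : ℕ} (α : Form n M (k + 1)) :
    VF n M →ₗ[ℝ] VF n M →ₗ[ℝ] (VF n M [⋀^Fin k]→ₗ[ℝ] Fn n M) :=
  LinearMap.mk₂ ℝ (fun X Y ↦ restrictReal (α.curryLeft (bracket X Y)))
    (fun X X' Y ↦ by
      ext v : 1
      simp only [bracket_swap _ Y, bracket_add_right]
      simp [-map_neg, neg_add_rev, add_comm])
    (fun c X Y ↦ by
      ext v : 1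
      simp only [bracket_swap _ Y, ← lieBracketL_apply, map_smul, ← smul_neg]
      exact form_cons_real_smul α c _ v)
    (fun X Y Y' ↦ by
      ext v : 1
      simp [bracket_add_right])
    (fun c X Y ↦ by
      ext v : 1
      simp only [← lieBracketL_apply, map_smul]
      exact form_cons_real_smul α c _ v)

theorem adContract_apply {k : ℕ} (α : Form n M (k + 1)) (X Y : VF n M) (v : Fin k → VF n M) :
    adContract α X Y v = α (Matrix.vecCons (bracket X Y) v) := rfl

/-- The map `X ↦ ((X_1, …, X_k) ↦ X (α(X_1, …, X_k)))`. -/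
def derivContract {k : ℕ} (α : Form n M k) : VF n M →ₗ[ℝ] (VF n M [⋀^Fin k]→ₗ[ℝ] Fn n M) where
  toFun X := (deriv X).compAlternatingMap (restrictReal α)
  map_add' X Y := by
    ext v : 1
    simp [deriv_add_left]
  map_smul' c X := by
    ext v : 1
    simp only [LinearMap.compAlternatingMap_apply, AlternatingMap.smul_apply, RingHom.id_apply,
      real_smul_eq, deriv_smul_left, Algebra.smul_def]

theorem derivContract_apply {k : ℕ} (α : Form n M k) (X : VF n M) (v : Fin k → VF n M) :
    derivContract α X v = deriv X (α v) := rfl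

/-- The exterior derivative as an alternating map over `ℝ`; see `extDeriv_zero_apply` and
`extDeriv_succ_apply` for the resulting (Koszul) formula. -/
def koszul : {k : ℕ} → Form n M k → VF n M [⋀^Fin (k + 1)]→ₗ[ℝ] Fn n M
  | 0, α => AlternatingMap.alternatizeUncurryFin (derivContract α)
  | _ + 1, α => AlternatingMap.alternatizeUncurryFin (derivContract α) -
      (1 / 2 : ℝ) • AlternatingMap.alternatizeUncurryFin
        (AlternatingMap.alternatizeUncurryFinLM ∘ₗ adContract α)

theorem form_cons_smul {k : ℕ} (α : Form n M (k + 1)) (f : Fn n M) (X : VF n M)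
    (v : Fin k → VF n M) :
    α (Matrix.vecCons (f • X) v) = f * α (Matrix.vecCons X v) := by
  have h := (α.curryLeft).map_smul f X
  exact congrArg (fun β ↦ β v) h

theorem form_cons_add {k : ℕ} (α : Form n M (k + 1)) (X Y : VF n M)
    (v : Fin k → VF n M) :
    α (Matrix.vecCons (X + Y) v) = α (Matrix.vecCons X v) + α (Matrix.vecCons Y v) := by
  have h := (α.curryLeft).map_add X Y
  exact congrArg (fun β ↦ β v) h

theorem removeNth_succ_cons {k : ℕ} {A : Type*} (i : Fin (k + 1)) (X : A) (v : Fin (k + 1) → A) :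
    i.succ.removeNth (Matrix.vecCons X v) = Matrix.vecCons X (i.removeNth v) := by
  funext j
  refine Fin.cases ?_ (fun j ↦ ?_) j <;> simp [Fin.removeNth]

theorem form_bracket_smul_left {k : ℕ} (α : Form n M (k + 1)) (f : Fn n M) (X Y : VF n M)
    (w : Fin k → VF n M) :
    α (Matrix.vecCons (bracket (f • X) Y) w) =
      f * α (Matrix.vecCons (bracket X Y) w) - deriv Y f * α (Matrix.vecCons X w) := by
  have h : bracket (f • X) Y = f • bracket X Y + (-(deriv Y f)) • X := by
    rw [bracket_swap, bracket_smul_right, bracket_swap X Y]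
    module
  rw [h, form_cons_add, form_cons_smul, form_cons_smul, neg_mul, sub_eq_add_neg]

theorem removeNth_zero_cons {m : ℕ} {A : Type*} (Y : A) (w : Fin m → A) :
    (0 : Fin (m + 1)).removeNth (Matrix.vecCons Y w) = w := by
  funext j; simp [Fin.removeNth]

theorem form_swap {k : ℕ} (α : Form n M (k + 2)) (X Y : VF n M) (w : Fin k → VF n M) :
    α (Matrix.vecCons Y (Matrix.vecCons X w)) = - α (Matrix.vecCons X (Matrix.vecCons Y w)) := by
  rw [← α.map_swap _ (i := 0) (j := 1) (by simp)]
  congr 1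
  funext j
  refine Fin.cases ?_ (fun j ↦ Fin.cases ?_ (fun j ↦ ?_) j) j
  · simp
  · simp
  · have h1 : j.succ.succ ≠ (0 : Fin (k + 2)) := Fin.succ_ne_zero _
    have h2 : j.succ.succ ≠ (1 : Fin (k + 2)) := by
      intro h; simp [Fin.ext_iff] at h
    simp [Equiv.swap_apply_of_ne_of_ne h1 h2]

theorem inner_smul {k : ℕ} (α : Form n M (k + 1)) (f : Fn n M) (X Y : VF n M)
    (w : Fin k → VF n M) :
    ∑ j : Fin (k + 1), (-1 : ℤ) ^ (j : ℕ) • α (Matrix.vecCons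
        (bracket Y (Matrix.vecCons (f • X) w j)) (j.removeNth (Matrix.vecCons (f • X) w))) =
      f * (∑ j : Fin (k + 1), (-1 : ℤ) ^ (j : ℕ) • α (Matrix.vecCons
        (bracket Y (Matrix.vecCons X w j)) (j.removeNth (Matrix.vecCons X w)))) +
        deriv Y f * α (Matrix.vecCons X w) := by
  cases k with
  | zero =>
    simp [bracket_smul_right, form_cons_add, form_cons_smul]
    rw [add_comm]
  | succ k =>
    have key : ∀ j : Fin (k + 1), α (Matrix.vecCons (bracket Y (w j))
        (Matrix.vecCons (f • X) (j.removeNth w))) =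
        f * α (Matrix.vecCons (bracket Y (w j)) (Matrix.vecCons X (j.removeNth w))) := fun j ↦ by
      rw [form_swap, form_cons_smul, form_swap α X, mul_neg]
    rw [Fin.sum_univ_succ, Fin.sum_univ_succ (n := k + 1)]
    simp only [removeNth_succ_cons, removeNth_zero_cons, Matrix.cons_val_zero,
      Matrix.cons_val_succ, bracket_smul_right, form_cons_add, form_cons_smul, key,
      mul_add, Finset.mul_sum, mul_smul_comm, Fin.val_zero, pow_zero, one_smul]
    abel

theorem koszul_smul {k : ℕ} (α : Form n M k) (f : Fn n M) (X : VF n M) (v : Fin k → VF n M) :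
    koszul α (Matrix.vecCons (f • X) v) = f * koszul α (Matrix.vecCons X v) := by
  cases k with
  | zero =>
    simp [koszul, AlternatingMap.alternatizeUncurryFin_apply, derivContract_apply, deriv_smul_left]
  | succ k =>
    simp only [koszul, AlternatingMap.sub_apply, AlternatingMap.smul_apply,
      AlternatingMap.alternatizeUncurryFin_apply, derivContract_apply, LinearMap.comp_apply,
      AlternatingMap.alternatizeUncurryFinLM_apply, adContract_apply]
    rw [Fin.sum_univ_succ, Fin.sum_univ_succ (n := k + 1), Fin.sum_univ_succ (n := k + 1),
      Fin.sum_univ_succ (n := k + 1)]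
    simp only [removeNth_succ_cons, removeNth_zero_cons, Matrix.cons_val_zero, Matrix.cons_val_succ,
      inner_smul, form_cons_smul, deriv_mul, deriv_smul_left, form_bracket_smul_left,
      smul_add, smul_sub, Finset.sum_add_distrib, Finset.sum_sub_distrib, mul_sub, mul_add, Finset.mul_sum, mul_smul_comm,
      Fin.val_zero, pow_zero, one_smul, Fin.val_succ, pow_succ, mul_neg, mul_one, neg_smul,
      smul_neg, Finset.sum_neg_distrib]
    module

/-- An alternating map over `ℝ` which is `C^∞(M)`-homogeneous in its first argument is
`C^∞(M)`-multilinear. -/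
def ofHomogeneous {k : ℕ} (T : VF n M [⋀^Fin (k + 1)]→ₗ[ℝ] Fn n M)
    (hT : ∀ (f : Fn n M) (X : VF n M) (v : Fin k → VF n M),
      T (Matrix.vecCons (f • X) v) = f * T (Matrix.vecCons X v)) : Form n M (k + 1) where
  toFun := T
  map_update_add' v i X Y := by
    convert T.map_update_add v i X Y
  map_update_smul' {inst} v i f X := by
    obtain rfl : inst = instDecidableEqFin (k + 1) := Subsingleton.elim _ _
    have h : ∀ Z : VF n M, Function.update v i Z = i.insertNth Z (i.removeNth v) := fun Z ↦ by
      rw [Fin.insertNth_removeNth]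
    rw [h, h, T.map_insertNth, T.map_insertNth, hT, smul_eq_mul, mul_smul_comm]
  map_eq_zero_of_eq' := T.map_eq_zero_of_eq

/-- The exterior derivative `d : Ω^k(M) → Ω^(k+1)(M)`. -/
def extDeriv (k : ℕ) : Form n M k →ₗ[ℝ] Form n M (k + 1) where
  toFun α := ofHomogeneous (koszul α) (koszul_smul α)
  map_add' α β := by
    ext v : 1
    change koszul (α + β) v = koszul α v + koszul β v
    cases k <;> simp [koszul, AlternatingMap.alternatizeUncurryFin_apply, derivContract_apply,
      adContract_apply, Finset.sum_add_distrib]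
    module
  map_smul' c α := by
    ext v : 1
    change koszul (c • α) v = c • koszul α v
    have h1 : derivContract (c • α) = c • derivContract α := by
      ext X v : 2
      simp [derivContract_apply]
    cases k with
    | zero => simp [koszul, h1]
    | succ k =>
      have h2 : adContract (c • α) = c • adContract α := by
        ext X Y v : 3
        simp [adContract_apply]
      simp only [koszul, h1, h2, LinearMap.comp_smul, AlternatingMap.alternatizeUncurryFin_smul,
        AlternatingMap.sub_apply, AlternatingMap.smul_apply, smul_sub]
      rw [smul_comm]

/-- `(df)(X) = X f`. -/
theorem extDeriv_zero_apply (f : Form n M 0) (v : Fin 1 → VF n M) :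
    extDeriv 0 f v = deriv (v 0) (f ![]) := by
  change koszul f v = _
  simp [koszul, AlternatingMap.alternatizeUncurryFin_apply, derivContract_apply]
  congr
  exact Subsingleton.elim _ _

/-- The invariant formula for the exterior derivative of a form of positive degree. The index pair
`i ≤ j` stands for the positions `i < j + 1`, whence the minus sign. -/
theorem extDeriv_succ_apply (k : ℕ) (α : Form n M (k + 1)) (v : Fin (k + 2) → VF n M) :
    extDeriv (k + 1) α v =
      (∑ i : Fin (k + 2), (-1 : ℤ) ^ (i : ℕ) • deriv (v i) (α (i.removeNth v))) -
        ∑ i : Fin (k + 1), ∑ j ≥ i, (-1 : ℤ) ^ (i + j : ℕ) •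
          α (Matrix.vecCons (bracket (v i.castSucc) (v j.succ))
            (j.removeNth (i.castSucc.removeNth v))) := by
  change koszul α v = _
  simp only [koszul, AlternatingMap.sub_apply, AlternatingMap.smul_apply]
  rw [AlternatingMap.alternatizeUncurryFin_alternatizeUncurryFinLM_comp_apply,
    AlternatingMap.alternatizeUncurryFin_apply]
  congr 1
  rw [Finset.smul_sum]
  refine Finset.sum_congr rfl fun i _ ↦ ?_
  rw [Finset.smul_sum]
  refine Finset.sum_congr rfl fun j _ ↦ ?_
  have h : ∀ (X Y : VF n M) (w : Fin k → VF n M),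
      adContract α X Y w - adContract α Y X w = (2 : ℝ) • α (Matrix.vecCons (bracket X Y) w) := by
    intro X Y w
    have h' : α (Matrix.vecCons (-bracket X Y) w) = - α (Matrix.vecCons (bracket X Y) w) := by
      have := congrArg (fun β ↦ β w) ((α.curryLeft).map_neg (bracket X Y))
      exact this
    rw [adContract_apply, adContract_apply, bracket_swap Y X, h']
    module
  rw [h]
  module

section Algebra

variable {R N : Type*} [CommRing R] [AddCommGroup N] [Module R N]

/-! ### Exterior algebra -/

/-- The wedge product of alternating maps with values in the ring (sum over shuffles). -/
def wedge {p q m : ℕ} (a : N [⋀^Fin p]→ₗ[R] R) (b : N [⋀^Fin q]→ₗ[R] R)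
    (h : p + q = m := by omega) : N [⋀^Fin m]→ₗ[R] R :=
  ((LinearMap.mul' R R).compAlternatingMap (a.domCoprod b)).domDomCongr
    (finSumFinEquiv.trans (finCongr h))

/-- Scalars from `S` act on alternating maps through `R`. -/
instance {S : Type*} [CommRing S] [Algebra S R] {k : ℕ} :
    IsScalarTower S R (N [⋀^Fin k]→ₗ[R] R) :=
  ⟨fun c r a ↦ by ext v; simp⟩

theorem wedge_add {p q m : ℕ} (a : N [⋀^Fin p]→ₗ[R] R) (b b' : N [⋀^Fin q]→ₗ[R] R)
    (h : p + q = m) : wedge a (b + b') h = wedge a b h + wedge a b' h := by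
  simp [wedge, ← AlternatingMap.domCoprod'_apply, TensorProduct.tmul_add, map_add]

theorem wedge_smul {S : Type*} [CommRing S] [Algebra S R] {p q m : ℕ} (a : N [⋀^Fin p]→ₗ[R] R)
    (c : S) (b : N [⋀^Fin q]→ₗ[R] R) (h : p + q = m) :
    wedge a (c • b) h = c • wedge a b h := by
  rw [← algebraMap_smul R c b, ← algebraMap_smul R c (wedge a b h)]
  simp only [wedge, ← AlternatingMap.domCoprod'_apply, TensorProduct.tmul_smul, map_smul]
  ext v
  simp

theorem add_wedge {p q m : ℕ}
    (a a' : N [⋀^Fin p]→ₗ[R] R) (b : N [⋀^Fin q]→ₗ[R] R)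
    (h : p + q = m) : wedge (a + a') b h = wedge a b h + wedge a' b h := by
  simp [wedge, ← AlternatingMap.domCoprod'_apply, TensorProduct.add_tmul, map_add]

theorem smul_wedge {S : Type*} [CommRing S] [Algebra S R] {p q m : ℕ} (c : S) (a : N [⋀^Fin p]→ₗ[R] R)
    (b : N [⋀^Fin q]→ₗ[R] R) (h : p + q = m) :
    wedge (c • a) b h = c • wedge a b h := by
  rw [← algebraMap_smul R c a, ← algebraMap_smul R c (wedge a b h)]
  simp only [wedge, ← AlternatingMap.domCoprod'_apply, ← TensorProduct.smul_tmul', map_smul]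
  ext v
  simp

theorem wedge_compLinearMap {N' : Type*} [AddCommGroup N'] [Module R N'] {p q m : ℕ}
    (a : N [⋀^Fin p]→ₗ[R] R) (b : N [⋀^Fin q]→ₗ[R] R) (g : N' →ₗ[R] N) (h : p + q = m) :
    (wedge a b h).compLinearMap g = wedge (a.compLinearMap g) (b.compLinearMap g) h := by
  subst h
  ext v
  simp only [wedge, AlternatingMap.compLinearMap_apply, AlternatingMap.domDomCongr_apply,
    LinearMap.compAlternatingMap_apply, AlternatingMap.domCoprod_apply, _root_.sum_apply, map_sum]
  refine Finset.sum_congr rfl fun σ _ ↦ ?_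
  induction σ using Quotient.inductionOn' with
  | h σ =>
    simp only [AlternatingMap.domCoprod.summand_mk'']
    simp

/-- A linear form, regarded as an alternating map in one variable. -/
def toDegOne (φ : N →ₗ[R] R) : N [⋀^Fin 1]→ₗ[R] R := AlternatingMap.ofSubsingleton R N R 0 φ

/-- The inverse of a bijective linear map (and `0` if the map is not bijective). -/
def inverseMap {N' : Type*} [AddCommGroup N'] [Module R N'] (f : N →ₗ[R] N') : N' →ₗ[R] N :=
  open Classical in
  if h : Function.Bijective f then (LinearEquiv.ofBijective f h).symm else 0

/-- Pullback of alternating maps along a linear map. -/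
def pullback {N' : Type*} [AddCommGroup N'] [Module R N'] (g : N' →ₗ[R] N) (k : ℕ) :
    (N [⋀^Fin k]→ₗ[R] R) →ₗ[R] (N' [⋀^Fin k]→ₗ[R] R) where
  toFun a := a.compLinearMap g
  map_add' _ _ := rfl
  map_smul' _ _ := rfl

end Algebra

/-! ### Multivector fields and the Schouten-Nijenhuis bracket -/

/-- Differential `1`-forms, as `C^∞(M)`-linear maps from vector fields to functions. -/
abbrev OneForm (n : ℕ) (M : Type*) [TopologicalSpace M]
    [ChartedSpace (EuclideanSpace ℝ (Fin n)) M] [IsManifold (𝓡 n) ∞ M] :=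
  VF n M →ₗ[Fn n M] Fn n M

/-- `k`-vectors on `M`: alternating `C^∞(M)`-multilinear maps from `k` one-forms to functions. -/
abbrev MultiVF (n : ℕ) (M : Type*) [TopologicalSpace M]
    [ChartedSpace (EuclideanSpace ℝ (Fin n)) M] [IsManifold (𝓡 n) ∞ M] (k : ℕ) :=
  OneForm n M [⋀^Fin k]→ₗ[Fn n M] Fn n M

/-- A vector field as a `1`-vector, `X(α) = α(X)`. -/
def vec (X : VF n M) : MultiVF n M 1 := toDegOne (Module.Dual.eval (Fn n M) (VF n M) X)

/-- The differential `df` of a function. -/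
def dFn (f : Fn n M) : OneForm n M where
  toFun X := deriv X f
  map_add' X Y := deriv_add_left X Y f
  map_smul' g X := deriv_smul_left g X f

/-- The insertion of a `q`-vector `Q` into a `p`-vector `P`, as an operation on functions: the sum
over all `(q, p - 1)`-shuffles `τ` of `sign τ • P(d(Q(df_τ1, …, df_τq)), df_τ(q+1), …, df_τm)` with
`m = p + q - 1`, written as a normalized sum over all permutations. -/
def insertion {p q m : ℕ} (h : m + 1 = p + q) (P : MultiVF n M p) (Q : MultiVF n M q)
    (f : Fin m → Fn n M) : Fn n M :=
  match p, h, P with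
  | 0, _, _ => 0
  | p + 1, h, P =>
    ((q.factorial * p.factorial : ℝ)⁻¹) • ∑ τ : Equiv.Perm (Fin m), (Equiv.Perm.sign τ : ℤ) •
      P (Matrix.vecCons
        (dFn (Q fun i : Fin q ↦ dFn (f (τ (Fin.cast (by omega) (Fin.castAdd p i))))))
        (fun j : Fin p ↦ dFn (f (τ (Fin.cast (by omega) (Fin.natAdd q j))))))

/-- The bilinear map `B` is the Schouten-Nijenhuis bracket of `p`-vectors with `q`-vectors: on exact
`1`-forms it is given by the graded commutator of multiderivations. The sign convention is the one
for which `[X, Q]` is the Lie derivative of `Q` along the vector field `X`, `[P, Q] = (-1)^(p q) [Q, P]`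
and `[X_1 ∧ ⋯ ∧ X_p, Q] = ∑ (-1)^(i+1) X_1 ∧ ⋯ (omit X_i) ⋯ ∧ X_p ∧ [X_i, Q]`. -/
def IsSchouten {p q m : ℕ} (h : m + 1 = p + q)
    (B : MultiVF n M p →ₗ[ℝ] MultiVF n M q →ₗ[ℝ] MultiVF n M m) : Prop :=
  ∀ (P : MultiVF n M p) (Q : MultiVF n M q) (f : Fin m → Fn n M),
    B P Q (fun i ↦ dFn (f i)) =
      (-1 : ℤ) ^ ((p + 1) * q) • insertion h P Q f +
        (-1 : ℤ) ^ p • insertion (h.trans (add_comm p q)) Q P f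

/-- The Schouten-Nijenhuis bracket as a bilinear map. Such a map exists since multiderivations of
`C^∞(M)` are the same as multivector fields, and it is unique since exact `1`-forms generate all
`1`-forms locally. -/
def schoutenBilin {p q m : ℕ} (h : m + 1 = p + q) :
    MultiVF n M p →ₗ[ℝ] MultiVF n M q →ₗ[ℝ] MultiVF n M m :=
  open Classical in
  if hB : ∃ B : MultiVF n M p →ₗ[ℝ] MultiVF n M q →ₗ[ℝ] MultiVF n M m, IsSchouten h B
  then hB.choose else 0

/-- The Schouten-Nijenhuis bracket `[P, Q]` of a `p`-vector and a `q`-vector. -/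
abbrev schouten {p q m : ℕ} (P : MultiVF n M p) (Q : MultiVF n M q)
    (h : m + 1 = p + q := by omega) : MultiVF n M m :=
  schoutenBilin h P Q

/-! ### Locally conformal symplectic manifolds -/

/-- `♭ : X ↦ i_X Ω` from vector fields to `1`-forms. -/
def flatOne (Ω : Form n M 2) : VF n M →ₗ[Fn n M] OneForm n M :=
  LinearMap.mk₂ (Fn n M) (fun X Y ↦ Ω ![X, Y])
    (fun X X' _ ↦ form_cons_add Ω X X' _)
    (fun f X _ ↦ form_cons_smul Ω f X _)
    (fun X _ _ ↦ form_cons_add (Ω.curryLeft X) _ _ _)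
    (fun f X Y ↦ form_cons_smul (Ω.curryLeft X) f Y _)

/-- The extension of `♭` to `k`-vectors with `♭(X_1 ∧ ⋯ ∧ X_k) = ♭X_1 ∧ ⋯ ∧ ♭X_k`; in terms of
alternating maps `(♭P)(Y_1, …, Y_k) = (-1)^k P(♭Y_1, …, ♭Y_k)`. See `flat_vec` and `flat_wedge`. -/
def flat (Ω : Form n M 2) (k : ℕ) : MultiVF n M k →ₗ[Fn n M] Form n M k :=
  (-1 : ℤ) ^ k • pullback (flatOne Ω) k

/-- `Λ(α, β) = Ω(♭⁻¹ α, ♭⁻¹ β)`. -/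
def bivector (Ω : Form n M 2) : MultiVF n M 2 := Ω.compLinearMap (inverseMap (flatOne Ω))

/-- `E = ♭⁻¹ ω` for the Lee form `ω`. -/
def leeVF (Ω : Form n M 2) (lee : OneForm n M) : VF n M := inverseMap (flatOne Ω) lee

/-- `#_Λ` from `1`-forms to vector fields: `β(#_Λ α) = Λ(α, β)`, where vector fields are identified
with linear functionals on `1`-forms by evaluation. -/
def sharpOne (Λ : MultiVF n M 2) : OneForm n M →ₗ[Fn n M] VF n M :=
  inverseMap (Module.Dual.eval (Fn n M) (VF n M)) ∘ₗ
  LinearMap.mk₂ (Fn n M) (fun X Y ↦ Λ ![X, Y])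
    (fun X X' Y ↦ by exact congrArg (fun β ↦ β ![Y]) ((Λ.curryLeft).map_add X X'))
    (fun f X Y ↦ by exact congrArg (fun β ↦ β ![Y]) ((Λ.curryLeft).map_smul f X))
    (fun X Y Y' ↦ by exact congrArg (fun β ↦ β ![]) (((Λ.curryLeft X).curryLeft).map_add Y Y'))
    (fun f X Y ↦ by exact congrArg (fun β ↦ β ![]) (((Λ.curryLeft X).curryLeft).map_smul f Y))

/-- `#_Λ` from `k`-forms to `k`-vectors: `(#_Λ α)(α_1, …, α_k) = (-1)^k α(#_Λ α_1, …, #_Λ α_k)`. -/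
def sharp (Λ : MultiVF n M 2) (k : ℕ) : Form n M k →ₗ[Fn n M] MultiVF n M k :=
  (-1 : ℤ) ^ k • pullback (sharpOne Λ) k


/-! ### Shifted complexes and cohomology -/

section Shift

universe u

/-- The graded space `C^(* - 1)`: it vanishes in degree `0` and is `C^k` in degree `k + 1`. -/
def Shift (C : ℕ → Type u) : ℕ → Type u
  | 0 => PUnit
  | k + 1 => C k

variable {C : ℕ → Type u}

instance [∀ k, AddCommGroup (C k)] : ∀ k, AddCommGroup (Shift C k)
  | 0 => inferInstanceAs (AddCommGroup PUnit)
  | k + 1 => inferInstanceAs (AddCommGroup (C k))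

instance {S : Type*} [Semiring S] [∀ k, AddCommGroup (C k)] [∀ k, Module S (C k)] :
    ∀ k, Module S (Shift C k)
  | 0 =>
    { smul := fun _ _ ↦ PUnit.unit
      one_smul := fun _ ↦ rfl
      mul_smul := fun _ _ _ ↦ rfl
      smul_zero := fun _ ↦ rfl
      smul_add := fun _ _ _ ↦ rfl
      add_smul := fun _ _ _ ↦ rfl
      zero_smul := fun _ ↦ rfl }
  | k + 1 => by
    change Module S (C k)
    infer_instance

instance {S T : Type*} [Semiring S] [Semiring T] [SMul S T] [∀ k, AddCommGroup (C k)]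
    [∀ k, Module S (C k)] [∀ k, Module T (C k)] [∀ k, IsScalarTower S T (C k)] :
    ∀ k, IsScalarTower S T (Shift C k)
  | 0 => ⟨fun _ _ _ ↦ rfl⟩
  | k + 1 => by
    change IsScalarTower S T (C k)
    infer_instance

/-- A differential (or any map of degree `1`) on the shifted graded space. -/
def shiftMap {S : Type*} [Semiring S] [∀ k, AddCommGroup (C k)] [∀ k, Module S (C k)]
    (d : ∀ k, C k →ₗ[S] C (k + 1)) : ∀ k, Shift C k →ₗ[S] Shift C (k + 1)
  | 0 => 0
  | k + 1 => d k

/-- A map of degree `0` on shifted graded spaces. -/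
def shiftHom {S : Type*} [Semiring S] {C' : ℕ → Type u} [∀ k, AddCommGroup (C k)]
    [∀ k, Module S (C k)] [∀ k, AddCommGroup (C' k)] [∀ k, Module S (C' k)]
    (f : ∀ k, C k →ₗ[S] C' k) : ∀ k, Shift C k →ₗ[S] Shift C' k
  | 0 => 0
  | k + 1 => f k

end Shift

section Cohomology

variable {A B : ℕ → Type*} [∀ k, AddCommGroup (A k)] [∀ k, Module ℝ (A k)]
  [∀ k, AddCommGroup (B k)] [∀ k, Module ℝ (B k)]

/-- Coboundaries of a complex `A^0 → A^1 → ⋯`. -/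
def coboundaries (d : ∀ k, A k →ₗ[ℝ] A (k + 1)) : ∀ k, Submodule ℝ (A k)
  | 0 => ⊥
  | k + 1 => LinearMap.range (d k)

/-- Cocycles of a complex `A^0 → A^1 → ⋯`. -/
abbrev cocycles (d : ∀ k, A k →ₗ[ℝ] A (k + 1)) (k : ℕ) : Submodule ℝ (A k) := LinearMap.ker (d k)

/-- The `k`-th cohomology space, cocycles modulo coboundaries. -/
abbrev Cohomology (d : ∀ k, A k →ₗ[ℝ] A (k + 1)) (k : ℕ) :=
  cocycles d k ⧸ (coboundaries d k).submoduleOf (cocycles d k)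

/-- The cohomology class of a cocycle. -/
def cohClass (d : ∀ k, A k →ₗ[ℝ] A (k + 1)) (k : ℕ) (a : A k) (ha : d k a = 0) :
    Cohomology d k :=
  Submodule.Quotient.mk ⟨a, ha⟩

/-- The linear map `f : A^k → B^l` sends cocycles to cocycles and coboundaries to coboundaries. -/
def Induces (dA : ∀ k, A k →ₗ[ℝ] A (k + 1)) (dB : ∀ k, B k →ₗ[ℝ] B (k + 1)) {k l : ℕ}
    (f : A k →ₗ[ℝ] B l) : Prop :=
  cocycles dA k ≤ (cocycles dB l).comap f ∧ coboundaries dA k ≤ (coboundaries dB l).comap f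

/-- The map `[a] ↦ [f a]` in cohomology. -/
def inducedMap {dA : ∀ k, A k →ₗ[ℝ] A (k + 1)} {dB : ∀ k, B k →ₗ[ℝ] B (k + 1)} {k l : ℕ}
    {f : A k →ₗ[ℝ] B l} (h : Induces dA dB f) : Cohomology dA k →ₗ[ℝ] Cohomology dB l :=
  Submodule.mapQ _ _ (f.restrict h.1) fun _ ha ↦ h.2 ha

/-- Let `0 → A → B → C → 0` be a short exact sequence of complexes, given by the maps `F` and `G`
and the differentials `dA`, `dB`, `dC`. The map `δ : H^k(C) → H^(k+1)(A)` is the connecting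
homomorphism: if `b` lifts a cocycle, `G b = c`, and `F a = dB b`, then `δ [c] = [a]`. -/
def IsConnectingHom {C : ℕ → Type*} [∀ k, AddCommGroup (C k)] [∀ k, Module ℝ (C k)]
    (dA : ∀ k, A k →ₗ[ℝ] A (k + 1)) (dB : ∀ k, B k →ₗ[ℝ] B (k + 1))
    (dC : ∀ k, C k →ₗ[ℝ] C (k + 1)) (F : ∀ k, A k →ₗ[ℝ] B k) (G : ∀ k, B k →ₗ[ℝ] C k) (k : ℕ)
    (δ : Cohomology dC k →ₗ[ℝ] Cohomology dA (k + 1)) : Prop :=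
  ∀ (b : B k) (hb : dC k (G k b) = 0) (a : A (k + 1)) (ha : dA (k + 1) a = 0),
    F (k + 1) a = dB k b → δ (cohClass dC k (G k b) hb) = cohClass dA (k + 1) a ha

end Cohomology

/-! ### The complexes of the theorem -/

/-- Lichnerowicz-Jacobi cochains: pairs of a `k`-vector and a `(k - 1)`-vector. -/
abbrev LJCochain (n : ℕ) (M : Type*) [TopologicalSpace M]
    [ChartedSpace (EuclideanSpace ℝ (Fin n)) M] [IsManifold (𝓡 n) ∞ M] (k : ℕ) :=
  MultiVF n M k × Shift (MultiVF n M) k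

/-- First component of the LJ-operator in degree `k + 1`: `-[Λ, P] + (k + 1) E ∧ P + Λ ∧ Q`. -/
def sigmaFst (Λ : MultiVF n M 2) (E : VF n M) {k : ℕ} (P : MultiVF n M (k + 1))
    (Q : MultiVF n M k) : MultiVF n M (k + 2) :=
  -(schouten Λ P) + ((k + 1 : ℕ) : ℝ) • wedge (vec E) P (m := k + 2) + wedge Λ Q (m := k + 2)

/-- Second component of the LJ-operator in degree `k + 1`: `[Λ, Q] - k E ∧ Q + [E, P]`. -/
def sigmaSnd (Λ : MultiVF n M 2) (E : VF n M) {k : ℕ} (P : MultiVF n M (k + 1))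
    (Q : MultiVF n M k) : MultiVF n M (k + 1) :=
  schouten Λ Q - (k : ℝ) • wedge (vec E) Q (m := k + 1) + schouten (vec E) P

/-- The LJ-cohomology operator
`σ(P, Q) = (-[Λ, P] + k E ∧ P + Λ ∧ Q, [Λ, Q] - (k - 1) E ∧ Q + [E, P])` on `k`-cochains. -/
def ljDifferential (Λ : MultiVF n M 2) (E : VF n M) :
    ∀ k, LJCochain n M k →ₗ[ℝ] LJCochain n M (k + 1)
  | 0 =>
    { toFun := fun c ↦ (-(schouten Λ c.1), (schouten (vec E) c.1 : MultiVF n M 0))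
      map_add' := fun c c' ↦ by
        rw [Prod.fst_add, schouten, map_add, schouten, map_add, neg_add]; rfl
      map_smul' := fun r c ↦ by
        rw [Prod.smul_fst, schouten, map_smul, schouten, map_smul]
        exact Prod.ext (smul_neg _ _).symm rfl }
  | k + 1 =>
    { toFun := fun c ↦ (sigmaFst Λ E c.1 (c.2 : MultiVF n M k), sigmaSnd Λ E c.1 (c.2 : MultiVF n M k))
      map_add' := fun c c' ↦ by
        obtain ⟨P, Q⟩ := c
        obtain ⟨P', Q'⟩ := c'
        change MultiVF n M k at Q Q'
        refine Prod.ext ?_ ?_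
        · change sigmaFst Λ E (P + P') (Q + Q') = sigmaFst Λ E P Q + sigmaFst Λ E P' Q'
          simp only [sigmaFst, map_add, wedge_add, smul_add, neg_add]
          abel
        · change sigmaSnd Λ E (P + P') (Q + Q') = sigmaSnd Λ E P Q + sigmaSnd Λ E P' Q'
          simp only [sigmaSnd, map_add, wedge_add, smul_add, sub_eq_add_neg, neg_add]
          abel
      map_smul' := fun r c ↦ by
        obtain ⟨P, Q⟩ := c
        change MultiVF n M k at Q
        refine Prod.ext ?_ ?_
        · change sigmaFst Λ E (r • P) (r • Q) = r • sigmaFst Λ E P Q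
          simp only [sigmaFst, map_smul, wedge_smul]
          module
        · change sigmaSnd Λ E (r • P) (r • Q) = r • sigmaSnd Λ E P Q
          simp only [sigmaSnd, map_smul, wedge_smul]
          module }

/-- The interior product `i_X : Ω^k(M) → Ω^(k-1)(M)`. -/
def interior (X : VF n M) : ∀ k, Form n M k →ₗ[Fn n M] Shift (Form n M) k
  | 0 => 0
  | k + 1 =>
    { toFun := fun α ↦ (α.curryLeft X : Form n M k)
      map_add' := fun _ _ ↦ rfl
      map_smul' := fun _ _ ↦ rfl }

/-- The operator `d_ω α = dα + ω ∧ α`. -/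
def lichnerowicz (lee : OneForm n M) (k : ℕ) : Form n M k →ₗ[ℝ] Form n M (k + 1) where
  toFun α := extDeriv k α + wedge (toDegOne lee) α
  map_add' α β := by rw [map_add, wedge_add]; abel
  map_smul' c α := by rw [map_smul, wedge_smul, smul_add]; rfl

/-- The map `α ↦ α ∧ Ω` from `Ω^(k-1)(M)` to `Ω^(k+1)(M)`. -/
def wedgeRight (Ω : Form n M 2) : ∀ k, Shift (Form n M) k →ₗ[ℝ] Form n M (k + 1)
  | 0 => 0
  | k + 1 => 
    { toFun := fun α ↦ wedge (α : Form n M k) Ω (m := k + 2)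
      map_add' := fun α β ↦ add_wedge (α : Form n M k) β Ω _
      map_smul' := fun c α ↦ smul_wedge c (α : Form n M k) Ω _ }

/-- `F(α) = (#_Λ α, -#_Λ(i_E α))`. -/
def Fbar (Λ : MultiVF n M 2) (E : VF n M) (k : ℕ) : Form n M k →ₗ[Fn n M] LJCochain n M k :=
  (sharp Λ k).prod (-(shiftHom (sharp Λ) k ∘ₗ interior E k))

/-- `G(P, Q) = (-1)^k (-♭Q + i_E ♭P)` on `k`-cochains. -/
def Gbar (Ω : Form n M 2) (E : VF n M) (k : ℕ) :
    LJCochain n M k →ₗ[Fn n M] Shift (Form n M) k :=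
  (-1 : ℤ) ^ k • (-(shiftHom (flat Ω) k ∘ₗ LinearMap.snd _ _ _) +
    interior E k ∘ₗ flat Ω k ∘ₗ LinearMap.fst _ _ _)

/-- `Ω` is a locally conformal symplectic form on `M` with Lee form `lee`: it is nondegenerate at
every point, the Lee form is closed, and `dΩ = lee ∧ Ω`. -/
structure IsLCS (Ω : Form n M 2) (lee : OneForm n M) : Prop where
  nondegenerate : ∀ (x : M) (X : VF n M), (∀ Y, Ω ![X, Y] x = 0) → X x = 0
  lee_closed : extDeriv 1 (toDegOne lee) = 0
  extDeriv_eq : extDeriv 2 Ω = wedge (toDegOne lee) Ω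

theorem flat_vec (Ω : Form n M 2) (X : VF n M) : flat Ω 1 (vec X) = toDegOne (flatOne Ω X) := by
  ext v : 1
  change (-1 : ℤ) ^ 1 • Ω ![v 0, X] = Ω ![X, v 0]
  have := form_swap Ω X (v 0) ![]
  rw [this]
  simp

theorem flat_wedge (Ω : Form n M 2) {p q : ℕ} (P : MultiVF n M p) (Q : MultiVF n M q) :
    flat Ω (p + q) (wedge P Q) = wedge (flat Ω p P) (flat Ω q Q) := by
  simp only [flat, LinearMap.smul_apply]
  rw [smul_wedge, wedge_smul, smul_smul, pow_add]
  exact congrArg _ (wedge_compLinearMap P Q (flatOne Ω) _)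

end LJ

end

/-! Composing with `♭` in every argument turns a k-vector P into a k-form p = P ∘ ♭; likewise q = Q
∘ ♭. In the coordinates (p, γ) with γ = q + i_E p, the map F̄ is α ↦ (α, 0), Ḡ is the projection to
γ (`coneEquiv_Fbar`, `coneEquiv_snd`), and σ becomes (p, γ) ↦ (-dp + γ ∧ Ω, d_ω γ)
(`IsLCS.coneEquiv_ljDifferential`). So the LJ complex is the mapping cone of L : γ ↦ γ ∧ Ω, which
satisfies d L = L d_ω because dΩ = ω ∧ Ω. All assertions are then formal for cones (`IsCone`). In
particular σ² = 0 follows from d² = 0, d_ω² = 0 and d L = L d_ω, without any graded Jacobi identity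
for the Schouten bracket.

The work lies in computing σ in these coordinates. The operator [Λ, ·] is minus the differential of
the skew algebroid on 1-forms with anchor #_Λ and the Koszul bracket (`schouten_bivector`), and [E,
·] is the Lie derivative (`schouten_vec`). Contracting dΩ = ω ∧ Ω twice shows that, up to sign, ♭
carries the bracket [X, Y] + ω(X) Y - ω(Y) X + Ω(X, Y) E to the Koszul bracket
(`IsLCS.koszulBracket_flatOne`). By Cartan's formula and induction on the degree, [Λ, Q] pulls back
to dq - k ω ∧ q - Ω ∧ i_E q for Q of degree k (`IsLCS.pullback_schouten`), while L_E Ω = 0 makes [E,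
P] pull back to L_E p. Substitution leaves exactly the cone differential.

The exterior calculus is algebraic: an alternating map of positive degree is determined by its
contractions, so identities for ∧, L_X and d are proved by contracting and inducting on the degree.
The differential of a skew algebroid satisfies Cartan's formula without the Jacobi identity, which
enters only for d² = 0 on the tangent bundle. Geometry enters through the commutator formula
`deriv_bracket`, through local frames, which show that multivectors are determined on exact 1-forms
and hence make the Schouten bracket computable, and through the bijectivity of ♭
(`flatOne_bijective`). -/

noncomputable section

namespace LJ

/-! ### Signed sums over permutations, split by one distinguished index -/

section PermSums

open Equiv

/-- The extension of a permutation of `Fin m` to `Fin (m + 1)` fixing `0`. -/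
def extendPerm {m : ℕ} (τ : Perm (Fin m)) : Perm (Fin (m + 1)) := Perm.decomposeFin.symm (0, τ)

@[simp] theorem extendPerm_zero {m : ℕ} (τ : Perm (Fin m)) : extendPerm τ 0 = 0 := by
  simp [extendPerm]

@[simp] theorem extendPerm_succ {m : ℕ} (τ : Perm (Fin m)) (i : Fin m) :
    extendPerm τ i.succ = (τ i).succ := by
  simp [extendPerm]

@[simp] theorem sign_extendPerm {m : ℕ} (τ : Perm (Fin m)) :
    Perm.sign (extendPerm τ) = Perm.sign τ := by
  simp [extendPerm]

theorem extendPerm_injective {m : ℕ} : Function.Injective (extendPerm (m := m)) := fun τ τ' h ↦ by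
  simpa using Perm.decomposeFin.symm.injective h

/-- The product sends j to 0, since `j.cycleRange` does and the extension fixes 0; this recovers j
and then τ. Injectivity suffices, both sides having (m + 1)! elements. -/
theorem bijective_extendPerm_mul_cycleRange (m : ℕ) : Function.Bijective
    fun x : Fin (m + 1) × Perm (Fin m) ↦ extendPerm x.2 * x.1.cycleRange := by
  rw [Fintype.bijective_iff_injective_and_card]
  refine ⟨fun ⟨j, τ⟩ ⟨j', τ'⟩ h ↦ ?_, by simp [Fintype.card_perm, Nat.factorial_succ]⟩
  dsimp only at h
  have h0 : j = j' := by
    by_contra hne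
    have h1 := congrArg (fun σ ↦ σ j) h
    simp only [Perm.mul_apply, Fin.cycleRange_self, extendPerm_zero] at h1
    have h2 : j'.cycleRange j = 0 :=
      (extendPerm τ').injective (by rw [← h1, extendPerm_zero])
    exact hne (j'.cycleRange.injective (by rw [h2, Fin.cycleRange_self]))
  subst h0
  rw [extendPerm_injective (mul_right_cancel h)]

theorem bijective_cycleRange_inv_mul_extendPerm (m : ℕ) : Function.Bijective
    fun x : Fin (m + 1) × Perm (Fin m) ↦ x.1.cycleRange⁻¹ * extendPerm x.2 := by
  rw [Fintype.bijective_iff_injective_and_card]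
  refine ⟨fun ⟨j, τ⟩ ⟨j', τ'⟩ h ↦ ?_, by simp [Fintype.card_perm, Nat.factorial_succ]⟩
  dsimp only at h
  have h0 : j = j' := by
    have h1 := congrArg (fun σ ↦ σ 0) h
    simpa [Perm.mul_apply, Perm.inv_def, Fin.cycleRange_symm_zero] using h1
  subst h0
  rw [extendPerm_injective (mul_left_cancel h)]

variable {A G : Type*} [AddCommGroup G]

/-- Sorts the permutations by the slot j in which X lands; `j.cycleRange` has sign (-1)^j. -/
theorem sum_perm_cons {m : ℕ} (T : (Fin (m + 1) → A) → G) (X : A) (v : Fin m → A) :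
    ∑ σ : Perm (Fin (m + 1)), (Perm.sign σ : ℤ) • T (fun i ↦ (Matrix.vecCons X v : _ → A) (σ i)) =
      ∑ j : Fin (m + 1), (-1 : ℤ) ^ (j : ℕ) •
        ∑ τ : Perm (Fin m), (Perm.sign τ : ℤ) • T (j.insertNth X fun i ↦ v (τ i)) := by
  rw [← (bijective_extendPerm_mul_cycleRange m).sum_comp, Fintype.sum_prod_type]
  refine Finset.sum_congr rfl fun j _ ↦ ?_
  rw [Finset.smul_sum]
  refine Finset.sum_congr rfl fun τ _ ↦ ?_
  rw [smul_smul]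
  congr 1
  · simp [mul_comm]
  · congr 1
    funext i
    refine Fin.succAboveCases j ?_ (fun k ↦ ?_) i
    · simp
    · simp

/-- Sorts the permutations by their value j at 0, that is, by the entry that comes first. -/
theorem sum_perm_removeNth {m : ℕ} (T : (Fin (m + 1) → A) → G) (v : Fin (m + 1) → A) :
    ∑ σ : Perm (Fin (m + 1)), (Perm.sign σ : ℤ) • T (fun i ↦ v (σ i)) =
      ∑ j : Fin (m + 1), (-1 : ℤ) ^ (j : ℕ) •
        ∑ τ : Perm (Fin m), (Perm.sign τ : ℤ) •
          T (Matrix.vecCons (v j) fun i ↦ j.removeNth v (τ i)) := by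
  rw [← (bijective_cycleRange_inv_mul_extendPerm m).sum_comp, Fintype.sum_prod_type]
  refine Finset.sum_congr rfl fun j _ ↦ ?_
  rw [Finset.smul_sum]
  refine Finset.sum_congr rfl fun τ _ ↦ ?_
  rw [smul_smul]
  congr 1
  · simp
  · congr 1
    funext i
    refine Fin.cases ?_ (fun k ↦ ?_) i
    · simp [Perm.inv_def, Fin.cycleRange_symm_zero]
    · simp [Perm.inv_def, Fin.cycleRange_symm_succ, Fin.removeNth]

theorem sum_perm_rotate {m : ℕ} (T : (Fin (m + 1) → A) → G) (v : Fin (m + 1) → A) :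
    ∑ σ : Perm (Fin (m + 1)), (Perm.sign σ : ℤ) • T (fun i ↦ v (σ i)) =
      (-1 : ℤ) ^ m • ∑ σ : Perm (Fin (m + 1)), (Perm.sign σ : ℤ) •
        T (fun i ↦ v (σ (finRotate _ i))) := by
  rw [← (Group.mulRight_bijective (finRotate (m + 1))).sum_comp, Finset.smul_sum]
  refine Finset.sum_congr rfl fun σ _ ↦ ?_
  rw [smul_smul]
  simp [sign_finRotate, mul_comm]

end PermSums

/-! ### Wedge product and interior product -/

section Wedge

variable {R N : Type*} [CommRing R] [AddCommGroup N] [Module R N]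

/-- The wedge product as a sum over all permutations. -/
theorem factorial_smul_wedge_apply {p q m : ℕ} (a : N [⋀^Fin p]→ₗ[R] R) (b : N [⋀^Fin q]→ₗ[R] R)
    (h : p + q = m) (v : Fin m → N) :
    (p.factorial * q.factorial) • wedge a b h v =
      ∑ σ : Equiv.Perm (Fin m), (Equiv.Perm.sign σ : ℤ) •
        (a (fun i ↦ v (σ (Fin.cast h (Fin.castAdd q i)))) *
          b (fun j ↦ v (σ (Fin.cast h (Fin.natAdd p j))))) := by
  subst h
  have h1 := MultilinearMap.domCoprod_alternization_eq a b
  simp only [Fintype.card_fin] at h1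
  have h2 := congrArg (fun T ↦ LinearMap.mul' R R (T (v ∘ finSumFinEquiv))) h1
  simp only [AlternatingMap.smul_apply, map_nsmul] at h2
  refine Eq.trans (Eq.trans ?_ h2.symm) ?_
  · rfl
  · rw [MultilinearMap.alternatization_apply, map_sum,
      ← (Equiv.permCongr (finSumFinEquiv (m := p) (n := q))).sum_comp]
    refine Finset.sum_congr rfl fun σ _ ↦ ?_
    rw [Equiv.Perm.sign_permCongr]
    rw [Units.smul_def, map_zsmul]
    congr 1
    simp [Equiv.permCongr_apply]

/-- Permutation sums describe wedge products only after multiplication by factorials; real scalars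
allow these to be cancelled. -/
theorem eq_of_nsmul_eq {V : Type*} [AddCommGroup V] [Module ℝ V] {c : ℕ} (hc : c ≠ 0) {x y : V}
    (h : c • x = c • y) : x = y := by
  have h' : ((c : ℝ)) • x = (c : ℝ) • y := by
    rw [Nat.cast_smul_eq_nsmul, Nat.cast_smul_eq_nsmul, h]
  have hc' : (c : ℝ) ≠ 0 := by exact_mod_cast hc
  rw [← inv_smul_smul₀ hc' x, h', inv_smul_smul₀ hc']

section InsertNth

variable {A : Type*} {p q m : ℕ} (X : A) (w : Fin m → A)

theorem insertNth_castAdd_castAdd (h : p + 1 + q = m + 1) (h1 : p + q = m) (j i : Fin (p + 1)) :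
    ((Fin.cast h (Fin.castAdd q j)).insertNth X w : Fin (m + 1) → A)
      (Fin.cast h (Fin.castAdd q i)) =
      (j.insertNth X (fun k ↦ w (Fin.cast h1 (Fin.castAdd q k))) : Fin (p + 1) → A) i := by
  refine Fin.succAboveCases j ?_ (fun k ↦ ?_) i
  · simp
  · have : Fin.cast h (Fin.castAdd q (j.succAbove k)) =
        (Fin.cast h (Fin.castAdd q j)).succAbove (Fin.cast h1 (Fin.castAdd q k)) := by
      simp only [Fin.ext_iff, Fin.succAbove, Fin.lt_def]
      simp; split_ifs <;> simp
    rw [this, Fin.insertNth_apply_succAbove, Fin.insertNth_apply_succAbove]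

theorem insertNth_castAdd_natAdd (h : p + 1 + q = m + 1) (h1 : p + q = m) (j : Fin (p + 1))
    (i : Fin q) :
    ((Fin.cast h (Fin.castAdd q j)).insertNth X w : Fin (m + 1) → A)
      (Fin.cast h (Fin.natAdd (p + 1) i)) = w (Fin.cast h1 (Fin.natAdd p i)) := by
  have : Fin.cast h (Fin.natAdd (p + 1) i) =
      (Fin.cast h (Fin.castAdd q j)).succAbove (Fin.cast h1 (Fin.natAdd p i)) := by
    simp only [Fin.ext_iff, Fin.succAbove, Fin.lt_def]
    simp; split_ifs <;> simp <;> omega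
  rw [this, Fin.insertNth_apply_succAbove]

theorem insertNth_natAdd_castAdd (h : p + (q + 1) = m + 1) (h1 : p + q = m) (j : Fin (q + 1))
    (i : Fin p) :
    ((Fin.cast h (Fin.natAdd p j)).insertNth X w : Fin (m + 1) → A)
      (Fin.cast h (Fin.castAdd (q + 1) i)) = w (Fin.cast h1 (Fin.castAdd q i)) := by
  have : Fin.cast h (Fin.castAdd (q + 1) i) =
      (Fin.cast h (Fin.natAdd p j)).succAbove (Fin.cast h1 (Fin.castAdd q i)) := by
    simp only [Fin.ext_iff, Fin.succAbove, Fin.lt_def]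
    simp; split_ifs <;> simp <;> omega
  rw [this, Fin.insertNth_apply_succAbove]

theorem insertNth_natAdd_natAdd (h : p + (q + 1) = m + 1) (h1 : p + q = m) (j i : Fin (q + 1)) :
    ((Fin.cast h (Fin.natAdd p j)).insertNth X w : Fin (m + 1) → A)
      (Fin.cast h (Fin.natAdd p i)) =
      (j.insertNth X (fun k ↦ w (Fin.cast h1 (Fin.natAdd p k))) : Fin (q + 1) → A) i := by
  refine Fin.succAboveCases j ?_ (fun k ↦ ?_) i
  · simp
  · have : Fin.cast h (Fin.natAdd p (j.succAbove k)) =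
        (Fin.cast h (Fin.natAdd p j)).succAbove (Fin.cast h1 (Fin.natAdd p k)) := by
      simp only [Fin.ext_iff, Fin.succAbove, Fin.lt_def]
      simp; split_ifs <;> simp <;> omega
    rw [this, Fin.insertNth_apply_succAbove, Fin.insertNth_apply_succAbove]

end InsertNth

variable [Algebra ℝ R]

/-- The interior product is an antiderivation of the wedge product. -/
theorem curryLeft_wedge {p q m : ℕ} (a : N [⋀^Fin (p + 1)]→ₗ[R] R) (b : N [⋀^Fin (q + 1)]→ₗ[R] R)
    (h : p + 1 + (q + 1) = m + 1) (X : N) :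
    (wedge a b h).curryLeft X = wedge (a.curryLeft X) b (by omega) +
      (-1 : ℤ) ^ (p + 1) • wedge a (b.curryLeft X) (by omega) := by
  have h1 : p + (q + 1) = m := by omega
  have h2 : p + 1 + q = m := by omega
  ext v
  refine eq_of_nsmul_eq (c := (p + 1).factorial * (q + 1).factorial) (by positivity) ?_
  rw [AlternatingMap.curryLeft_apply_apply, factorial_smul_wedge_apply, sum_perm_cons
    (fun w ↦ a (fun i ↦ w (Fin.cast h (Fin.castAdd _ i))) *
      b (fun i ↦ w (Fin.cast h (Fin.natAdd _ i)))), ← (finCongr h).sum_comp, Fin.sum_univ_add,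
    AlternatingMap.add_apply, smul_add]
  congr 1
  -- X sits in slot j of `a`. Moving it to the front absorbs (-1)^j, so all p + 1 slots contribute
  -- equally and turn p! into (p + 1)!.
  · have key : ∀ j : Fin (p + 1), (-1 : ℤ) ^ ((finCongr h (Fin.castAdd (q + 1) j) : Fin _) : ℕ) •
        ∑ τ : Equiv.Perm (Fin m), (Equiv.Perm.sign τ : ℤ) •
          (a (fun i ↦ ((finCongr h (Fin.castAdd (q + 1) j)).insertNth X fun i ↦ v (τ i) :
              Fin (m + 1) → N) (Fin.cast h (Fin.castAdd _ i))) *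
            b (fun i ↦ ((finCongr h (Fin.castAdd (q + 1) j)).insertNth X fun i ↦ v (τ i) :
              Fin (m + 1) → N) (Fin.cast h (Fin.natAdd _ i)))) =
        (p.factorial * (q + 1).factorial) • wedge (a.curryLeft X) b h1 v := fun j ↦ by
      rw [factorial_smul_wedge_apply, Finset.smul_sum]
      refine Finset.sum_congr rfl fun τ _ ↦ ?_
      simp only [finCongr_apply, insertNth_castAdd_castAdd X _ h h1,
        insertNth_castAdd_natAdd X _ h h1]
      change _ = (Equiv.Perm.sign τ : ℤ) • (a (Matrix.vecCons X _) * _)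
      have ha := a.neg_one_pow_smul_map_insertNth j X
        (fun k ↦ v (τ (Fin.cast h1 (Fin.castAdd (q + 1) k))))
      rw [← ha, smul_comm, smul_mul_assoc]
      simp
    rw [Finset.sum_congr rfl fun j _ ↦ key j, Finset.sum_const, Finset.card_univ, Fintype.card_fin,
      smul_smul, Nat.factorial_succ p, mul_assoc]
  -- X sits in slot j of `b`, hence in slot p + 1 + j overall: `b` absorbs (-1)^j and (-1)^(p + 1)
  -- remains.
  · have key : ∀ j : Fin (q + 1), (-1 : ℤ) ^ ((finCongr h (Fin.natAdd (p + 1) j) : Fin _) : ℕ) •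
        ∑ τ : Equiv.Perm (Fin m), (Equiv.Perm.sign τ : ℤ) •
          (a (fun i ↦ ((finCongr h (Fin.natAdd (p + 1) j)).insertNth X fun i ↦ v (τ i) :
              Fin (m + 1) → N) (Fin.cast h (Fin.castAdd _ i))) *
            b (fun i ↦ ((finCongr h (Fin.natAdd (p + 1) j)).insertNth X fun i ↦ v (τ i) :
              Fin (m + 1) → N) (Fin.cast h (Fin.natAdd _ i)))) =
        (-1 : ℤ) ^ (p + 1) • ((p + 1).factorial * q.factorial) •
          wedge a (b.curryLeft X) h2 v := fun j ↦ by
      rw [factorial_smul_wedge_apply, Finset.smul_sum, Finset.smul_sum]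
      refine Finset.sum_congr rfl fun τ _ ↦ ?_
      simp only [finCongr_apply, insertNth_natAdd_castAdd X _ h h2,
        insertNth_natAdd_natAdd X _ h h2]
      change _ = (-1 : ℤ) ^ (p + 1) • (Equiv.Perm.sign τ : ℤ) • (_ * b (Matrix.vecCons X _))
      have hb := b.neg_one_pow_smul_map_insertNth j X
        (fun k ↦ v (τ (Fin.cast h2 (Fin.natAdd (p + 1) k))))
      rw [← hb, mul_smul_comm, smul_comm _ ((-1 : ℤ) ^ (j : ℕ)), smul_smul ((-1 : ℤ) ^ (p + 1)),
        ← pow_add]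
      simp
    rw [Finset.sum_congr rfl fun j _ ↦ key j, Finset.sum_const, Finset.card_univ, Fintype.card_fin,
      AlternatingMap.smul_apply, smul_comm _ ((-1 : ℤ) ^ (p + 1)),
      smul_comm _ ((-1 : ℤ) ^ (p + 1)), smul_smul, Nat.factorial_succ q]
    congr 2
    ring

theorem wedge_deg_zero_left {q : ℕ} (a : N [⋀^Fin 0]→ₗ[R] R) (b : N [⋀^Fin q]→ₗ[R] R)
    (h : 0 + q = q) : wedge a b h = a ![] • b := by
  ext v
  refine eq_of_nsmul_eq (c := Nat.factorial 0 * q.factorial) (by positivity) ?_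
  rw [factorial_smul_wedge_apply]
  have key : ∀ τ : Equiv.Perm (Fin q), (Equiv.Perm.sign τ : ℤ) •
      (a (fun i ↦ v (τ (Fin.cast h (Fin.castAdd q i)))) *
        b (fun i ↦ v (τ (Fin.cast h (Fin.natAdd 0 i))))) = a ![] * b v := fun τ ↦ by
    have h1 : (fun i ↦ v (τ (Fin.cast h (Fin.natAdd 0 i)))) = v ∘ τ := by
      funext i
      simp only [Function.comp_apply]
      congr 2
      simp
    have h2 : (fun i ↦ v (τ (Fin.cast h (Fin.castAdd q i)))) = ![] := Subsingleton.elim _ _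
    rw [h1, h2, b.map_perm, Units.smul_def, mul_smul_comm, smul_smul, ← Units.val_mul,
      Int.units_mul_self, Units.val_one, one_smul]
  rw [Finset.sum_congr rfl fun τ _ ↦ key τ]
  simp [Fintype.card_perm]

theorem wedge_deg_zero_right {p : ℕ} (a : N [⋀^Fin p]→ₗ[R] R) (b : N [⋀^Fin 0]→ₗ[R] R)
    (h : p + 0 = p) : wedge a b h = b ![] • a := by
  ext v
  refine eq_of_nsmul_eq (c := p.factorial * Nat.factorial 0) (by positivity) ?_
  rw [factorial_smul_wedge_apply]
  have key : ∀ τ : Equiv.Perm (Fin p), (Equiv.Perm.sign τ : ℤ) •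
      (a (fun i ↦ v (τ (Fin.cast h (Fin.castAdd 0 i)))) *
        b (fun i ↦ v (τ (Fin.cast h (Fin.natAdd p i))))) = b ![] * a v := fun τ ↦ by
    have h1 : (fun i ↦ v (τ (Fin.cast h (Fin.castAdd 0 i)))) = v ∘ τ := rfl
    have h2 : (fun i ↦ v (τ (Fin.cast h (Fin.natAdd p i)))) = ![] := Subsingleton.elim _ _
    rw [h1, h2, a.map_perm, Units.smul_def, smul_mul_assoc, smul_smul, ← Units.val_mul,
      Int.units_mul_self, Units.val_one, one_smul, mul_comm]
  rw [Finset.sum_congr rfl fun τ _ ↦ key τ]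
  simp [Fintype.card_perm]

end Wedge

end LJ

namespace LJ

/-! ### Exterior algebra by contraction and induction on the degree -/

section Exterior

variable {R N : Type*} [CommRing R] [AddCommGroup N] [Module R N]

/-- The wedge product as a bilinear map. -/
def wedgeL (p q m : ℕ) (h : p + q = m) :
    (N [⋀^Fin p]→ₗ[R] R) →ₗ[R] (N [⋀^Fin q]→ₗ[R] R) →ₗ[R] (N [⋀^Fin m]→ₗ[R] R) :=
  LinearMap.mk₂ R (fun a b ↦ wedge a b h) (fun a a' b ↦ add_wedge a a' b h)
    (fun c a b ↦ smul_wedge c a b h) (fun a b b' ↦ wedge_add a b b' h)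
    (fun c a b ↦ wedge_smul a c b h)

/-- `toDegOne` as a linear equivalence. -/
def degOneEquiv : (N →ₗ[R] R) ≃ₗ[R] (N [⋀^Fin 1]→ₗ[R] R) where
  toFun := toDegOne
  map_add' _ _ := rfl
  map_smul' _ _ := rfl
  invFun := (AlternatingMap.ofSubsingleton R N R 0).symm
  left_inv _ := Equiv.symm_apply_apply _ _
  right_inv _ := Equiv.apply_symm_apply _ _

theorem degOneEquiv_apply (φ : N →ₗ[R] R) (v : Fin 1 → N) : degOneEquiv φ v = φ (v 0) := rfl

theorem degOneEquiv_symm_apply (a : N [⋀^Fin 1]→ₗ[R] R) (X : N) :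
    degOneEquiv.symm a X = a ![X] := by
  change a _ = _
  congr 1
  funext i
  fin_cases i
  rfl

/-- The wedge product with a linear form from the left. -/
def wedgeOne {q : ℕ} :
    (N →ₗ[R] R) →ₗ[R] (N [⋀^Fin q]→ₗ[R] R) →ₗ[R] (N [⋀^Fin (q + 1)]→ₗ[R] R) :=
  wedgeL 1 q (q + 1) (by omega) ∘ₗ degOneEquiv.toLinearMap

/-- The wedge product with a `2`-form from the left. -/
def wedgeTwo {q : ℕ} :
    (N [⋀^Fin 2]→ₗ[R] R) →ₗ[R] (N [⋀^Fin q]→ₗ[R] R) →ₗ[R] (N [⋀^Fin (q + 2)]→ₗ[R] R) :=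
  wedgeL 2 q (q + 2) (by omega)

/-- The wedge product with a `3`-form from the left. -/
def wedgeThree {q : ℕ} :
    (N [⋀^Fin 3]→ₗ[R] R) →ₗ[R] (N [⋀^Fin q]→ₗ[R] R) →ₗ[R] (N [⋀^Fin (q + 3)]→ₗ[R] R) :=
  wedgeL 3 q (q + 3) (by omega)

/-- The contraction of an alternating map with a vector. -/
def contract (X : N) {q : ℕ} : (N [⋀^Fin (q + 1)]→ₗ[R] R) →ₗ[R] (N [⋀^Fin q]→ₗ[R] R) where
  toFun a := a.curryLeft X
  map_add' _ _ := rfl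
  map_smul' _ _ := rfl

theorem contract_apply (X : N) {q : ℕ} (a : N [⋀^Fin (q + 1)]→ₗ[R] R) (v : Fin q → N) :
    contract X a v = a (Matrix.vecCons X v) := rfl

theorem contract_add {q : ℕ} (X Y : N) (a : N [⋀^Fin (q + 1)]→ₗ[R] R) :
    contract (X + Y) a = contract X a + contract Y a := a.curryLeft.map_add X Y

theorem contract_sub {q : ℕ} (X Y : N) (a : N [⋀^Fin (q + 1)]→ₗ[R] R) :
    contract (X - Y) a = contract X a - contract Y a := a.curryLeft.map_sub X Y

theorem contract_neg {q : ℕ} (X : N) (a : N [⋀^Fin (q + 1)]→ₗ[R] R) :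
    contract (-X) a = -contract X a := a.curryLeft.map_neg X

theorem contract_smul {q : ℕ} (f : R) (X : N) (a : N [⋀^Fin (q + 1)]→ₗ[R] R) :
    contract (f • X) a = f • contract X a := a.curryLeft.map_smul f X

/-- The induction principle of the calculus below: contracting an identity of degree k + 1 leaves
one of degree k, and degree 0 is handled by `ext_deg_zero`. -/
theorem ext_contract {q : ℕ} {a b : N [⋀^Fin (q + 1)]→ₗ[R] R}
    (h : ∀ X, contract X a = contract X b) : a = b := by
  ext v
  have := congrArg (fun c ↦ c (Matrix.vecTail v)) (h (Matrix.vecHead v))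
  simpa only [contract_apply, Matrix.cons_head_tail] using this

/-- Alternating maps in no variables are scalars. -/
theorem ext_deg_zero {a b : N [⋀^Fin 0]→ₗ[R] R} (h : a ![] = b ![]) : a = b := by
  ext v
  rwa [Subsingleton.elim v ![]]

theorem contract_self {q : ℕ} (X : N) (a : N [⋀^Fin (q + 2)]→ₗ[R] R) :
    contract X (contract X a) = 0 := a.curryLeft_same X

theorem contract_contract {q : ℕ} (X Y : N) (a : N [⋀^Fin (q + 2)]→ₗ[R] R) :
    contract X (contract Y a) = -contract Y (contract X a) := by
  have h := contract_self (X + Y) a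
  simp only [contract_add, map_add, contract_self, zero_add, add_zero] at h
  exact eq_neg_of_add_eq_zero_right h

/-- The linear form `i_X a` for a `2`-form `a`. -/
def contractTwo (a : N [⋀^Fin 2]→ₗ[R] R) (X : N) : N →ₗ[R] R := degOneEquiv.symm (contract X a)

theorem contractTwo_apply (a : N [⋀^Fin 2]→ₗ[R] R) (X Y : N) : contractTwo a X Y = a ![X, Y] := by
  rw [contractTwo, degOneEquiv_symm_apply]
  rfl

theorem degOneEquiv_contractTwo (a : N [⋀^Fin 2]→ₗ[R] R) (X : N) :
    degOneEquiv (contractTwo a X) = contract X a := LinearEquiv.apply_symm_apply _ _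

variable [Algebra ℝ R]

theorem contract_wedgeOne_zero (φ : N →ₗ[R] R) (f : N [⋀^Fin 0]→ₗ[R] R) (X : N) :
    contract X (wedgeOne φ f) = φ X • f := by
  apply ext_deg_zero
  change wedge (toDegOne φ) f _ _ = _
  rw [wedge_deg_zero_right]
  exact mul_comm _ _

theorem contract_wedgeOne {q : ℕ} (φ : N →ₗ[R] R) (b : N [⋀^Fin (q + 1)]→ₗ[R] R) (X : N) :
    contract X (wedgeOne φ b) = φ X • b - wedgeOne φ (contract X b) := by
  have h := curryLeft_wedge (toDegOne φ) b (m := q + 1) (by omega) X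
  rw [wedge_deg_zero_left] at h
  refine h.trans ?_
  rw [sub_eq_add_neg, show (-1 : ℤ) ^ (0 + 1) = -1 by norm_num, neg_smul, one_smul]
  rfl

theorem wedgeTwo_zero (a : N [⋀^Fin 2]→ₗ[R] R) (f : N [⋀^Fin 0]→ₗ[R] R) :
    wedgeTwo a f = f ![] • a := wedge_deg_zero_right a f _

theorem wedgeOne_deg_zero (φ : N →ₗ[R] R) (f : N [⋀^Fin 0]→ₗ[R] R) :
    wedgeOne φ f = f ![] • degOneEquiv φ := wedge_deg_zero_right _ f _

theorem wedgeThree_zero (a : N [⋀^Fin 3]→ₗ[R] R) (f : N [⋀^Fin 0]→ₗ[R] R) :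
    wedgeThree a f = f ![] • a := wedge_deg_zero_right a f _

theorem contract_wedgeTwo_zero (a : N [⋀^Fin 2]→ₗ[R] R) (f : N [⋀^Fin 0]→ₗ[R] R) (X : N) :
    contract X (wedgeTwo a f) = wedgeOne (contractTwo a X) f := by
  rw [wedgeTwo_zero, wedgeOne_deg_zero, map_smul, degOneEquiv_contractTwo]

theorem contract_wedgeTwo {q : ℕ} (a : N [⋀^Fin 2]→ₗ[R] R) (b : N [⋀^Fin (q + 1)]→ₗ[R] R) (X : N) :
    contract X (wedgeTwo a b) = wedgeOne (contractTwo a X) b + wedgeTwo a (contract X b) := by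
  have h := curryLeft_wedge a b (m := q + 2) (by omega) X
  refine h.trans ?_
  congr 1
  · change _ = wedge (degOneEquiv (contractTwo a X)) b _
    rw [degOneEquiv_contractTwo]
    rfl
  · norm_num
    rfl

theorem contract_wedgeThree_zero (a : N [⋀^Fin 3]→ₗ[R] R) (f : N [⋀^Fin 0]→ₗ[R] R) (X : N) :
    contract X (wedgeThree a f) = wedgeTwo (contract X a) f := by
  rw [wedgeThree_zero, wedgeTwo_zero, map_smul]

theorem contract_wedgeThree {q : ℕ} (a : N [⋀^Fin 3]→ₗ[R] R) (b : N [⋀^Fin (q + 1)]→ₗ[R] R)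
    (X : N) :
    contract X (wedgeThree a b) = wedgeTwo (contract X a) b - wedgeThree a (contract X b) := by
  have h := curryLeft_wedge a b (m := q + 3) (by omega) X
  refine h.trans ?_
  rw [sub_eq_add_neg]
  congr 1
  rw [show (-1 : ℤ) ^ (2 + 1) = -1 by norm_num, neg_smul, one_smul]
  rfl

/-- Graded commutativity and associativity are needed only for factors of low degree. This case and
those below follow by contracting with X and applying the antiderivation rules. -/
theorem wedgeOne_anticomm {q : ℕ} (φ ψ : N →ₗ[R] R) (b : N [⋀^Fin q]→ₗ[R] R) :
    wedgeOne φ (wedgeOne ψ b) = -wedgeOne ψ (wedgeOne φ b) := by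
  induction q with
  | zero =>
    refine ext_contract fun X ↦ ?_
    simp only [map_neg, contract_wedgeOne, contract_wedgeOne_zero, map_smul]
    abel
  | succ q ih =>
    refine ext_contract fun X ↦ ?_
    simp only [map_neg, contract_wedgeOne, map_smul, map_sub, ih (contract X b)]
    abel

theorem wedgeOne_self {q : ℕ} (φ : N →ₗ[R] R) (b : N [⋀^Fin q]→ₗ[R] R) :
    wedgeOne φ (wedgeOne φ b) = 0 := by
  induction q with
  | zero =>
    refine ext_contract fun X ↦ ?_
    simp [contract_wedgeOne, contract_wedgeOne_zero]
  | succ q ih =>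
    refine ext_contract fun X ↦ ?_
    simp [contract_wedgeOne, ih (contract X b)]

theorem wedgeTwo_wedgeOne {q : ℕ} (a : N [⋀^Fin 2]→ₗ[R] R) (φ : N →ₗ[R] R)
    (b : N [⋀^Fin q]→ₗ[R] R) : wedgeTwo a (wedgeOne φ b) = wedgeOne φ (wedgeTwo a b) := by
  induction q with
  | zero =>
    refine ext_contract fun X ↦ ?_
    simp only [contract_wedgeTwo, contract_wedgeOne, contract_wedgeOne_zero,
      contract_wedgeTwo_zero, map_smul, wedgeOne_anticomm φ]
    abel
  | succ q ih =>
    refine ext_contract fun X ↦ ?_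
    simp only [contract_wedgeTwo, contract_wedgeOne, map_sub, map_add, map_smul,
      wedgeOne_anticomm φ (contractTwo a X), ih (contract X b)]
    abel

theorem wedgeTwo_wedgeOne_left {q : ℕ} (φ ψ : N →ₗ[R] R) (b : N [⋀^Fin q]→ₗ[R] R) :
    wedgeTwo (wedgeOne φ (degOneEquiv ψ)) b = wedgeOne φ (wedgeOne ψ b) := by
  have key : ∀ X, contractTwo (wedgeOne φ (degOneEquiv ψ)) X = φ X • ψ - ψ X • φ := fun X ↦ by
    apply degOneEquiv.injective
    rw [degOneEquiv_contractTwo, contract_wedgeOne, wedgeOne_deg_zero]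
    rfl
  induction q with
  | zero =>
    refine ext_contract fun X ↦ ?_
    rw [contract_wedgeTwo_zero, key]
    simp [contract_wedgeOne, contract_wedgeOne_zero]
  | succ q ih =>
    refine ext_contract fun X ↦ ?_
    rw [contract_wedgeTwo, key]
    simp [contract_wedgeOne, ih (contract X b)]
    abel

theorem wedgeThree_wedgeOne_left {q : ℕ} (φ : N →ₗ[R] R) (a : N [⋀^Fin 2]→ₗ[R] R)
    (b : N [⋀^Fin q]→ₗ[R] R) :
    wedgeThree (wedgeOne φ a) b = wedgeOne φ (wedgeTwo a b) := by
  have key : ∀ X, contract X (wedgeOne φ a) = φ X • a - wedgeOne φ (degOneEquiv (contractTwo a X)) :=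
    fun X ↦ by rw [contract_wedgeOne, degOneEquiv_contractTwo]
  induction q with
  | zero =>
    refine ext_contract fun X ↦ ?_
    rw [contract_wedgeThree_zero, key]
    simp [contract_wedgeOne, contract_wedgeTwo_zero, wedgeTwo_wedgeOne_left]
  | succ q ih =>
    refine ext_contract fun X ↦ ?_
    rw [contract_wedgeThree, key]
    simp [contract_wedgeOne, contract_wedgeTwo, wedgeTwo_wedgeOne_left, ih (contract X b)]
    abel

theorem wedge_toDegOne_right {q : ℕ} (φ : N →ₗ[R] R) (b : N [⋀^Fin q]→ₗ[R] R) :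
    wedge b (toDegOne φ) = (-1 : ℤ) ^ q • wedgeOne φ b := by
  induction q with
  | zero =>
    rw [wedge_deg_zero_left, wedgeOne_deg_zero]
    simp
    rfl
  | succ q ih =>
    refine ext_contract fun X ↦ ?_
    have h := curryLeft_wedge b (toDegOne φ) (m := q + 1) (by omega) X
    refine h.trans ?_
    rw [wedge_deg_zero_right, map_zsmul, contract_wedgeOne]
    refine (congrArg₂ (· + ·) (ih (contract X b)) rfl).trans ?_
    change _ + (-1 : ℤ) ^ (q + 1) • φ X • b = _
    rw [pow_succ, smul_sub]
    simp
    abel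

/-- Moves the factor Ω of α ∧ Ω to the left, where the contraction rules are stated; a factor of
even degree passes without a sign. -/
theorem wedge_two_right {q : ℕ} (a : N [⋀^Fin 2]→ₗ[R] R) (b : N [⋀^Fin q]→ₗ[R] R) :
    wedge b a (m := q + 2) = wedgeTwo a b := by
  induction q with
  | zero =>
    rw [wedge_deg_zero_left, wedgeTwo_zero]
  | succ q ih =>
    refine ext_contract fun X ↦ ?_
    have h := curryLeft_wedge b a (m := q + 2) (by omega) X
    refine h.trans ?_
    rw [contract_wedgeTwo]
    have h1 : wedge b (contract X a) = (-1 : ℤ) ^ (q + 1) • wedgeOne (contractTwo a X) b := by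
      rw [← wedge_toDegOne_right]
      congr 1
      exact (degOneEquiv_contractTwo a X).symm
    refine (congrArg₂ (· + ·) (ih (contract X b))
      (congrArg (fun c ↦ (-1 : ℤ) ^ (q + 1) • c) h1)).trans ?_
    rw [smul_smul, ← pow_add, Even.neg_one_pow ⟨q + 1, rfl⟩, one_smul]
    exact add_comm _ _

end Exterior

end LJ

namespace LJ

/-! ### Lie derivatives attached to module derivations -/

section Lie

variable (R N : Type*) [CommRing R] [Algebra ℝ R] [AddCommGroup N] [Module R N] [Module ℝ N]

/-- A derivation `D` of the ring `R` together with an operator `A` on the module `N` satisfying the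
Leibniz rule over `D`. -/
structure ModuleDerivation where
  D : R →ₗ[ℝ] R
  A : N →ₗ[ℝ] N
  D_mul : ∀ f g, D (f * g) = f * D g + D f * g
  A_smul : ∀ (f : R) X, A (f • X) = f • A X + D f • X

variable {R N}

namespace ModuleDerivation

variable (δ : ModuleDerivation R N)

/-- The induced operator on linear forms. -/
def dual : (N →ₗ[R] R) →ₗ[ℝ] (N →ₗ[R] R) where
  toFun φ :=
    { toFun := fun X ↦ δ.D (φ X) - φ (δ.A X)
      map_add' := fun X Y ↦ by simp only [map_add]; abel
      map_smul' := fun f X ↦ by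
        simp only [map_smul, smul_eq_mul, δ.D_mul, δ.A_smul, map_add, RingHom.id_apply]
        ring }
  map_add' φ ψ := by
    ext X
    simp only [LinearMap.coe_mk, AddHom.coe_mk, LinearMap.add_apply, map_add]
    abel
  map_smul' c φ := by
    ext X
    simp [smul_sub]

theorem dual_apply (φ : N →ₗ[R] R) (X : N) : δ.dual φ X = δ.D (φ X) - φ (δ.A X) := rfl

theorem dual_smul (f : R) (φ : N →ₗ[R] R) : δ.dual (f • φ) = f • δ.dual φ + δ.D f • φ := by
  ext X
  simp only [dual_apply, LinearMap.smul_apply, LinearMap.add_apply, smul_eq_mul, δ.D_mul]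
  ring

theorem update_update_apply {k : ℕ} (v : Fin k → N) (j i : Fin k) (hij : i ≠ j) (Z : N) :
    Function.update (Function.update v j Z) i (δ.A (Function.update v j Z i)) =
      Function.update (Function.update v i (δ.A (v i))) j Z := by
  rw [Function.update_of_ne hij, Function.update_comm hij.symm]

/-- The induced operator on alternating maps. -/
def lie {k : ℕ} : (N [⋀^Fin k]→ₗ[R] R) →ₗ[ℝ] (N [⋀^Fin k]→ₗ[R] R) where
  toFun a :=
    { toFun := fun v ↦ δ.D (a v) - ∑ i, a (Function.update v i (δ.A (v i)))
      map_update_add' := fun {inst} v j X Y ↦ by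
        obtain rfl : inst = instDecidableEqFin k := Subsingleton.elim _ _
        rw [a.map_update_add, map_add, ← Finset.add_sum_erase _ _ (Finset.mem_univ j),
          ← Finset.add_sum_erase _ _ (Finset.mem_univ j),
          ← Finset.add_sum_erase _ _ (Finset.mem_univ j)]
        simp only [Function.update_self, Function.update_idem, map_add, a.map_update_add]
        have h : ∀ i ∈ Finset.univ.erase j,
            a (Function.update (Function.update v j (X + Y)) i
              (δ.A (Function.update v j (X + Y) i))) =
            a (Function.update (Function.update v j X) i (δ.A (Function.update v j X i))) +
            a (Function.update (Function.update v j Y) i (δ.A (Function.update v j Y i))) :=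
          fun i hi ↦ by
            have hij := Finset.ne_of_mem_erase hi
            rw [δ.update_update_apply v j i hij, δ.update_update_apply v j i hij,
              δ.update_update_apply v j i hij, a.map_update_add]
        rw [Finset.sum_congr rfl h, Finset.sum_add_distrib]
        abel
      map_update_smul' := fun {inst} v j f X ↦ by
        obtain rfl : inst = instDecidableEqFin k := Subsingleton.elim _ _
        rw [a.map_update_smul, smul_eq_mul, δ.D_mul,
          ← Finset.add_sum_erase _ _ (Finset.mem_univ j),
          ← Finset.add_sum_erase _ _ (Finset.mem_univ j)]
        simp only [Function.update_self, Function.update_idem, δ.A_smul, a.map_update_add,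
          a.map_update_smul]
        have h : ∀ i ∈ Finset.univ.erase j,
            a (Function.update (Function.update v j (f • X)) i
              (δ.A (Function.update v j (f • X) i))) =
            f * a (Function.update (Function.update v j X) i (δ.A (Function.update v j X i))) :=
          fun i hi ↦ by
            have hij := Finset.ne_of_mem_erase hi
            rw [δ.update_update_apply v j i hij, δ.update_update_apply v j i hij,
              a.map_update_smul, smul_eq_mul]
        rw [Finset.sum_congr rfl h, ← Finset.mul_sum]
        simp only [smul_eq_mul]
        ring
      map_eq_zero_of_eq' := fun v i j hv hij ↦ by
        rw [a.map_eq_zero_of_eq v hv hij, map_zero, zero_sub, neg_eq_zero,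
          Fintype.sum_eq_add i j hij]
        -- Only the terms that modify slot i or slot j can survive. Their argument tuples differ by
        -- the transposition of i and j, so they cancel.
        · have h : Function.update v j (δ.A (v j)) =
              Function.update v i (δ.A (v i)) ∘ Equiv.swap i j := by
            funext l
            rcases eq_or_ne l i with rfl | hli
            · simp [Function.update_of_ne hij, Function.update_of_ne hij.symm, hv]
            · rcases eq_or_ne l j with rfl | hlj
              · simp [hv]
              · simp [Equiv.swap_apply_of_ne_of_ne hli hlj, Function.update_of_ne hli,
                  Function.update_of_ne hlj]
          rw [h, a.map_swap _ hij, add_neg_cancel]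
        · intro l hl
          exact a.map_eq_zero_of_eq _ (by
            rw [Function.update_of_ne hl.1.symm, Function.update_of_ne hl.2.symm, hv]) hij }
  map_add' a b := by
    ext v
    simp [Finset.sum_add_distrib]
    abel
  map_smul' c a := by
    ext v
    simp [smul_sub, Finset.smul_sum]

theorem lie_apply {k : ℕ} (a : N [⋀^Fin k]→ₗ[R] R) (v : Fin k → N) :
    δ.lie a v = δ.D (a v) - ∑ i, a (Function.update v i (δ.A (v i))) := rfl

theorem lie_zero_apply (a : N [⋀^Fin 0]→ₗ[R] R) (v : Fin 0 → N) : δ.lie a v = δ.D (a v) := by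
  simp [lie_apply]

/-- The commutation rule [L, i_X] = i_(A X). Together with the action on functions it determines
`lie`, so it drives every induction about Lie derivatives. -/
theorem contract_lie {k : ℕ} (a : N [⋀^Fin (k + 1)]→ₗ[R] R) (X : N) :
    contract X (δ.lie a) = δ.lie (contract X a) - contract (δ.A X) a := by
  ext v
  simp only [contract_apply, lie_apply, AlternatingMap.sub_apply, Fin.sum_univ_succ,
    Matrix.cons_val_zero, Matrix.cons_val_succ]
  have h0 : Function.update (Matrix.vecCons X v) 0 (δ.A X) = Matrix.vecCons (δ.A X) v :=
    Fin.update_cons_zero _ _ _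
  have h1 : ∀ (i : Fin k) Z, Function.update (Matrix.vecCons X v) i.succ Z =
      Matrix.vecCons X (Function.update v i Z) := fun i Z ↦ (Fin.cons_update _ _ _ _).symm
  simp only [h0, h1]
  abel

theorem lie_smul {k : ℕ} (f : R) (a : N [⋀^Fin k]→ₗ[R] R) :
    δ.lie (f • a) = f • δ.lie a + δ.D f • a := by
  ext v
  simp only [lie_apply, AlternatingMap.smul_apply, AlternatingMap.add_apply, smul_eq_mul, δ.D_mul,
    ← Finset.mul_sum]
  ring

theorem lie_degOneEquiv (φ : N →ₗ[R] R) : δ.lie (degOneEquiv φ) = degOneEquiv (δ.dual φ) := by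
  ext v
  simp only [lie_apply, degOneEquiv_apply, dual_apply, Fin.sum_univ_one, Fin.isValue,
    Function.update_self]

theorem contractTwo_lie (a : N [⋀^Fin 2]→ₗ[R] R) (X : N) :
    contractTwo (δ.lie a) X = δ.dual (contractTwo a X) - contractTwo a (δ.A X) := by
  apply degOneEquiv.injective
  rw [map_sub, degOneEquiv_contractTwo, contract_lie, ← lie_degOneEquiv, degOneEquiv_contractTwo,
    degOneEquiv_contractTwo]

theorem lie_wedgeOne {q : ℕ} (φ : N →ₗ[R] R) (b : N [⋀^Fin q]→ₗ[R] R) :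
    δ.lie (wedgeOne φ b) = wedgeOne (δ.dual φ) b + wedgeOne φ (δ.lie b) := by
  induction q with
  | zero =>
    refine ext_contract fun X ↦ ?_
    simp only [contract_lie, contract_wedgeOne_zero, map_add, lie_smul, dual_apply]
    module
  | succ q ih =>
    refine ext_contract fun X ↦ ?_
    simp only [contract_lie, contract_wedgeOne, map_add, map_sub, lie_smul, dual_apply,
      ih (contract X b)]
    module

theorem lie_wedgeTwo {q : ℕ} (a : N [⋀^Fin 2]→ₗ[R] R) (b : N [⋀^Fin q]→ₗ[R] R) :
    δ.lie (wedgeTwo a b) = wedgeTwo (δ.lie a) b + wedgeTwo a (δ.lie b) := by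
  induction q with
  | zero =>
    refine ext_contract fun X ↦ ?_
    simp only [contract_lie, contract_wedgeTwo_zero, map_add, lie_wedgeOne, contractTwo_lie, map_sub,
      LinearMap.sub_apply]
    abel
  | succ q ih =>
    refine ext_contract fun X ↦ ?_
    simp only [contract_lie, contract_wedgeTwo, map_add, lie_wedgeOne, contractTwo_lie, map_sub,
      LinearMap.sub_apply, ih (contract X b)]
    abel

/-- The commutator on functions is the case of degree 0. In the inductive step, contraction with X
produces precisely the commutator on the module, evaluated at X. -/
theorem lie_lie {k : ℕ} (δ₁ δ₂ δ₃ : ModuleDerivation R N)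
    (hD : ∀ f, δ₁.D (δ₂.D f) - δ₂.D (δ₁.D f) = δ₃.D f)
    (hA : ∀ X, δ₁.A (δ₂.A X) - δ₂.A (δ₁.A X) = δ₃.A X) (a : N [⋀^Fin k]→ₗ[R] R) :
    δ₁.lie (δ₂.lie a) - δ₂.lie (δ₁.lie a) = δ₃.lie a := by
  induction k with
  | zero =>
    refine ext_deg_zero ?_
    simp only [AlternatingMap.sub_apply, lie_zero_apply, hD]
  | succ k ih =>
    refine ext_contract fun X ↦ ?_
    rw [contract_lie δ₃, ← ih (contract X a), ← hA]
    simp only [map_sub, contract_lie, contract_sub]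
    abel

end ModuleDerivation

end Lie

end LJ

namespace LJ

/-! ### Cartan calculus of skew algebroids -/

section Algebroid

open AlternatingMap

variable (R N : Type*) [CommRing R] [Algebra ℝ R] [AddCommGroup N] [Module R N] [Module ℝ N]

/-- A skew-symmetric algebroid: a Lie-Rinehart structure without the Jacobi identity. -/
structure SkewAlgebroid where
  anchor : N →ₗ[R] (R →ₗ[ℝ] R)
  bracket : N →ₗ[ℝ] N →ₗ[ℝ] N
  anchor_mul : ∀ X f g, anchor X (f * g) = f * anchor X g + anchor X f * g
  skew : ∀ X Y, bracket X Y = -bracket Y X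
  leibniz : ∀ X (f : R) Y, bracket X (f • Y) = f • bracket X Y + anchor X f • Y

variable {R N}

theorem sum_update_eq {k : ℕ} (a : N [⋀^Fin (k + 1)]→ₗ[R] R) (v Z : Fin (k + 1) → N) :
    ∑ i, a (Function.update v i (Z i)) =
      ∑ i : Fin (k + 1), (-1 : ℤ) ^ (i : ℕ) • a (Matrix.vecCons (Z i) (i.removeNth v)) := by
  refine Finset.sum_congr rfl fun i _ ↦ ?_
  rw [← a.neg_one_pow_smul_map_insertNth i, smul_smul, ← pow_add, Even.neg_one_pow ⟨_, rfl⟩,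
    one_smul, Fin.insertNth_removeNth]

variable [IsScalarTower ℝ R N]

/-- An alternating map over `R`, regarded as an alternating map over `ℝ`. -/
def realAlternating {k : ℕ} : (N [⋀^Fin k]→ₗ[R] R) →ₗ[ℝ] (N [⋀^Fin k]→ₗ[ℝ] R) where
  toFun a :=
    { toMultilinearMap := a.toMultilinearMap.restrictScalars ℝ
      map_eq_zero_of_eq' := a.map_eq_zero_of_eq }
  map_add' _ _ := rfl
  map_smul' _ _ := rfl

/-- An alternating map over `ℝ` which is `R`-homogeneous in its first argument is
`R`-multilinear. -/
def alternatingOfHomogeneous {k : ℕ} (T : N [⋀^Fin (k + 1)]→ₗ[ℝ] R)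
    (hT : ∀ (f : R) (X : N) (v : Fin k → N),
      T (Matrix.vecCons (f • X) v) = f * T (Matrix.vecCons X v)) : N [⋀^Fin (k + 1)]→ₗ[R] R where
  toFun := T
  map_update_add' v i X Y := by
    convert T.map_update_add v i X Y
  map_update_smul' {inst} v i f X := by
    obtain rfl : inst = instDecidableEqFin (k + 1) := Subsingleton.elim _ _
    have h : ∀ Z : N, Function.update v i Z = i.insertNth Z (i.removeNth v) := fun Z ↦ by
      rw [Fin.insertNth_removeNth]
    rw [h, h, T.map_insertNth, T.map_insertNth, hT, smul_eq_mul, mul_smul_comm]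
  map_eq_zero_of_eq' := T.map_eq_zero_of_eq

namespace SkewAlgebroid

variable (𝒜 : SkewAlgebroid R N)

/-- The operator `[X, ·]` with the derivation given by the anchor. -/
def ad (X : N) : ModuleDerivation R N where
  D := 𝒜.anchor X
  A := 𝒜.bracket X
  D_mul := 𝒜.anchor_mul X
  A_smul := 𝒜.leibniz X

/-- The map `X ↦ X ∘ a`. -/
def anchorComp {k : ℕ} (a : N [⋀^Fin k]→ₗ[R] R) : N →ₗ[ℝ] (N [⋀^Fin k]→ₗ[ℝ] R) where
  toFun X := (𝒜.anchor X).compAlternatingMap (realAlternating a)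
  map_add' X Y := by
    ext v
    simp
  map_smul' c X := by
    ext v
    rw [← algebraMap_smul R c X, map_smul]
    simp [Algebra.smul_def]

theorem anchorComp_apply {k : ℕ} (a : N [⋀^Fin k]→ₗ[R] R) (X : N) (v : Fin k → N) :
    𝒜.anchorComp a X v = 𝒜.anchor X (a v) := rfl

/-- The map `X ↦ Y ↦ i_[X, Y] a`. -/
def bracketContract {k : ℕ} (a : N [⋀^Fin (k + 1)]→ₗ[R] R) :
    N →ₗ[ℝ] N →ₗ[ℝ] (N [⋀^Fin k]→ₗ[ℝ] R) :=
  LinearMap.mk₂ ℝ (fun X Y ↦ realAlternating (contract (𝒜.bracket X Y) a))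
    (fun X X' Y ↦ by rw [map_add, LinearMap.add_apply, contract_add, map_add])
    (fun c X Y ↦ by
      rw [map_smul, LinearMap.smul_apply, ← algebraMap_smul R c, contract_smul, algebraMap_smul,
        map_smul])
    (fun X Y Y' ↦ by rw [map_add, contract_add, map_add])
    (fun c X Y ↦ by
      rw [map_smul, ← algebraMap_smul R c, contract_smul, algebraMap_smul, map_smul])

theorem bracketContract_apply {k : ℕ} (a : N [⋀^Fin (k + 1)]→ₗ[R] R) (X Y : N) (v : Fin k → N) :
    𝒜.bracketContract a X Y v = a (Matrix.vecCons (𝒜.bracket X Y) v) := rfl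

/-- The Koszul formula as an alternating map over `ℝ`. -/
def koszulReal : {k : ℕ} → (N [⋀^Fin k]→ₗ[R] R) → (N [⋀^Fin (k + 1)]→ₗ[ℝ] R)
  | 0, a => alternatizeUncurryFin (𝒜.anchorComp a)
  | _ + 1, a => alternatizeUncurryFin (𝒜.anchorComp a) -
      (1 / 2 : ℝ) • alternatizeUncurryFin (alternatizeUncurryFinLM ∘ₗ 𝒜.bracketContract a)

/-- The double sum runs over ordered pairs. The first sum collects the brackets [X, v i]; in the
second, X is either the second entry of the bracket or an untouched argument. -/
theorem bracketContract_cons {k : ℕ} (a : N [⋀^Fin (k + 1)]→ₗ[R] R) (X : N) (v : Fin (k + 1) → N) :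
    alternatizeUncurryFin (alternatizeUncurryFinLM ∘ₗ 𝒜.bracketContract a) (Matrix.vecCons X v) =
      ∑ i, a (Function.update v i (𝒜.bracket X (v i))) +
      ∑ i : Fin (k + 1), (-1 : ℤ) ^ ((i : ℕ) + 1) •
        alternatizeUncurryFin (𝒜.bracketContract a (v i)) (Matrix.vecCons X (i.removeNth v)) := by
  rw [alternatizeUncurryFin_apply, Fin.sum_univ_succ, sum_update_eq]
  simp only [removeNth_succ_cons, removeNth_zero_cons, Matrix.cons_val_zero, Matrix.cons_val_succ,
    LinearMap.comp_apply, alternatizeUncurryFinLM_apply, Fin.val_zero, pow_zero, one_smul,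
    Fin.val_succ]
  congr 1
  rw [alternatizeUncurryFin_apply]
  rfl

theorem bracket_neg_cons {k : ℕ} (a : N [⋀^Fin (k + 1)]→ₗ[R] R) (X Y : N) (v : Fin k → N) :
    a (Matrix.vecCons (𝒜.bracket X Y) v) = -a (Matrix.vecCons (𝒜.bracket Y X) v) := by
  rw [𝒜.skew]
  simp only [← contract_apply, contract_neg, AlternatingMap.neg_apply]

theorem koszulReal_cons {k : ℕ} (a : N [⋀^Fin (k + 1)]→ₗ[R] R) (X : N) (v : Fin (k + 1) → N) :
    𝒜.koszulReal a (Matrix.vecCons X v) =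
      (𝒜.ad X).lie a v - 𝒜.koszulReal (contract X a) v := by
  have h1 : alternatizeUncurryFin (𝒜.anchorComp a) (Matrix.vecCons X v) =
      𝒜.anchor X (a v) - alternatizeUncurryFin (𝒜.anchorComp (contract X a)) v := by
    rw [alternatizeUncurryFin_apply, Fin.sum_univ_succ, alternatizeUncurryFin_apply]
    simp only [removeNth_succ_cons, removeNth_zero_cons, Matrix.cons_val_zero,
      Matrix.cons_val_succ, Fin.val_zero, pow_zero, one_smul, Fin.val_succ, pow_succ, mul_neg,
      mul_one, neg_smul, Finset.sum_neg_distrib, ← sub_eq_add_neg, anchorComp_apply,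
      contract_apply]
  rw [ModuleDerivation.lie_apply]
  have h0 : 𝒜.koszulReal a (Matrix.vecCons X v) =
      alternatizeUncurryFin (𝒜.anchorComp a) (Matrix.vecCons X v) - (1 / 2 : ℝ) •
        alternatizeUncurryFin (alternatizeUncurryFinLM ∘ₗ 𝒜.bracketContract a)
          (Matrix.vecCons X v) := rfl
  rw [h0, bracketContract_cons, h1]
  cases k with
  | zero =>
    -- With two arguments the only other ordered pair is the reversed one, which by skew-symmetry
    -- repeats the first sum; the factor 1/2 compensates.
    have h2 : ∑ i : Fin 1, (-1 : ℤ) ^ ((i : ℕ) + 1) • alternatizeUncurryFin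
        (𝒜.bracketContract a (v i)) (Matrix.vecCons X (i.removeNth v)) =
        ∑ i, a (Function.update v i (𝒜.bracket X (v i))) := by
      rw [sum_update_eq]
      simp only [Fin.sum_univ_one, alternatizeUncurryFin_apply, bracketContract_apply]
      simp [𝒜.bracket_neg_cons a X]
    rw [h2]
    change _ = _ - alternatizeUncurryFin (𝒜.anchorComp (contract X a)) v
    simp only [ad]
    module
  | succ k =>
    -- The pairs with X in second place repeat the first sum, and 1/2 removes the doubling. Where X
    -- is an untouched argument, moving it past the bracket gives minus the double sum of i_X a.
    have h2 : ∑ i : Fin (k + 2), (-1 : ℤ) ^ ((i : ℕ) + 1) • alternatizeUncurryFin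
        (𝒜.bracketContract a (v i)) (Matrix.vecCons X (i.removeNth v)) =
        ∑ i, a (Function.update v i (𝒜.bracket X (v i))) -
        alternatizeUncurryFin (alternatizeUncurryFinLM ∘ₗ 𝒜.bracketContract (contract X a)) v := by
      rw [sum_update_eq, alternatizeUncurryFin_apply, ← Finset.sum_sub_distrib]
      refine Finset.sum_congr rfl fun i _ ↦ ?_
      rw [alternatizeUncurryFin_apply, Fin.sum_univ_succ, LinearMap.comp_apply,
        alternatizeUncurryFinLM_apply, alternatizeUncurryFin_apply, pow_succ, mul_neg, mul_one,
        neg_smul, smul_add, neg_add, sub_eq_add_neg]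
      congr 1
      · simp only [Fin.val_zero, pow_zero, one_smul, bracketContract_apply, Matrix.cons_val_zero,
          removeNth_zero_cons, 𝒜.bracket_neg_cons a X, smul_neg]
      · rw [← smul_neg, ← smul_neg, ← Finset.sum_neg_distrib, ← Finset.sum_neg_distrib]
        congr 1
        refine Finset.sum_congr rfl fun j _ ↦ ?_
        rw [Fin.val_succ, pow_succ, mul_neg, mul_one, neg_smul, neg_neg, bracketContract_apply,
          bracketContract_apply, removeNth_succ_cons, Matrix.cons_val_succ, contract_apply,
          ← smul_neg]
        congr 1
        simp only [← contract_apply]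
        rw [contract_contract, AlternatingMap.neg_apply]
    rw [h2]
    change _ = _ - (alternatizeUncurryFin (𝒜.anchorComp (contract X a)) v - (1 / 2 : ℝ) • _)
    simp only [ad]
    module

theorem koszulReal_smul_form {k : ℕ} (f : R) (b : N [⋀^Fin k]→ₗ[R] R) (v : Fin (k + 1) → N) :
    𝒜.koszulReal (f • b) v = f * 𝒜.koszulReal b v +
      ∑ i : Fin (k + 1), (-1 : ℤ) ^ (i : ℕ) • (𝒜.anchor (v i) f * b (i.removeNth v)) := by
  have h1 : alternatizeUncurryFin (𝒜.anchorComp (f • b)) v =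
      f * alternatizeUncurryFin (𝒜.anchorComp b) v +
      ∑ i : Fin (k + 1), (-1 : ℤ) ^ (i : ℕ) • (𝒜.anchor (v i) f * b (i.removeNth v)) := by
    simp only [alternatizeUncurryFin_apply, anchorComp_apply, AlternatingMap.smul_apply,
      smul_eq_mul, 𝒜.anchor_mul, smul_add, Finset.sum_add_distrib, Finset.mul_sum, mul_smul_comm]
  cases k with
  | zero => exact h1
  | succ k =>
    have h2 : alternatizeUncurryFin (alternatizeUncurryFinLM ∘ₗ 𝒜.bracketContract (f • b)) v =
        f * alternatizeUncurryFin (alternatizeUncurryFinLM ∘ₗ 𝒜.bracketContract b) v := by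
      simp only [alternatizeUncurryFin_apply, LinearMap.comp_apply, alternatizeUncurryFinLM_apply,
        bracketContract_apply, AlternatingMap.smul_apply, smul_eq_mul, Finset.mul_sum,
        mul_smul_comm]
    simp only [koszulReal, AlternatingMap.sub_apply, AlternatingMap.smul_apply, h1, h2, mul_sub,
      mul_smul_comm]
    abel

theorem lie_ad_smul {k : ℕ} (f : R) (X : N) (a : N [⋀^Fin (k + 1)]→ₗ[R] R)
    (v : Fin (k + 1) → N) :
    (𝒜.ad (f • X)).lie a v = f * (𝒜.ad X).lie a v +
      ∑ i : Fin (k + 1), (-1 : ℤ) ^ (i : ℕ) •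
        (𝒜.anchor (v i) f * contract X a (i.removeNth v)) := by
  have h : ∀ Y, 𝒜.bracket (f • X) Y = f • 𝒜.bracket X Y - 𝒜.anchor Y f • X := fun Y ↦ by
    rw [𝒜.skew, 𝒜.leibniz, 𝒜.skew X Y]
    module
  rw [ModuleDerivation.lie_apply, ModuleDerivation.lie_apply, sum_update_eq, sum_update_eq]
  simp only [ad, h, ← contract_apply, contract_sub, contract_smul, AlternatingMap.sub_apply,
    AlternatingMap.smul_apply, map_smul, LinearMap.smul_apply, smul_eq_mul, smul_sub,
    Finset.sum_sub_distrib, mul_sub, Finset.mul_sum, mul_smul_comm]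
  abel

/-- By Cartan's formula the expression is L_(fX) a - d(f i_X a). The terms containing derivatives of
f are the same in `lie_ad_smul` and `koszulReal_smul_form`, so they cancel. -/
theorem koszulReal_smul {k : ℕ} (a : N [⋀^Fin k]→ₗ[R] R) (f : R) (X : N) (v : Fin k → N) :
    𝒜.koszulReal a (Matrix.vecCons (f • X) v) = f * 𝒜.koszulReal a (Matrix.vecCons X v) := by
  cases k with
  | zero => simp [koszulReal, alternatizeUncurryFin_apply, anchorComp_apply]
  | succ k =>
    rw [koszulReal_cons, koszulReal_cons, lie_ad_smul, contract_smul, koszulReal_smul_form]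
    ring

/-- The differential of a skew algebroid. -/
def d {k : ℕ} : (N [⋀^Fin k]→ₗ[R] R) →ₗ[ℝ] (N [⋀^Fin (k + 1)]→ₗ[R] R) where
  toFun a := alternatingOfHomogeneous (𝒜.koszulReal a) (𝒜.koszulReal_smul a)
  map_add' a b := by
    ext v
    change 𝒜.koszulReal (a + b) v = 𝒜.koszulReal a v + 𝒜.koszulReal b v
    cases k <;> simp [koszulReal, alternatizeUncurryFin_apply, anchorComp_apply,
      bracketContract_apply, Finset.sum_add_distrib]
    module
  map_smul' c a := by
    ext v
    change 𝒜.koszulReal (c • a) v = c • 𝒜.koszulReal a v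
    cases k <;> simp [koszulReal, alternatizeUncurryFin_apply, anchorComp_apply,
      bracketContract_apply, Finset.smul_sum, smul_sub, smul_comm c]

theorem d_apply {k : ℕ} (a : N [⋀^Fin k]→ₗ[R] R) (v : Fin (k + 1) → N) :
    𝒜.d a v = 𝒜.koszulReal a v := rfl

theorem contract_d_zero (a : N [⋀^Fin 0]→ₗ[R] R) (X : N) :
    contract X (𝒜.d a) = (𝒜.ad X).lie a := by
  refine ext_deg_zero ?_
  rw [ModuleDerivation.lie_zero_apply, contract_apply, d_apply]
  simp [koszulReal, alternatizeUncurryFin_apply, anchorComp_apply, ad]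

/-- Cartan's formula. -/
theorem contract_d {k : ℕ} (a : N [⋀^Fin (k + 1)]→ₗ[R] R) (X : N) :
    contract X (𝒜.d a) = (𝒜.ad X).lie a - 𝒜.d (contract X a) := by
  ext v
  exact 𝒜.koszulReal_cons a X v

/-- The differential of a function. -/
def grad (f : R) : N →ₗ[R] R where
  toFun X := 𝒜.anchor X f
  map_add' X Y := by simp
  map_smul' g X := by simp

theorem grad_apply (f : R) (X : N) : 𝒜.grad f X = 𝒜.anchor X f := rfl

theorem d_smul {k : ℕ} (f : R) (a : N [⋀^Fin k]→ₗ[R] R) :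
    𝒜.d (f • a) = wedgeOne (𝒜.grad f) a + f • 𝒜.d a := by
  induction k with
  | zero =>
    refine ext_contract fun X ↦ ?_
    simp only [contract_d_zero, map_add, map_smul, contract_wedgeOne_zero,
      ModuleDerivation.lie_smul, grad_apply, ad]
    abel
  | succ k ih =>
    refine ext_contract fun X ↦ ?_
    simp only [contract_d, map_add, map_smul, contract_wedgeOne, smul_sub,
      ModuleDerivation.lie_smul, grad_apply, ih (contract X a), ad]
    abel

theorem contractTwo_d (φ : N →ₗ[R] R) (X : N) :
    contractTwo (𝒜.d (degOneEquiv φ)) X = (𝒜.ad X).dual φ - 𝒜.grad (φ X) := by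
  apply degOneEquiv.injective
  rw [degOneEquiv_contractTwo, contract_d, ModuleDerivation.lie_degOneEquiv, map_sub]
  congr 1
  ext v
  have h := 𝒜.contract_d_zero (contract X (degOneEquiv φ)) (v 0)
  have h' := congrArg (fun c ↦ c ![]) h
  simp only [ModuleDerivation.lie_zero_apply, contract_apply] at h'
  rw [degOneEquiv_apply, grad_apply]
  refine Eq.trans ?_ h'
  congr 1
  funext i
  fin_cases i
  rfl

/-- After contraction, Cartan's formula reduces this to the derivation rule for L_X, to `d_smul` for
the coefficient φ X, and to the same claim for i_X b. -/
theorem d_wedgeOne {k : ℕ} (φ : N →ₗ[R] R) (b : N [⋀^Fin k]→ₗ[R] R) :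
    𝒜.d (wedgeOne φ b) = wedgeTwo (𝒜.d (degOneEquiv φ)) b - wedgeOne φ (𝒜.d b) := by
  induction k with
  | zero =>
    refine ext_contract fun X ↦ ?_
    simp only [contract_d, contract_d_zero, map_sub, contract_wedgeOne, contract_wedgeOne_zero,
      contract_wedgeTwo_zero, contractTwo_d, ModuleDerivation.lie_wedgeOne, d_smul,
      LinearMap.sub_apply]
    abel
  | succ k ih =>
    refine ext_contract fun X ↦ ?_
    simp only [contract_d, map_sub, contract_wedgeOne, contract_wedgeTwo, contractTwo_d,
      ModuleDerivation.lie_wedgeOne, d_smul, LinearMap.sub_apply, ih (contract X b)]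
    abel

theorem d_wedgeTwo {k : ℕ} (a : N [⋀^Fin 2]→ₗ[R] R) (b : N [⋀^Fin k]→ₗ[R] R) :
    𝒜.d (wedgeTwo a b) = wedgeThree (𝒜.d a) b + wedgeTwo a (𝒜.d b) := by
  induction k with
  | zero =>
    refine ext_contract fun X ↦ ?_
    simp only [contract_d, contract_d_zero, map_add, contract_wedgeTwo, contract_wedgeTwo_zero,
      contract_wedgeThree_zero, d_wedgeOne, degOneEquiv_contractTwo,
      ModuleDerivation.lie_wedgeTwo, map_sub, LinearMap.sub_apply]
    abel
  | succ k ih =>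
    refine ext_contract fun X ↦ ?_
    simp only [contract_d, map_add, contract_wedgeTwo, contract_wedgeThree, d_wedgeOne,
      degOneEquiv_contractTwo, ModuleDerivation.lie_wedgeTwo, map_sub, LinearMap.sub_apply,
      ih (contract X b)]
    abel

/-- The conditions for a skew algebroid to be a Lie algebroid. -/
structure IsLie : Prop where
  anchor_bracket : ∀ X Y f, 𝒜.anchor X (𝒜.anchor Y f) - 𝒜.anchor Y (𝒜.anchor X f) =
    𝒜.anchor (𝒜.bracket X Y) f
  jacobi : ∀ X Y Z, 𝒜.bracket X (𝒜.bracket Y Z) - 𝒜.bracket Y (𝒜.bracket X Z) =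
    𝒜.bracket (𝒜.bracket X Y) Z

variable {𝒜}

theorem lie_lie_ad (h : 𝒜.IsLie) {k : ℕ} (X Y : N) (a : N [⋀^Fin k]→ₗ[R] R) :
    (𝒜.ad X).lie ((𝒜.ad Y).lie a) - (𝒜.ad Y).lie ((𝒜.ad X).lie a) =
      (𝒜.ad (𝒜.bracket X Y)).lie a :=
  ModuleDerivation.lie_lie _ _ _ (h.anchor_bracket X Y) (h.jacobi X Y) a

/-- In the contracted identity the defect is [L_X, L_Y] - L_[X,Y]; this is where the anchor
condition and the Jacobi identity are used. -/
theorem lie_d (h : 𝒜.IsLie) {k : ℕ} (X : N) (a : N [⋀^Fin k]→ₗ[R] R) :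
    (𝒜.ad X).lie (𝒜.d a) = 𝒜.d ((𝒜.ad X).lie a) := by
  induction k with
  | zero =>
    refine ext_contract fun Y ↦ ?_
    simp only [ModuleDerivation.contract_lie, contract_d_zero]
    change _ - (𝒜.ad (𝒜.bracket X Y)).lie a = _
    rw [← lie_lie_ad h]
    abel
  | succ k ih =>
    refine ext_contract fun Y ↦ ?_
    simp only [ModuleDerivation.contract_lie, contract_d, map_sub, ← ih (contract Y a)]
    change _ - ((𝒜.ad (𝒜.bracket X Y)).lie a - 𝒜.d (contract (𝒜.bracket X Y) a)) =
      _ - (_ - 𝒜.d (contract (𝒜.bracket X Y) a))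
    rw [← lie_lie_ad h]
    abel

/-- Cartan's formula twice, with L_X d = d L_X, gives i_X d d a = d d (i_X a); in degree 0 the
right-hand side is absent. -/
theorem d_d (h : 𝒜.IsLie) {k : ℕ} (a : N [⋀^Fin k]→ₗ[R] R) : 𝒜.d (𝒜.d a) = 0 := by
  induction k with
  | zero =>
    refine ext_contract fun X ↦ ?_
    rw [contract_d, contract_d_zero, lie_d h, sub_self, _root_.map_zero]
  | succ k ih =>
    refine ext_contract fun X ↦ ?_
    rw [contract_d, contract_d, lie_d h, map_sub, ih, _root_.map_zero, sub_zero, sub_self]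

end SkewAlgebroid

end Algebroid

end LJ

namespace LJ

/-! ### Vector fields in charts and local frames -/

section Geometry

open Set Filter Topology

variable {n : ℕ} {M : Type*} [TopologicalSpace M] [ChartedSpace (EuclideanSpace ℝ (Fin n)) M]
  [IsManifold (𝓡 n) ∞ M]

section Commutator

theorem isManifold_two : IsManifold (𝓡 n) 2 M :=
  IsManifold.of_le (n := ∞) (WithTop.coe_le_coe.2 le_top)

theorem isManifold_minSmoothness_three : IsManifold (𝓡 n) (minSmoothness ℝ 3) M := by
  rw [minSmoothness_of_isRCLikeNormedField]
  exact IsManifold.of_le (n := ∞) (WithTop.coe_le_coe.2 le_top)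

/-- A vector field, written in the chart at `x₀`. -/
def chartField (x₀ : M) (X : VF n M) (y : EuclideanSpace ℝ (Fin n)) : EuclideanSpace ℝ (Fin n) :=
  VectorField.mpullbackWithin 𝓘(ℝ, EuclideanSpace ℝ (Fin n)) (𝓡 n) (extChartAt (𝓡 n) x₀).symm X
    (range (𝓡 n)) y

theorem range_model : range (𝓡 n) = univ := by simp

theorem differentiableAt_chartField (x₀ : M) (X : VF n M) :
    DifferentiableAt ℝ (chartField x₀ X) (extChartAt (𝓡 n) x₀ x₀) := by
  have := isManifold_two (n := n) (M := M)
  have h := MDifferentiableWithinAt.differentiableWithinAt_mpullbackWithin_vectorField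
    (I := 𝓡 n) (s := univ) (X.mdifferentiableAt (x := x₀)).mdifferentiableWithinAt
  rw [preimage_univ, univ_inter, range_model] at h
  have hc : chartField x₀ X = fun y ↦ VectorField.mpullbackWithin 𝓘(ℝ, EuclideanSpace ℝ (Fin n))
      (𝓡 n) (extChartAt (𝓡 n) x₀).symm X univ y := by
    funext y
    rw [chartField, range_model]
  rw [← differentiableWithinAt_univ, hc]
  exact h

/-- The derivative along a vector field, computed in a chart. -/
theorem fderiv_chart_apply (x₀ : M) (g : Fn n M) (X : VF n M) {y : EuclideanSpace ℝ (Fin n)}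
    (hy : y ∈ (extChartAt (𝓡 n) x₀).target) :
    fderiv ℝ (g ∘ (extChartAt (𝓡 n) x₀).symm) y (chartField x₀ X y) =
      deriv X g ((extChartAt (𝓡 n) x₀).symm y) := by
  have h1 := mdifferentiableWithinAt_extChartAt_symm (I := 𝓡 n) hy
  have hinv := isInvertible_mfderivWithin_extChartAt_symm (I := 𝓡 n) hy
  have h2 : mfderiv 𝓘(ℝ, EuclideanSpace ℝ (Fin n)) 𝓘(ℝ, ℝ) (g ∘ (extChartAt (𝓡 n) x₀).symm) y =
      (mfderiv (𝓡 n) 𝓘(ℝ, ℝ) g ((extChartAt (𝓡 n) x₀).symm y)).comp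
        (mfderivWithin 𝓘(ℝ, EuclideanSpace ℝ (Fin n)) (𝓡 n) (extChartAt (𝓡 n) x₀).symm
          (range (𝓡 n)) y) := by
    rw [← mfderivWithin_univ, ← range_model]
    exact mfderiv_comp_mfderivWithin (I := 𝓘(ℝ, EuclideanSpace ℝ (Fin n))) (I' := 𝓡 n)
      (I'' := 𝓘(ℝ, ℝ)) y (fn_mdiffAt g ((extChartAt (𝓡 n) x₀).symm y)) h1
      (uniqueMDiffWithinAt_iff_uniqueDiffWithinAt.2 (by rw [range_model]; exact uniqueDiffWithinAt_univ))
  rw [mfderiv_eq_fderiv] at h2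
  rw [h2]
  change mfderiv (𝓡 n) 𝓘(ℝ, ℝ) g _ (mfderivWithin _ _ _ _ _ (ContinuousLinearMap.inverse _ _)) = _
  rw [hinv.self_apply_inverse]
  rfl

theorem deriv_eq_fderiv_chart (x₀ : M) (g : Fn n M) (X : VF n M) :
    deriv X g x₀ = fderiv ℝ (g ∘ (extChartAt (𝓡 n) x₀).symm) (extChartAt (𝓡 n) x₀ x₀)
      (mfderiv (𝓡 n) 𝓘(ℝ, EuclideanSpace ℝ (Fin n)) (extChartAt (𝓡 n) x₀) x₀ (X x₀)) := by
  have hev : (g : M → ℝ) =ᶠ[𝓝 x₀] (g ∘ (extChartAt (𝓡 n) x₀).symm) ∘ extChartAt (𝓡 n) x₀ := by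
    filter_upwards [extChartAt_source_mem_nhds (I := 𝓡 n) x₀] with z hz
    simp only [Function.comp_apply, (extChartAt (𝓡 n) x₀).left_inv hz]
  have hd : MDifferentiableAt 𝓘(ℝ, EuclideanSpace ℝ (Fin n)) 𝓘(ℝ, ℝ)
      (g ∘ (extChartAt (𝓡 n) x₀).symm) (extChartAt (𝓡 n) x₀ x₀) :=
    ((g.contMDiff.contMDiffAt).comp _ ((contMDiffOn_extChartAt_symm x₀).contMDiffAt
      (extChartAt_target_mem_nhds (I := 𝓡 n) x₀))).mdifferentiableAt (n := ∞) (by simp)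
  have h := hev.mfderiv_eq (I := 𝓡 n) (I' := 𝓘(ℝ, ℝ))
  rw [mfderiv_comp x₀ hd (mdifferentiableAt_extChartAt (mem_chart_source _ x₀)),
    mfderiv_eq_fderiv] at h
  change mfderiv (𝓡 n) 𝓘(ℝ, ℝ) g x₀ (X x₀) = _
  rw [h]
  rfl

theorem mfderiv_chart_bracket (x₀ : M) (X Y : VF n M) :
    mfderiv (𝓡 n) 𝓘(ℝ, EuclideanSpace ℝ (Fin n)) (extChartAt (𝓡 n) x₀) x₀ (bracket X Y x₀) =
      VectorField.lieBracket ℝ (chartField x₀ X) (chartField x₀ Y) (extChartAt (𝓡 n) x₀ x₀) := by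
  have := isManifold_two (n := n) (M := M)
  have h1 : bracket X Y x₀ =
      (mfderiv (𝓡 n) 𝓘(ℝ, EuclideanSpace ℝ (Fin n)) (extChartAt (𝓡 n) x₀) x₀).inverse
        (VectorField.lieBracketWithin (E := EuclideanSpace ℝ (Fin n)) ℝ (chartField x₀ X) (chartField x₀ Y)
          ((extChartAt (𝓡 n) x₀).symm ⁻¹' univ ∩ range (𝓡 n)) (extChartAt (𝓡 n) x₀ x₀)) := rfl
  rw [h1]
  refine ((isInvertible_mfderiv_extChartAt (mem_extChartAt_source x₀)).self_apply_inverse _).trans ?_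
  rw [preimage_univ, univ_inter, range_model, VectorField.lieBracketWithin_univ]

/-- In a chart, the second-order terms cancel by symmetry of the second derivative of f, leaving the
derivative along the bracket of the coordinate fields. -/
theorem deriv_bracket (X Y : VF n M) (f : Fn n M) :
    deriv (bracket X Y) f = deriv X (deriv Y f) - deriv Y (deriv X f) := by
  ext x₀
  have hnhds := extChartAt_target_mem_nhds (I := 𝓡 n) x₀
  have hf : ContDiffAt ℝ 2 (f ∘ (extChartAt (𝓡 n) x₀).symm) (extChartAt (𝓡 n) x₀ x₀) := by
    have h1 : ContMDiffAt 𝓘(ℝ, EuclideanSpace ℝ (Fin n)) 𝓘(ℝ, ℝ) ∞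
        (f ∘ (extChartAt (𝓡 n) x₀).symm) (extChartAt (𝓡 n) x₀ x₀) :=
      (f.contMDiff.contMDiffAt).comp _ ((contMDiffOn_extChartAt_symm x₀).contMDiffAt hnhds)
    exact h1.contDiffAt.of_le (WithTop.coe_le_coe.2 le_top)
  -- The inner derivative is identified on a whole neighbourhood, not only at x₀, because it is
  -- differentiated again.
  have hgen : ∀ Z W : VF n M,
      fderiv ℝ (fun y ↦ fderiv ℝ (f ∘ (extChartAt (𝓡 n) x₀).symm) y (chartField x₀ Z y))
        (extChartAt (𝓡 n) x₀ x₀) (chartField x₀ W (extChartAt (𝓡 n) x₀ x₀)) =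
        deriv W (deriv Z f) x₀ := fun Z W ↦ by
    have h1 := fderiv_chart_apply x₀ (deriv Z f) W (mem_extChartAt_target x₀)
    rw [extChartAt_to_inv x₀] at h1
    rw [← h1]
    congr 1
    apply Filter.EventuallyEq.fderiv_eq
    filter_upwards [hnhds] with y hy
    exact fderiv_chart_apply x₀ f Z hy
  rw [deriv_eq_fderiv_chart, mfderiv_chart_bracket, VectorField.fderiv_apply_lieBracket hf (by simp)
    (differentiableAt_chartField x₀ Y) (differentiableAt_chartField x₀ X), hgen, hgen]
  rfl

theorem bracket_jacobi (X Y Z : VF n M) :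
    bracket X (bracket Y Z) - bracket Y (bracket X Z) = bracket (bracket X Y) Z := by
  have := isManifold_minSmoothness_three (n := n) (M := M)
  have h : ∀ X : VF n M, ContMDiff (𝓡 n) ((𝓡 n).prod 𝓘(ℝ, EuclideanSpace ℝ (Fin n)))
      (minSmoothness ℝ 2) (fun x ↦ (X x : TangentBundle (𝓡 n) M)) := fun X ↦
    X.contMDiff.of_le (by
      rw [minSmoothness_of_isRCLikeNormedField]
      exact WithTop.coe_le_coe.2 le_top)
  rw [sub_eq_iff_eq_add]
  ext x : 1
  exact VectorField.leibniz_identity_mlieBracket_apply (h X x) (h Y x) (h Z x)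

end Commutator

/-- Evaluation of vector fields at a point. -/
def evalAt (y : M) : VF n M →+ TangentSpace (𝓡 n) y where
  toFun X := X y
  map_zero' := rfl
  map_add' _ _ := rfl

section LocalFrame

variable [T2Space M]

/-- Take bump functions with χ = 1 on a neighbourhood of the support of θ, and put X_i = θ ∂_i, f_j
= χ x_j. On supp θ one has df_j = dx_j, so θ Y = ∑ dx_i(Y) θ ∂_i is an identity between global
fields; off supp θ both sides vanish. -/
theorem exists_local_frame (x₀ : M) :
    ∃ (θ : Fn n M) (X : Fin n → VF n M) (f : Fin n → Fn n M), θ x₀ = 1 ∧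
      (∀ i j, deriv (X i) (f j) x₀ = if i = j then 1 else 0) ∧
      ∀ Y : VF n M, θ • Y = ∑ i, deriv Y (f i) • X i := by
  obtain ⟨χ⟩ : Nonempty (SmoothBumpFunction (𝓡 n) x₀) := inferInstance
  set U : Set M := _root_.interior {y | χ y = 1} with hU
  have hUx : U ∈ 𝓝 x₀ := by
    rw [hU, interior_mem_nhds]
    exact χ.eventuallyEq_one
  obtain ⟨θ, -, hθ⟩ := (SmoothBumpFunction.nhds_basis_tsupport (I := 𝓡 n) x₀).mem_iff.1 hUx
  have hsrc : tsupport θ ⊆ (chartAt (EuclideanSpace ℝ (Fin n)) x₀).source :=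
    θ.tsupport_subset_chartAt_source
  set e := trivializationAt (EuclideanSpace ℝ (Fin n)) (TangentSpace (𝓡 n) : M → Type _) x₀ with he
  set b := (EuclideanSpace.basisFun (Fin n) ℝ).toBasis with hb
  have hbase : e.baseSet = (chartAt (EuclideanSpace ℝ (Fin n)) x₀).source :=
    TangentBundle.trivializationAt_baseSet x₀
  set φ := extChartAt (𝓡 n) x₀ with hφ
  let X : Fin n → VF n M := fun i ↦ ⟨(θ : M → ℝ) • e.localFrame b i,
    ContMDiffOn.smul_section_of_tsupport θ.contMDiff.contMDiffOn e.open_baseSet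
      (hbase ▸ hsrc) (e.contMDiffOn_localFrame_baseSet _ b i)⟩
  let f : Fin n → Fn n M := fun j ↦ ⟨fun y ↦ χ y • (φ y) j, χ.contMDiff_smul (by
    have h1 : ContMDiffOn (𝓡 n) 𝓘(ℝ, EuclideanSpace ℝ (Fin n)) ∞ φ
      (chartAt (EuclideanSpace ℝ (Fin n)) x₀).source := contMDiffOn_extChartAt
    have h2 : ContMDiff 𝓘(ℝ, EuclideanSpace ℝ (Fin n)) 𝓘(ℝ, ℝ) ∞
        (EuclideanSpace.proj j : EuclideanSpace ℝ (Fin n) →L[ℝ] ℝ) :=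
      (EuclideanSpace.proj j : EuclideanSpace ℝ (Fin n) →L[ℝ] ℝ).contMDiff
    exact h2.comp_contMDiffOn h1)⟩
  have hderiv : ∀ (Y : VF n M) (j : Fin n) (y : M), θ y ≠ 0 →
      deriv Y (f j) y = (e.continuousLinearMapAt ℝ y (Y y)) j := fun Y j y hy ↦ by
    have hyt : y ∈ tsupport θ := subset_tsupport _ hy
    have hys := hsrc hyt
    have hev : (f j : M → ℝ) =ᶠ[𝓝 y]
        (EuclideanSpace.proj j : EuclideanSpace ℝ (Fin n) →L[ℝ] ℝ) ∘ φ := by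
      filter_upwards [isOpen_interior.mem_nhds (hθ hyt)] with z hz
      have hz1 : χ z = 1 := by simpa using (interior_subset hz : z ∈ {y | χ y = 1})
      change χ z • (φ z) j = (φ z) j
      rw [hz1, one_smul]
    have hcl := TangentBundle.continuousLinearMapAt_trivializationAt (I := 𝓡 n) hys
    refine Eq.trans ?_ (congrArg (fun L ↦ (L (Y y) : EuclideanSpace ℝ (Fin n)) j) hcl).symm
    have hφd : MDifferentiableAt (𝓡 n) 𝓘(ℝ, EuclideanSpace ℝ (Fin n)) φ y :=
      mdifferentiableAt_extChartAt hys
    have h1 : mfderiv (𝓡 n) 𝓘(ℝ, ℝ) (f j) y =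
        (EuclideanSpace.proj j : EuclideanSpace ℝ (Fin n) →L[ℝ] ℝ).comp
          (mfderiv (𝓡 n) 𝓘(ℝ, EuclideanSpace ℝ (Fin n)) φ y) := by
      rw [hev.mfderiv_eq, mfderiv_comp y
        (EuclideanSpace.proj j : EuclideanSpace ℝ (Fin n) →L[ℝ] ℝ).mdifferentiableAt hφd]
      congr 1
      exact ContinuousLinearMap.mfderiv_eq _
    change mfderiv (𝓡 n) 𝓘(ℝ, ℝ) (f j) y (Y y) = _
    rw [h1]
    rfl
  have hX : ∀ i y, y ∈ e.baseSet → X i y = θ y • e.symmL ℝ y (b i) := fun i y hy ↦ by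
    change θ y • e.localFrame b i y = _
    rw [e.localFrame_apply_of_mem_baseSet b hy, Bundle.Trivialization.basisAt,
      Module.Basis.map_apply, e.symmL_apply hy]
    rfl
  refine ⟨⟨θ, θ.contMDiff⟩, X, f, θ.eq_one, fun i j ↦ ?_, fun Y ↦ ?_⟩
  · have hx : x₀ ∈ e.baseSet := hbase ▸ mem_chart_source _ _
    rw [hderiv _ _ _ (by rw [θ.eq_one]; exact one_ne_zero), hX i x₀ hx, θ.eq_one, one_smul,
      e.continuousLinearMapAt_symmL hx]
    simp [hb, eq_comm]
  · ext y : 1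
    have hsum : (∑ i, deriv Y (f i) • X i) y = ∑ i, deriv Y (f i) y • X i y :=
      map_sum (evalAt y) (fun i ↦ deriv Y (f i) • X i) Finset.univ
    rw [hsum]
    by_cases hy : θ y = 0
    · have hX0 : ∀ i, X i y = 0 := fun i ↦ by
        change θ y • e.localFrame b i y = 0
        rw [hy, zero_smul]
      simp only [hX0, smul_zero, Finset.sum_const_zero]
      change θ y • Y y = 0
      rw [hy, zero_smul]
    · have hyb : y ∈ e.baseSet := hbase ▸ hsrc (subset_tsupport _ hy)
      simp only [hX _ y hyb, hderiv Y _ y hy, smul_comm _ (θ y), ← Finset.smul_sum]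
      change θ y • Y y = _
      congr 1
      refine (e.symmL_continuousLinearMapAt (R := ℝ) hyb (Y y)).symm.trans ?_
      set w := e.continuousLinearMapAt ℝ y (Y y) with hw
      simp only [← map_smul, ← map_sum]
      congr 1
      have := b.sum_repr w
      simpa [hb] using this.symm

end LocalFrame

end Geometry

end LJ

namespace LJ

/-! ### Exact 1-forms determine multivectors; nondegeneracy makes ♭ bijective -/

section InverseMap

variable {R N N' : Type*} [CommRing R] [AddCommGroup N] [Module R N] [AddCommGroup N'] [Module R N']
  {f : N →ₗ[R] N'}

theorem inverseMap_apply (h : Function.Bijective f) (x : N) : inverseMap f (f x) = x := by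
  rw [inverseMap, dif_pos h]
  exact (LinearEquiv.ofBijective f h).symm_apply_apply x

theorem apply_inverseMap (h : Function.Bijective f) (y : N') : f (inverseMap f y) = y := by
  rw [inverseMap, dif_pos h]
  exact (LinearEquiv.ofBijective f h).apply_symm_apply y

end InverseMap

section Geometry

open Set Filter Topology

variable {n : ℕ} {M : Type*} [TopologicalSpace M] [ChartedSpace (EuclideanSpace ℝ (Fin n)) M]
  [IsManifold (𝓡 n) ∞ M]

/-- Evaluation of functions at a point. -/
def evalFn (x : M) : Fn n M →+* ℝ where
  toFun f := f x
  map_one' := rfl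
  map_mul' _ _ := rfl
  map_zero' := rfl
  map_add' _ _ := rfl

theorem evalFn_apply (x : M) (f : Fn n M) : evalFn x f = f x := rfl

theorem flatOne_apply (Ω : Form n M 2) (X Y : VF n M) : flatOne Ω X Y = Ω ![X, Y] := rfl

theorem flatOne_swap (Ω : Form n M 2) (X Y : VF n M) : flatOne Ω X Y = -flatOne Ω Y X := by
  rw [flatOne_apply, flatOne_apply]
  exact form_swap Ω Y X ![]

theorem flatOne_injective {Ω : Form n M 2}
    (hΩ : ∀ (x : M) (X : VF n M), (∀ Y, Ω ![X, Y] x = 0) → X x = 0) :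
    Function.Injective (flatOne Ω) := by
  rw [← LinearMap.ker_eq_bot, LinearMap.ker_eq_bot']
  intro X hX
  ext x : 1
  refine hΩ x X fun Y ↦ ?_
  rw [← flatOne_apply, hX]
  rfl

/-- Reflexivity comes from ♭ itself: its transpose under the evaluation pairing is -♭, so
bijectivity of ♭ forces bijectivity of evaluation. -/
theorem dual_eval_bijective {Ω : Form n M 2} (h : Function.Bijective (flatOne Ω)) :
    Function.Bijective (Module.Dual.eval (Fn n M) (VF n M)) := by
  constructor
  · rw [← LinearMap.ker_eq_bot, LinearMap.ker_eq_bot']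
    intro X hX
    refine h.1 ?_
    rw [map_zero]
    ext1 Y
    rw [flatOne_swap]
    have : flatOne Ω Y X = 0 := congrArg (fun ξ ↦ ξ (flatOne Ω Y)) hX
    rw [this, neg_zero]
    rfl
  · intro ξ
    obtain ⟨X, hX⟩ := h.2 (ξ ∘ₗ flatOne Ω)
    refine ⟨-X, ?_⟩
    ext1 α
    obtain ⟨Y, rfl⟩ := h.2 α
    have h1 : flatOne Ω X Y = ξ (flatOne Ω Y) := congrArg (fun β ↦ β Y) hX
    rw [← h1, flatOne_swap]
    exact map_neg (flatOne Ω Y) X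

theorem smul_oneForm_eq {θ : Fn n M} {X : Fin n → VF n M} {f : Fin n → Fn n M}
    (h : ∀ Y : VF n M, θ • Y = ∑ i, deriv Y (f i) • X i) (α : OneForm n M) :
    θ • α = ∑ i, α (X i) • dFn (f i) := by
  ext1 Y
  have h1 : α (θ • Y) = α (∑ i, deriv Y (f i) • X i) := by rw [h Y]
  rw [map_smul, map_sum] at h1
  rw [LinearMap.smul_apply, h1, LinearMap.sum_apply]
  refine Finset.sum_congr rfl fun i _ ↦ ?_
  rw [map_smul, LinearMap.smul_apply, smul_eq_mul, smul_eq_mul, mul_comm]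
  rfl

variable [T2Space M]

/-- A multivector field is determined by its values on exact `1`-forms. -/
theorem multiVF_ext {k : ℕ} {P Q : MultiVF n M k}
    (h : ∀ f : Fin k → Fn n M, P (fun i ↦ dFn (f i)) = Q (fun i ↦ dFn (f i))) : P = Q := by
  rw [← sub_eq_zero]
  set S := P - Q with hS
  have hz : ∀ f : Fin k → Fn n M, S (fun i ↦ dFn (f i)) = 0 := fun f ↦ by
    rw [hS, AlternatingMap.sub_apply, h, sub_self]
  ext α x
  obtain ⟨θ, X, f, hθ, -, hX⟩ := exists_local_frame (n := n) x
  -- Each θ α_i is a combination of exact forms, on which S vanishes, so θ^k S(α) = 0; and θ = 1 at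
  -- x.
  have h1 : S (fun i ↦ θ • α i) = (∏ _i : Fin k, θ) • S α := S.map_smul_univ (fun _ ↦ θ) α
  have h2 : S (fun i ↦ θ • α i) = 0 := by
    simp only [smul_oneForm_eq hX]
    have h3 := S.toMultilinearMap.map_sum (fun (i : Fin k) (j : Fin n) ↦ α i (X j) • dFn (f j))
    refine h3.trans (Finset.sum_eq_zero fun r _ ↦ ?_)
    have h4 := S.map_smul_univ (fun i ↦ α i (X (r i))) (fun i ↦ dFn (f (r i)))
    refine h4.trans ?_
    rw [hz, smul_zero]
  rw [h2] at h1
  have h5 := congrArg (evalFn x) h1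
  rw [smul_eq_mul, map_mul, map_prod, map_zero] at h5
  simp only [evalFn_apply, hθ, Finset.prod_const_one, one_mul] at h5
  exact h5.symm

/-- Cramer's rule for the matrix A = (Ω(X_i, X_j)) of a local frame. The adjugate keeps the solution
smooth and global, at the price of the factor g = θ det A, nonzero at x. -/
theorem exists_local_flat_eq {Ω : Form n M 2}
    (hΩ : ∀ (x : M) (X : VF n M), (∀ Y, Ω ![X, Y] x = 0) → X x = 0) (φ : OneForm n M) (x : M) :
    ∃ (Z : VF n M) (g : Fn n M), g x ≠ 0 ∧ flatOne Ω Z = g • φ := by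
  obtain ⟨θ, X, f, hθ, hδ, hX⟩ := exists_local_frame (n := n) x
  set A : Matrix (Fin n) (Fin n) (Fn n M) := Matrix.of fun i j ↦ flatOne Ω (X i) (X j) with hA
  have hflat : ∀ Z Y, θ * flatOne Ω Z Y = ∑ j, deriv Y (f j) * flatOne Ω Z (X j) := fun Z Y ↦ by
    have h1 : flatOne Ω Z (θ • Y) = flatOne Ω Z (∑ i, deriv Y (f i) • X i) := by rw [hX Y]
    rw [map_smul, map_sum] at h1
    simpa only [map_smul, smul_eq_mul] using h1
  have hdet : A.det x ≠ 0 := by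
    intro h0
    have h1 : ((evalFn x).mapMatrix A).det = 0 := by
      rw [← RingHom.map_det]
      exact h0
    -- A left null vector v of A(x) yields V = ∑ v_i X_i with Ω(V, ·) = 0 at x, hence V(x) = 0; yet
    -- V(f_j)(x) = v_j.
    obtain ⟨v, hv, hvA⟩ := Matrix.exists_vecMul_eq_zero_iff.2 h1
    obtain ⟨V, hV⟩ : ∃ V : VF n M, V = ∑ i, v i • X i := ⟨_, rfl⟩
    have hVX : ∀ j, flatOne Ω V (X j) x = 0 := fun j ↦ by
      have h2 := congrFun hvA j
      rw [Matrix.vecMul, dotProduct] at h2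
      have h3 : flatOne Ω V (X j) = ∑ i, v i • flatOne Ω (X i) (X j) := by
        rw [hV, map_sum, LinearMap.sum_apply]
        refine Finset.sum_congr rfl fun i _ ↦ ?_
        rw [real_smul_eq, map_smul, LinearMap.smul_apply, algebraMap_smul]
      rw [← evalFn_apply, h3, map_sum]
      exact h2
    have hV0 : V x = 0 := by
      refine hΩ x V fun Y ↦ ?_
      have h4 := congrArg (evalFn x) (hflat V Y)
      rw [map_mul, map_sum] at h4
      simp only [map_mul, evalFn_apply, hθ, one_mul, hVX, mul_zero, Finset.sum_const_zero] at h4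
      exact h4
    refine hv (funext fun j ↦ ?_)
    have h5 : deriv V (f j) x = 0 := by rw [deriv_apply, hV0, map_zero]
    have h6 : deriv V (f j) x = v j := by
      have h7 : dFn (f j) V = ∑ i, v i • dFn (f j) (X i) := by
        rw [hV, map_sum]
        refine Finset.sum_congr rfl fun i _ ↦ ?_
        rw [real_smul_eq, map_smul, algebraMap_smul]
      have h8 : deriv V (f j) x = ∑ i, v i * deriv (X i) (f j) x := by
        rw [← evalFn_apply, show deriv V (f j) = dFn (f j) V from rfl, h7, map_sum]
        rfl
      rw [h8]
      simp [hδ]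
    rw [← h6, h5]
    rfl
  set c : Fin n → Fn n M := Matrix.vecMul (fun j ↦ φ (X j)) A.adjugate with hc
  have hcA : Matrix.vecMul c A = A.det • fun j ↦ φ (X j) := by
    rw [hc, Matrix.vecMul_vecMul, Matrix.adjugate_mul, Matrix.vecMul_smul, Matrix.vecMul_one]
  refine ⟨θ • ∑ i, c i • X i, θ * A.det, ?_, ?_⟩
  · change θ x * A.det x ≠ 0
    rw [hθ, one_mul]
    exact hdet
  · ext1 Y
    rw [map_smul, LinearMap.smul_apply, smul_eq_mul, hflat]
    have h1 : ∀ j, flatOne Ω (∑ i, c i • X i) (X j) = A.det * φ (X j) := fun j ↦ by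
      have h2 := congrFun hcA j
      rw [map_sum, LinearMap.sum_apply]
      simp only [map_smul, LinearMap.smul_apply]
      exact h2
    simp only [h1]
    have h3 := congrArg (fun β ↦ β Y) (smul_oneForm_eq hX φ)
    simp only [LinearMap.smul_apply, LinearMap.sum_apply, smul_eq_mul] at h3 ⊢
    rw [mul_assoc, mul_left_comm, h3, Finset.mul_sum]
    refine Finset.sum_congr rfl fun j _ ↦ ?_
    change _ = A.det * (φ (X j) * deriv Y (f j))
    ring

/-- The local solutions Z_x / g_x agree wherever both are defined, by injectivity of ♭. Hence the
value at y may be read off from the solution centred at y, and near x the resulting field equals the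
smooth field Z_x / g_x, with no partition of unity. -/
theorem flatOne_bijective {Ω : Form n M 2}
    (hΩ : ∀ (x : M) (X : VF n M), (∀ Y, Ω ![X, Y] x = 0) → X x = 0) :
    Function.Bijective (flatOne Ω) := by
  have hinj := flatOne_injective hΩ
  refine ⟨hinj, fun φ ↦ ?_⟩
  choose Z g hg hZ using exists_local_flat_eq hΩ φ
  have hcompat : ∀ x y, g y • Z x = g x • Z y := fun x y ↦ by
    refine hinj ?_
    rw [map_smul, map_smul, hZ, hZ, smul_smul, smul_smul, mul_comm]
  have hval : ∀ x y, g x y ≠ 0 → (g y y)⁻¹ • Z y y = (g x y)⁻¹ • Z x y := fun x y hxy ↦ by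
    have h1 : g y y • Z x y = g x y • Z y y := congrArg (evalAt y) (hcompat x y)
    rw [inv_smul_eq_iff₀ (hg y), smul_comm, h1, inv_smul_smul₀ hxy]
  let W : VF n M := ⟨fun y ↦ (g y y)⁻¹ • Z y y, fun x ↦ by
    have hne : ∀ᶠ y in 𝓝 x, g x y ≠ 0 :=
      (g x).contMDiff.continuous.continuousAt.eventually_ne (hg x)
    have hs : ContMDiffAt (𝓡 n) ((𝓡 n).prod 𝓘(ℝ, EuclideanSpace ℝ (Fin n))) ∞
        (fun y ↦ Bundle.TotalSpace.mk' (EuclideanSpace ℝ (Fin n)) y ((g x y)⁻¹ • Z x y)) x :=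
      ((g x).contMDiff.contMDiffAt.inv₀ (hg x)).smul_section (Z x).contMDiff.contMDiffAt
    refine hs.congr_of_eventuallyEq ?_
    filter_upwards [hne] with y hy
    rw [hval x y hy]⟩
  refine ⟨W, ?_⟩
  ext Y x
  -- The second factor g x makes the identity valid also at the zeros of g x, so it is an equation
  -- of global sections to which ♭ applies; both factors are cancelled at the point x.
  have h1 : g x • g x • W = g x • Z x := by
    ext y : 1
    change g x y • g x y • ((g y y)⁻¹ • Z y y) = g x y • Z x y
    by_cases hy : g x y = 0
    · rw [hy, zero_smul, zero_smul]
    · rw [hval x y hy, smul_inv_smul₀ hy]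
  have h2 : g x * (g x * flatOne Ω W Y) = g x * (g x * φ Y) := by
    have h3 := congrArg (fun V ↦ flatOne Ω V Y) h1
    simpa only [map_smul, hZ, LinearMap.smul_apply, smul_eq_mul] using h3
  have h4 : g x x * (g x x * flatOne Ω W Y x) = g x x * (g x x * φ Y x) :=
    congrArg (evalFn x) h2
  exact mul_left_cancel₀ (hg x) (mul_left_cancel₀ (hg x) h4)

end Geometry

end LJ

namespace LJ

/-! ### Functoriality of Lie derivatives and contractions -/

section Transpose

variable {R N N' : Type*} [CommRing R] [Algebra ℝ R] [AddCommGroup N] [Module R N] [Module ℝ N]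
  [AddCommGroup N'] [Module R N'] [Module ℝ N']

/-- The module derivation induced on linear forms. -/
def ModuleDerivation.transpose (δ : ModuleDerivation R N) : ModuleDerivation R (N →ₗ[R] R) where
  D := δ.D
  A := δ.dual
  D_mul := δ.D_mul
  A_smul := δ.dual_smul

theorem ModuleDerivation.lie_compLinearMap (δ : ModuleDerivation R N) (δ' : ModuleDerivation R N')
    (g : N' →ₗ[R] N) (hD : ∀ f, δ.D f = δ'.D f) (hA : ∀ X, δ.A (g X) = g (δ'.A X)) {k : ℕ}
    (a : N [⋀^Fin k]→ₗ[R] R) : (δ.lie a).compLinearMap g = δ'.lie (a.compLinearMap g) := by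
  ext v
  rw [AlternatingMap.compLinearMap_apply, lie_apply, lie_apply, hD]
  congr 1
  refine Finset.sum_congr rfl fun i _ ↦ ?_
  rw [AlternatingMap.compLinearMap_apply, hA]
  congr 1
  funext j
  exact (Function.apply_update (fun _ ↦ g) v i _ j).symm

theorem contract_compLinearMap (g : N' →ₗ[R] N) (X : N') {k : ℕ} (a : N [⋀^Fin (k + 1)]→ₗ[R] R) :
    contract X (a.compLinearMap g) = (contract (g X) a).compLinearMap g := by
  ext v
  rw [contract_apply, AlternatingMap.compLinearMap_apply, AlternatingMap.compLinearMap_apply,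
    contract_apply]
  congr 1
  funext j
  refine Fin.cases rfl (fun j ↦ rfl) j

end Transpose

variable {n : ℕ} {M : Type*} [TopologicalSpace M] [ChartedSpace (EuclideanSpace ℝ (Fin n)) M]
  [IsManifold (𝓡 n) ∞ M]

section Shortcuts

/-! Shortcuts for instance resolution. -/

variable (n M)

scoped instance : AddCommGroup (VF n M) := inferInstance
scoped instance : AddCommMonoid (VF n M) := inferInstance
scoped instance : AddCommGroup (OneForm n M) := inferInstance
scoped instance : AddCommMonoid (OneForm n M) := inferInstance
scoped instance : Module (Fn n M) (OneForm n M) := inferInstance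
scoped instance : Module ℝ (OneForm n M) := inferInstance
scoped instance : CommRing (Fn n M) := inferInstance
scoped instance : CommSemiring (Fn n M) := inferInstance
scoped instance : Semiring (Fn n M) := inferInstance
scoped instance : Module (Fn n M) (Fn n M) := inferInstance

variable (k : ℕ)

scoped instance : AddCommGroup (Form n M k) := inferInstance
scoped instance : AddCommMonoid (Form n M k) := inferInstance
scoped instance : Module (Fn n M) (Form n M k) := inferInstance
scoped instance : Module ℝ (Form n M k) := inferInstance
scoped instance : AddCommGroup (MultiVF n M k) := inferInstance
scoped instance : AddCommMonoid (MultiVF n M k) := inferInstance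
scoped instance : Module (Fn n M) (MultiVF n M k) := inferInstance
scoped instance : Module ℝ (MultiVF n M k) := inferInstance

end Shortcuts

/-! ### The tangent algebroid -/

section Tangent

/-- The tangent bundle as a Lie algebroid. -/
def tangent (n : ℕ) (M : Type*) [TopologicalSpace M] [ChartedSpace (EuclideanSpace ℝ (Fin n)) M]
    [IsManifold (𝓡 n) ∞ M] : SkewAlgebroid (Fn n M) (VF n M) where
  anchor :=
    { toFun := deriv
      map_add' := fun X Y ↦ LinearMap.ext fun f ↦ deriv_add_left X Y f
      map_smul' := fun g X ↦ LinearMap.ext fun f ↦ deriv_smul_left g X f }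
  bracket :=
    { toFun := lieBracketL
      map_add' := fun X Y ↦ LinearMap.ext fun Z ↦ by
        rw [LinearMap.add_apply, lieBracketL_apply, lieBracketL_apply, lieBracketL_apply,
          bracket_swap, bracket_add_right, neg_add, ← bracket_swap, ← bracket_swap]
      map_smul' := fun c X ↦ LinearMap.ext fun Z ↦ by
        rw [RingHom.id_apply, LinearMap.smul_apply, lieBracketL_apply, lieBracketL_apply,
          bracket_swap, ← lieBracketL_apply, map_smul, lieBracketL_apply, ← smul_neg,
          ← bracket_swap] }
  anchor_mul := deriv_mul
  skew := bracket_swap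
  leibniz X f Y := (bracket_smul_right f X Y).trans (add_comm _ _)

theorem tangent_isLie : (tangent n M).IsLie where
  anchor_bracket X Y f := (deriv_bracket X Y f).symm
  jacobi := bracket_jacobi

theorem extDeriv_eq {k : ℕ} (α : Form n M k) : extDeriv k α = (tangent n M).d α := by
  ext v : 1
  change koszul α v = (tangent n M).koszulReal α v
  cases k <;> rfl

theorem tangent_grad (f : Fn n M) : (tangent n M).grad f = dFn f := rfl

theorem dFn_add (f g : Fn n M) : dFn (f + g) = dFn f + dFn g :=
  LinearMap.ext fun X ↦ map_add (deriv X) f g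

theorem dFn_neg (f : Fn n M) : dFn (-f) = -dFn f :=
  LinearMap.ext fun X ↦ map_neg (deriv X) f

theorem dFn_smul (c : ℝ) (f : Fn n M) : dFn (c • f) = c • dFn f :=
  LinearMap.ext fun X ↦ map_smul (deriv X) c f

theorem dFn_mul (f g : Fn n M) : dFn (f * g) = f • dFn g + g • dFn f := by
  ext1 X
  change deriv X (f * g) = f * deriv X g + g * deriv X f
  rw [deriv_mul, mul_comm g]

theorem dual_dFn (X : VF n M) (f : Fn n M) :
    ((tangent n M).ad X).dual (dFn f) = dFn (deriv X f) := by
  ext1 Y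
  change deriv X (deriv Y f) - deriv (bracket X Y) f = deriv Y (deriv X f)
  rw [deriv_bracket]
  abel

theorem dual_ad_smul (g : Fn n M) (X : VF n M) (α : OneForm n M) :
    ((tangent n M).ad (g • X)).dual α = g • ((tangent n M).ad X).dual α + α X • dFn g := by
  ext1 Y
  change deriv (g • X) (α Y) - α (bracket (g • X) Y) =
    g * (deriv X (α Y) - α (bracket X Y)) + α X * deriv Y g
  rw [bracket_swap, bracket_smul_right, bracket_swap Y X, deriv_smul_left, map_neg, map_add,
    map_smul, map_smul, map_neg, smul_eq_mul, smul_eq_mul]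
  ring

theorem dual_ad_add (X Y : VF n M) (α : OneForm n M) :
    ((tangent n M).ad (X + Y)).dual α =
      ((tangent n M).ad X).dual α + ((tangent n M).ad Y).dual α := by
  ext1 Z
  change deriv (X + Y) (α Z) - α (bracket (X + Y) Z) =
    (deriv X (α Z) - α (bracket X Z)) + (deriv Y (α Z) - α (bracket Y Z))
  rw [bracket_swap, bracket_add_right, bracket_swap Z X, bracket_swap Z Y, deriv_add_left, map_neg,
    map_add, map_neg, map_neg]
  ring

end Tangent

/-! ### The cotangent algebroid of a bivector field -/

section Cotangent

theorem apply_sharpOne (h : Function.Bijective (Module.Dual.eval (Fn n M) (VF n M)))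
    (P : MultiVF n M 2) (α β : OneForm n M) : β (sharpOne P α) = P ![α, β] := by
  have := apply_inverseMap h (LinearMap.mk₂ (Fn n M) (fun X Y ↦ P ![X, Y])
    (fun X X' Y ↦ by exact congrArg (fun β ↦ β ![Y]) ((P.curryLeft).map_add X X'))
    (fun f X Y ↦ by exact congrArg (fun β ↦ β ![Y]) ((P.curryLeft).map_smul f X))
    (fun X Y Y' ↦ by exact congrArg (fun β ↦ β ![]) (((P.curryLeft X).curryLeft).map_add Y Y'))
    (fun f X Y ↦ by exact congrArg (fun β ↦ β ![]) (((P.curryLeft X).curryLeft).map_smul f Y)) α)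
  exact congrArg (fun ξ ↦ ξ β) this

theorem multiVF_swap (P : MultiVF n M 2) (α β : OneForm n M) : P ![α, β] = -P ![β, α] := by
  have h := congrArg (fun c ↦ c ![]) (contract_contract β α P)
  exact h

/-- The Koszul bracket of `1`-forms defined by a bivector field. -/
def koszulBracket (P : MultiVF n M 2) (α β : OneForm n M) : OneForm n M :=
  ((tangent n M).ad (sharpOne P α)).dual β - ((tangent n M).ad (sharpOne P β)).dual α -
    dFn (P ![α, β])

theorem koszulBracket_swap (P : MultiVF n M 2) (α β : OneForm n M) :
    koszulBracket P α β = -koszulBracket P β α := by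
  have h : dFn (P ![α, β]) = -dFn (P ![β, α]) := by
    rw [multiVF_swap, dFn_neg]
  rw [koszulBracket, koszulBracket, h]
  abel

theorem multiVF_two_add_right (P : MultiVF n M 2) (α β β' : OneForm n M) :
    P ![α, β + β'] = P ![α, β] + P ![α, β'] := by
  simpa only [contractTwo_apply] using (contractTwo P α).map_add β β'

theorem multiVF_two_smul_right (P : MultiVF n M 2) (f : Fn n M) (α β : OneForm n M) :
    P ![α, f • β] = f * P ![α, β] := by
  simpa only [contractTwo_apply, smul_eq_mul] using (contractTwo P α).map_smul f β

theorem koszulBracket_add_right (P : MultiVF n M 2) (α β β' : OneForm n M) :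
    koszulBracket P α (β + β') = koszulBracket P α β + koszulBracket P α β' := by
  simp only [koszulBracket, map_add, dual_ad_add, multiVF_two_add_right, dFn_add]
  abel

/-- Two terms in df arise, one from the Lie derivative along #(fβ) and one from d(f P(α, β)). They
cancel because α(#β) = -P(α, β). -/
theorem koszulBracket_smul_right (h : Function.Bijective (Module.Dual.eval (Fn n M) (VF n M)))
    (P : MultiVF n M 2) (α : OneForm n M) (f : Fn n M) (β : OneForm n M) :
    koszulBracket P α (f • β) = f • koszulBracket P α β + deriv (sharpOne P α) f • β := by
  have h1 : α (sharpOne P β) = -P ![α, β] := by rw [apply_sharpOne h, multiVF_swap]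
  simp only [koszulBracket, map_smul, dual_ad_smul, multiVF_two_smul_right, dFn_mul,
    ModuleDerivation.dual_smul, h1]
  change f • _ + deriv (sharpOne P α) f • β - _ - _ = _
  module

theorem algebraMap_deriv (X : VF n M) (c : ℝ) : deriv X (algebraMap ℝ (Fn n M) c) = 0 := by
  have h1 : deriv X (1 : Fn n M) = 0 := by
    have := deriv_mul X (1 : Fn n M) 1
    simpa using this
  rw [Algebra.algebraMap_eq_smul_one, map_smul, h1, smul_zero]

/-- The cotangent algebroid of a bivector field. -/
def cotangent (h : Function.Bijective (Module.Dual.eval (Fn n M) (VF n M))) (P : MultiVF n M 2) :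
    SkewAlgebroid (Fn n M) (OneForm n M) where
  anchor := (tangent n M).anchor ∘ₗ sharpOne P
  bracket := by
    have hs : ∀ (c : ℝ) α β, koszulBracket P α (c • β) = c • koszulBracket P α β := fun c α β ↦ by
      rw [← algebraMap_smul (Fn n M) c β, koszulBracket_smul_right h, algebraMap_deriv, zero_smul,
        add_zero, algebraMap_smul]
    exact LinearMap.mk₂ ℝ (koszulBracket P)
      (fun α α' β ↦ by
        rw [koszulBracket_swap, koszulBracket_add_right, neg_add, ← koszulBracket_swap,
          ← koszulBracket_swap])
      (fun c α β ↦ by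
        rw [koszulBracket_swap, hs]
        exact ((congrArg (c • ·) (koszulBracket_swap P α β)).trans (smul_neg c _)).symm)
      (koszulBracket_add_right P) hs
  anchor_mul α f g := deriv_mul (sharpOne P α) f g
  skew := koszulBracket_swap P
  leibniz := koszulBracket_smul_right h P

/-- Of the three equal terms ±d(P(df, dg)) one survives. This matches the bracket terms of the
Koszul formula with the insertion of P into a multivector on exact forms. -/
theorem koszulBracket_dFn (h : Function.Bijective (Module.Dual.eval (Fn n M) (VF n M)))
    (P : MultiVF n M 2) (f g : Fn n M) :
    koszulBracket P (dFn f) (dFn g) = dFn (P ![dFn f, dFn g]) := by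
  have h1 : ∀ f g : Fn n M, deriv (sharpOne P (dFn f)) g = P ![dFn f, dFn g] := fun f g ↦
    apply_sharpOne h P (dFn f) (dFn g)
  have h2 : dFn (P ![dFn g, dFn f]) = -dFn (P ![dFn f, dFn g]) := by
    rw [multiVF_swap, dFn_neg]
  rw [koszulBracket, dual_dFn, dual_dFn, h1, h1, h2]
  abel

end Cotangent

end LJ

namespace LJ

variable {n : ℕ} {M : Type*} [TopologicalSpace M] [ChartedSpace (EuclideanSpace ℝ (Fin n)) M]
  [IsManifold (𝓡 n) ∞ M]

/-! ### The Schouten bracket with vector fields and bivectors -/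

section Existence

theorem insertion_add_left {p q m : ℕ} (h : m + 1 = p + q) (P P' : MultiVF n M p)
    (Q : MultiVF n M q) (f : Fin m → Fn n M) :
    insertion h (P + P') Q f = insertion h P Q f + insertion h P' Q f := by
  cases p with
  | zero => exact (add_zero 0).symm
  | succ p =>
    simp only [insertion, AlternatingMap.add_apply, smul_add, Finset.sum_add_distrib]

theorem insertion_smul_left {p q m : ℕ} (h : m + 1 = p + q) (c : ℝ) (P : MultiVF n M p)
    (Q : MultiVF n M q) (f : Fin m → Fn n M) :
    insertion h (c • P) Q f = c • insertion h P Q f := by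
  cases p with
  | zero => exact (smul_zero c).symm
  | succ p =>
    simp only [insertion, AlternatingMap.smul_apply, Finset.smul_sum, smul_comm c]

theorem insertion_add_right {p q m : ℕ} (h : m + 1 = p + q) (P : MultiVF n M p)
    (Q Q' : MultiVF n M q) (f : Fin m → Fn n M) :
    insertion h P (Q + Q') f = insertion h P Q f + insertion h P Q' f := by
  cases p with
  | zero => exact (add_zero 0).symm
  | succ p =>
    simp only [insertion, AlternatingMap.add_apply, ← contract_apply, dFn_add, contract_add,
      smul_add, Finset.sum_add_distrib]

theorem insertion_smul_right {p q m : ℕ} (h : m + 1 = p + q) (c : ℝ) (P : MultiVF n M p)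
    (Q : MultiVF n M q) (f : Fin m → Fn n M) :
    insertion h P (c • Q) f = c • insertion h P Q f := by
  cases p with
  | zero => exact (smul_zero c).symm
  | succ p =>
    have key : ∀ (α : OneForm n M), contract (c • α) P = c • contract α P := fun α ↦ by
      rw [← algebraMap_smul (Fn n M) c α, contract_smul, algebraMap_smul]
    simp only [insertion, AlternatingMap.smul_apply, ← contract_apply, dFn_smul, key,
      Finset.smul_sum, smul_comm c]

/-- The right-hand side of the formula for the Schouten-Nijenhuis bracket on exact `1`-forms. -/
def gradedCommutator {p q m : ℕ} (h : m + 1 = p + q) (P : MultiVF n M p) (Q : MultiVF n M q)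
    (f : Fin m → Fn n M) : Fn n M :=
  (-1 : ℤ) ^ ((p + 1) * q) • insertion h P Q f +
    (-1 : ℤ) ^ p • insertion (h.trans (add_comm p q)) Q P f

variable [T2Space M]

/-- The bracket is a choice that defaults to 0, so existence must be shown in each bidegree used. A
map B with the right values on exact forms is automatically bilinear, since exact forms separate
multivectors; the same fact identifies it with the chosen bracket. -/
theorem schouten_eq {p q m : ℕ} (h : m + 1 = p + q)
    (B : MultiVF n M p → MultiVF n M q → MultiVF n M m)
    (hB : ∀ P Q f, B P Q (fun i ↦ dFn (f i)) = gradedCommutator h P Q f) (P : MultiVF n M p)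
    (Q : MultiVF n M q) : schoutenBilin h P Q = B P Q := by
  have hex : ∃ B : MultiVF n M p →ₗ[ℝ] MultiVF n M q →ₗ[ℝ] MultiVF n M m, IsSchouten h B := by
    refine ⟨LinearMap.mk₂ ℝ B (fun P P' Q ↦ multiVF_ext fun f ↦ ?_)
      (fun c P Q ↦ multiVF_ext fun f ↦ ?_) (fun P Q Q' ↦ multiVF_ext fun f ↦ ?_)
      (fun c P Q ↦ multiVF_ext fun f ↦ ?_), hB⟩
    · simp only [AlternatingMap.add_apply, hB, gradedCommutator, insertion_add_left,
        insertion_add_right, smul_add]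
      abel
    · simp only [AlternatingMap.smul_apply, hB, gradedCommutator, insertion_smul_left,
        insertion_smul_right, smul_add, smul_comm c]
    · simp only [AlternatingMap.add_apply, hB, gradedCommutator, insertion_add_left,
        insertion_add_right, smul_add]
      abel
    · simp only [AlternatingMap.smul_apply, hB, gradedCommutator, insertion_smul_left,
        insertion_smul_right, smul_add, smul_comm c]
  rw [schoutenBilin, dif_pos hex]
  refine multiVF_ext fun f ↦ ?_
  rw [hB]
  exact hex.choose_spec P Q f

end Existence

section Permutations

theorem sum_perm_alternating {R N : Type*} [CommRing R] [AddCommGroup N] [Module R N]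
    {k : ℕ} (a : N [⋀^Fin k]→ₗ[R] R) (v : Fin k → N) :
    ∑ τ : Equiv.Perm (Fin k), (Equiv.Perm.sign τ : ℤ) • a (fun i ↦ v (τ i)) =
      k.factorial • a v := by
  have h : ∀ τ ∈ (Finset.univ : Finset (Equiv.Perm (Fin k))),
      (Equiv.Perm.sign τ : ℤ) • a (fun i ↦ v (τ i)) = a v := fun τ _ ↦ by
    have h1 := a.map_perm v τ
    change a (fun i ↦ v (τ i)) = _ at h1
    rw [h1, Units.smul_def, smul_smul]
    simp
  rw [Finset.sum_congr rfl h, Finset.sum_const, Finset.card_univ, Fintype.card_perm,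
    Fintype.card_fin]

theorem inv_factorial_smul {V : Type*} [AddCommGroup V] [Module ℝ V] (k : ℕ) (x : V) :
    (k.factorial : ℝ)⁻¹ • k.factorial • x = x := by
  rw [← Nat.cast_smul_eq_nsmul ℝ, inv_smul_smul₀ (by positivity)]

/-- The insertion of a multivector into a vector field. -/
theorem insertion_vec {q : ℕ} (P : MultiVF n M 1) (Q : MultiVF n M q) (h : q + 1 = 1 + q)
    (f : Fin q → Fn n M) :
    insertion h P Q f = P ![dFn (Q fun i ↦ dFn (f i))] := by
  have key : ∀ τ : Equiv.Perm (Fin q),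
      P (Matrix.vecCons (dFn (Q fun i : Fin q ↦
        dFn (f (τ (Fin.cast (by omega) (Fin.castAdd 0 i))))))
        (fun j : Fin 0 ↦ dFn (f (τ (Fin.cast (by omega) (Fin.natAdd q j)))))) =
      (Equiv.Perm.sign τ : ℤ) • P ![dFn (Q fun i ↦ dFn (f i))] := fun τ ↦ by
    have h1 := Q.map_perm (fun i ↦ dFn (f i)) τ
    change Q (fun i ↦ dFn (f (τ i))) = _ at h1
    have h2 : dFn (Q fun i ↦ dFn (f (τ i))) =
        (Equiv.Perm.sign τ : ℤ) • dFn (Q fun i ↦ dFn (f i)) := by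
      rw [h1]
      rcases Int.units_eq_one_or (Equiv.Perm.sign τ) with h | h <;> simp [h, dFn_neg]
    rw [← contract_apply]
    change contract (dFn (Q fun i ↦ dFn (f (τ i)))) P _ = _
    rw [h2]
    refine (congrArg _ (Subsingleton.elim _ ![])).trans ?_
    rcases Int.units_eq_one_or (Equiv.Perm.sign τ) with h | h <;> simp [h, contract_neg] <;> rfl
  change ((q.factorial * Nat.factorial 0 : ℝ)⁻¹) • ∑ τ : Equiv.Perm (Fin q), _ • P _ = _
  rw [Finset.sum_congr rfl fun τ _ ↦ by rw [key τ, smul_smul]]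
  simp
  rw [Fintype.card_perm, Fintype.card_fin, ← nsmul_eq_mul, inv_factorial_smul]

/-- The insertion of a vector field into a multivector. -/
theorem insertion_of_vec {k : ℕ} (P : MultiVF n M 1) (Q : MultiVF n M (k + 1))
    (h : k + 1 + 1 = k + 1 + 1) (f : Fin (k + 1) → Fn n M) :
    insertion h Q P f = ∑ j : Fin (k + 1), (-1 : ℤ) ^ (j : ℕ) •
      Q (Matrix.vecCons (dFn (P ![dFn (f j)])) fun i ↦ dFn (j.removeNth f i)) := by
  have h1 := sum_perm_removeNth (fun w : Fin (k + 1) → Fn n M ↦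
    Q (Matrix.vecCons (dFn (P ![dFn (w 0)])) fun i ↦ dFn (w i.succ))) f
  have h2 : insertion h Q P f = ((Nat.factorial 1 * k.factorial : ℝ)⁻¹) •
      ∑ τ : Equiv.Perm (Fin (k + 1)), (Equiv.Perm.sign τ : ℤ) •
        Q (Matrix.vecCons (dFn (P ![dFn (f (τ 0))])) fun i ↦ dFn (f (τ i.succ))) := by
    have key : ∀ τ : Equiv.Perm (Fin (k + 1)),
        Q (Matrix.vecCons (dFn (P fun i : Fin 1 ↦
          dFn (f (τ (Fin.cast (Nat.add_comm 1 k) (Fin.castAdd k i))))))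
          (fun j : Fin k ↦ dFn (f (τ (Fin.cast (Nat.add_comm 1 k) (Fin.natAdd 1 j)))))) =
        Q (Matrix.vecCons (dFn (P ![dFn (f (τ 0))])) fun i ↦ dFn (f (τ i.succ))) := fun τ ↦ by
      congr 2
      · congr 2
        funext i
        fin_cases i
        rfl
      · funext i
        congr 3
        ext
        simp [add_comm]
    simp only [← key]
    rfl
  rw [h2, h1]
  simp only [Matrix.cons_val_zero, Matrix.cons_val_succ]
  have h3 : ∀ j : Fin (k + 1), ∑ τ : Equiv.Perm (Fin k), (Equiv.Perm.sign τ : ℤ) •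
      Q (Matrix.vecCons (dFn (P ![dFn (f j)])) fun i ↦ dFn (j.removeNth f (τ i))) =
      k.factorial • Q (Matrix.vecCons (dFn (P ![dFn (f j)])) fun i ↦ dFn (j.removeNth f i)) :=
    fun j ↦ sum_perm_alternating (contract (dFn (P ![dFn (f j)])) Q)
      (fun i ↦ dFn (j.removeNth f i))
  simp only [h3, smul_comm _ k.factorial, ← Finset.smul_sum]
  rw [Nat.factorial_one, Nat.cast_one, one_mul, smul_comm, inv_factorial_smul]

end Permutations

end LJ

namespace LJ

variable {n : ℕ} {M : Type*} [TopologicalSpace M] [ChartedSpace (EuclideanSpace ℝ (Fin n)) M]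
  [IsManifold (𝓡 n) ∞ M]

section Bivector

/-- The insertion of a multivector into a bivector. -/
theorem insertion_bivector {k : ℕ} (P : MultiVF n M 2) (Q : MultiVF n M k) (h : k + 1 + 1 = 2 + k)
    (f : Fin (k + 1) → Fn n M) :
    insertion h P Q f = (-1 : ℤ) ^ k • ∑ j : Fin (k + 1), (-1 : ℤ) ^ (j : ℕ) •
      P ![dFn (Q fun i ↦ dFn (j.removeNth f i)), dFn (f j)] := by
  -- The insertion singles out the last function; a rotation, of sign (-1)^k, brings it to the front
  -- so that `sum_perm_removeNth` applies.
  have h1 := (sum_perm_rotate (fun w : Fin (k + 1) → Fn n M ↦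
    P ![dFn (Q fun i ↦ dFn (w i.castSucc)), dFn (w (Fin.last k))]) f)
  have h1' := sum_perm_removeNth (fun w : Fin (k + 1) → Fn n M ↦
    P ![dFn (Q fun i ↦ dFn (w i.succ)), dFn (w 0)]) f
  have h2 : insertion h P Q f = ((k.factorial * Nat.factorial 1 : ℝ)⁻¹) •
      ∑ τ : Equiv.Perm (Fin (k + 1)), (Equiv.Perm.sign τ : ℤ) •
        P ![dFn (Q fun i ↦ dFn (f (τ i.castSucc))), dFn (f (τ (Fin.last k)))] := by
    have key : ∀ τ : Equiv.Perm (Fin (k + 1)),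
        P (Matrix.vecCons (dFn (Q fun i : Fin k ↦
          dFn (f (τ (Fin.cast (rfl : k + 1 = k + 1) (Fin.castAdd 1 i))))))
          (fun j : Fin 1 ↦ dFn (f (τ (Fin.cast (rfl : k + 1 = k + 1) (Fin.natAdd k j)))))) =
        P ![dFn (Q fun i ↦ dFn (f (τ i.castSucc))), dFn (f (τ (Fin.last k)))] := fun τ ↦ by
      congr 2
      funext i
      fin_cases i
      rfl
    simp only [← key]
    rfl
  have h3 : ∀ σ : Equiv.Perm (Fin (k + 1)),
      P ![dFn (Q fun i ↦ dFn (f (σ (finRotate (k + 1) i.castSucc)))),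
        dFn (f (σ (finRotate (k + 1) (Fin.last k))))] =
      P ![dFn (Q fun i ↦ dFn (f (σ i.succ))), dFn (f (σ 0))] := fun σ ↦ by
    rw [finRotate_last]
    simp only [show ∀ i : Fin k, finRotate (k + 1) i.castSucc = i.succ from fun i ↦ finRotate_of_lt i.2]
  rw [h2, h1]
  simp only [h3]
  rw [h1']
  simp only [Matrix.cons_val_zero, Matrix.cons_val_succ]
  have h4 : ∀ j : Fin (k + 1), ∑ τ : Equiv.Perm (Fin k), (Equiv.Perm.sign τ : ℤ) •
      P ![dFn (Q fun i ↦ dFn (j.removeNth f (τ i))), dFn (f j)] =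
      k.factorial • P ![dFn (Q fun i ↦ dFn (j.removeNth f i)), dFn (f j)] := fun j ↦ by
    have h5 : ∀ τ ∈ (Finset.univ : Finset (Equiv.Perm (Fin k))), (Equiv.Perm.sign τ : ℤ) •
        P ![dFn (Q fun i ↦ dFn (j.removeNth f (τ i))), dFn (f j)] =
        P ![dFn (Q fun i ↦ dFn (j.removeNth f i)), dFn (f j)] := fun τ _ ↦ by
      have h6 := Q.map_perm (fun i ↦ dFn (j.removeNth f i)) τ
      change Q (fun i ↦ dFn (j.removeNth f (τ i))) = _ at h6
      rw [h6]
      rcases Int.units_eq_one_or (Equiv.Perm.sign τ) with h | h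
      · rw [h, Units.val_one, one_smul, one_smul]
      · rw [h, Units.neg_smul, one_smul, dFn_neg, ← contract_apply, contract_neg,
          AlternatingMap.neg_apply, contract_apply, Units.val_neg, Units.val_one, neg_one_smul, neg_neg]
    rw [Finset.sum_congr rfl h5, Finset.sum_const, Finset.card_univ, Fintype.card_perm,
      Fintype.card_fin]
  simp only [h4, smul_comm _ k.factorial, ← Finset.smul_sum]
  rw [Nat.factorial_one, Nat.cast_one, mul_one, smul_comm k.factorial, inv_factorial_smul]

/-- The insertion of a bivector into a multivector. -/
theorem insertion_of_bivector {k : ℕ} (P : MultiVF n M 2) (Q : MultiVF n M (k + 1))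
    (h : k + 2 + 1 = k + 1 + 2) (f : Fin (k + 2) → Fn n M) :
    insertion h Q P f = (1 / 2 : ℝ) • ∑ i : Fin (k + 2), (-1 : ℤ) ^ (i : ℕ) •
      ∑ j : Fin (k + 1), (-1 : ℤ) ^ (j : ℕ) •
        Q (Matrix.vecCons (dFn (P ![dFn (f i), dFn (i.removeNth f j)]))
          fun l ↦ dFn (j.removeNth (i.removeNth f) l)) := by
  -- Splitting off two entries in turn gives a sum over ordered pairs. The 2! of the shuffle
  -- normalization thus becomes the factor 1/2 of the Koszul formula.
  have h1 := sum_perm_removeNth (fun w : Fin (k + 2) → Fn n M ↦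
    Q (Matrix.vecCons (dFn (P ![dFn (w 0), dFn (w 1)])) fun l ↦ dFn (w l.succ.succ))) f
  have h1' : ∀ g : Fn n M, ∀ f' : Fin (k + 1) → Fn n M, _ := fun g ↦
    sum_perm_removeNth (fun w : Fin (k + 1) → Fn n M ↦
      Q (Matrix.vecCons (dFn (P ![dFn g, dFn (w 0)])) fun l ↦ dFn (w l.succ)))
  have h2 : insertion h Q P f = ((Nat.factorial 2 * k.factorial : ℝ)⁻¹) •
      ∑ τ : Equiv.Perm (Fin (k + 2)), (Equiv.Perm.sign τ : ℤ) •
        Q (Matrix.vecCons (dFn (P ![dFn (f (τ 0)), dFn (f (τ 1))]))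
          fun l ↦ dFn (f (τ l.succ.succ))) := by
    have key : ∀ τ : Equiv.Perm (Fin (k + 2)),
        Q (Matrix.vecCons (dFn (P fun i : Fin 2 ↦
          dFn (f (τ (Fin.cast (Nat.add_comm 2 k) (Fin.castAdd k i))))))
          (fun j : Fin k ↦ dFn (f (τ (Fin.cast (Nat.add_comm 2 k) (Fin.natAdd 2 j)))))) =
        Q (Matrix.vecCons (dFn (P ![dFn (f (τ 0)), dFn (f (τ 1))]))
          fun l ↦ dFn (f (τ l.succ.succ))) := fun τ ↦ by
      congr 2
      · congr 2
        funext i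
        fin_cases i <;> rfl
      · funext i
        congr 3
        ext
        change 2 + (i : ℕ) = i + 1 + 1
        omega
    simp only [← key]
    rfl
  rw [h2, h1]
  have h3 : (1 : Fin (k + 2)) = Fin.succ 0 := rfl
  simp only [h3, Matrix.cons_val_zero, Matrix.cons_val_succ, h1']
  have h4 : ∀ (i : Fin (k + 2)) (j : Fin (k + 1)),
      ∑ τ : Equiv.Perm (Fin k), (Equiv.Perm.sign τ : ℤ) •
      Q (Matrix.vecCons (dFn (P ![dFn (f i), dFn (i.removeNth f j)]))
        fun l ↦ dFn (j.removeNth (i.removeNth f) (τ l))) =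
      k.factorial • Q (Matrix.vecCons (dFn (P ![dFn (f i), dFn (i.removeNth f j)]))
          fun l ↦ dFn (j.removeNth (i.removeNth f) l)) :=
    fun i j ↦ sum_perm_alternating (contract (dFn (P ![dFn (f i), dFn (i.removeNth f j)])) Q)
      (fun l ↦ dFn (j.removeNth (i.removeNth f) l))
  simp only [h4, smul_comm _ k.factorial, ← Finset.smul_sum]
  rw [Nat.factorial_two, mul_inv, mul_smul, smul_comm k.factorial, smul_comm k.factorial,
    inv_factorial_smul, one_div, Nat.cast_ofNat]

end Bivector

section Formulas

variable [T2Space M]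

/-- The Schouten-Nijenhuis bracket with a vector field is the Lie derivative. -/
theorem schouten_vec (hev : Function.Bijective (Module.Dual.eval (Fn n M) (VF n M)))
    {q : ℕ} (X : VF n M) (Q : MultiVF n M q) (h : q + 1 = 1 + q) :
    schoutenBilin h (vec X) Q = ((tangent n M).ad X).transpose.lie Q := by
  -- The comparison map must be defined on all 1-vectors, so each is represented by a vector field
  -- through reflexivity.
  set toVF : MultiVF n M 1 → VF n M := fun P ↦
    inverseMap (Module.Dual.eval (Fn n M) (VF n M)) (degOneEquiv.symm P) with htoVF
  have h0 : toVF (vec X) = X := by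
    change inverseMap _ (degOneEquiv.symm (degOneEquiv (Module.Dual.eval (Fn n M) (VF n M) X))) = X
    rw [LinearEquiv.symm_apply_apply, inverseMap_apply hev]
  have h1 : ∀ (P : MultiVF n M 1) (α : OneForm n M), α (toVF P) = P ![α] := fun P α ↦ by
    rw [← degOneEquiv_symm_apply]
    exact congrArg (fun ξ ↦ ξ α) (apply_inverseMap hev (degOneEquiv.symm P))
  have h2 : ∀ (P : MultiVF n M 1) (f : Fn n M), deriv (toVF P) f = P ![dFn f] := fun P f ↦ h1 P (dFn f)
  rw [schouten_eq h (fun P Q ↦ ((tangent n M).ad (toVF P)).transpose.lie Q), h0]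
  intro P Q f
  have h3 : ((tangent n M).ad (toVF P)).transpose.lie Q (fun i ↦ dFn (f i)) =
      P ![dFn (Q fun i ↦ dFn (f i))] -
        ∑ i, Q (Function.update (fun i ↦ dFn (f i)) i (dFn (P ![dFn (f i)]))) := by
    rw [ModuleDerivation.lie_apply, ← h2]
    refine congrArg (_ - ·) (Finset.sum_congr rfl fun i _ ↦ ?_)
    rw [← h2, ← dual_dFn]
    rfl
  rw [h3, gradedCommutator, insertion_vec, Even.neg_one_pow (by simp), one_smul, sub_eq_add_neg]
  congr 1
  cases q with
  | zero => simp [insertion]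
  | succ k =>
    rw [insertion_of_vec, sum_update_eq]
    simp only [pow_one, neg_smul, one_smul]
    rfl

/-- The Schouten-Nijenhuis bracket with a bivector is minus the differential of the cotangent
algebroid. -/
theorem schouten_bivector (hev : Function.Bijective (Module.Dual.eval (Fn n M) (VF n M)))
    {k : ℕ} (P : MultiVF n M 2) (Q : MultiVF n M k) (h : k + 1 + 1 = 2 + k) :
    schoutenBilin h P Q = -(cotangent hev P).d Q := by
  rw [schouten_eq h (fun P Q ↦ -(cotangent hev P).d Q)]
  intro P Q f
  have h1 : ∀ α f, (cotangent hev P).anchor α f = P ![α, dFn f] := fun α f ↦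
    apply_sharpOne hev P α (dFn f)
  have h2 : AlternatingMap.alternatizeUncurryFin ((cotangent hev P).anchorComp Q)
      (fun i ↦ dFn (f i)) = -∑ j : Fin (k + 1), (-1 : ℤ) ^ (j : ℕ) •
      P ![dFn (Q fun i ↦ dFn (j.removeNth f i)), dFn (f j)] := by
    rw [AlternatingMap.alternatizeUncurryFin_apply, ← Finset.sum_neg_distrib]
    refine Finset.sum_congr rfl fun j _ ↦ ?_
    rw [SkewAlgebroid.anchorComp_apply, h1, multiVF_swap, smul_neg]
    rfl
  have h3 : (-1 : ℤ) ^ ((2 + 1) * k) * (-1) ^ k = 1 := by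
    rw [← pow_add]
    exact Even.neg_one_pow ⟨2 * k, by ring⟩
  rw [gradedCommutator, insertion_bivector, smul_smul, h3, one_smul, even_two.neg_one_pow, one_smul]
  change -(cotangent hev P).koszulReal Q _ = _
  cases k with
  | zero =>
    -- `insertion` into a function is 0 by convention, so only one half of the commutator
    -- contributes.
    change -(AlternatingMap.alternatizeUncurryFin ((cotangent hev P).anchorComp Q)
      (fun i ↦ dFn (f i))) = _ + 0
    rw [h2, neg_neg, add_zero]
  | succ k =>
    rw [insertion_of_bivector]
    change -(AlternatingMap.alternatizeUncurryFin ((cotangent hev P).anchorComp Q)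
      (fun i ↦ dFn (f i)) - (1 / 2 : ℝ) • _) = _
    rw [h2, neg_sub, sub_neg_eq_add, add_comm]
    congr 2
    refine (AlternatingMap.alternatizeUncurryFin_apply _ _).trans ?_
    refine Finset.sum_congr rfl fun i _ ↦ congrArg _ ?_
    rw [LinearMap.comp_apply, AlternatingMap.alternatizeUncurryFinLM_apply,
      AlternatingMap.alternatizeUncurryFin_apply]
    refine Finset.sum_congr rfl fun j _ ↦ congrArg _ ?_
    rw [SkewAlgebroid.bracketContract_apply]
    have h4 : (cotangent hev P).bracket (dFn (f i)) (i.removeNth (fun i ↦ dFn (f i)) j) =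
        dFn (P ![dFn (f i), dFn (i.removeNth f j)]) := koszulBracket_dFn hev P _ _
    rw [h4]
    rfl

end Formulas

end LJ

namespace LJ

/-! ### Transport of the cotangent calculus along ♭ -/

section TwistedLie

variable {R N : Type*} [CommRing R] [Algebra ℝ R] [AddCommGroup N] [Module R N] [Module ℝ N]

namespace ModuleDerivation

instance : Neg (ModuleDerivation R N) where
  neg δ :=
    { D := -δ.D
      A := -δ.A
      D_mul := fun f g ↦ by
        rw [LinearMap.neg_apply, LinearMap.neg_apply, LinearMap.neg_apply, δ.D_mul]
        ring
      A_smul := fun f X ↦ by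
        rw [LinearMap.neg_apply, LinearMap.neg_apply, LinearMap.neg_apply, δ.A_smul]
        module }

theorem lie_neg (δ : ModuleDerivation R N) {k : ℕ} (a : N [⋀^Fin k]→ₗ[R] R) :
    (-δ).lie a = -δ.lie a := by
  ext v
  rw [AlternatingMap.neg_apply, lie_apply, lie_apply, neg_sub', ← Finset.sum_neg_distrib]
  congr 1
  refine Finset.sum_congr rfl fun i _ ↦ ?_
  exact a.map_update_neg v i (δ.A (v i))

theorem lie_eq_of_deg_zero (δ δ' : ModuleDerivation R N) (hD : ∀ f, δ'.D f = δ.D f)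
    (a : N [⋀^Fin 0]→ₗ[R] R) : δ'.lie a = δ.lie a := by
  ext v
  rw [lie_zero_apply, lie_zero_apply, hD]

/-- The effect on the Lie derivative of changing a module derivation by a sum of a multiple of the
identity and two operators of rank one. -/
theorem lie_twist (δ δ' : ModuleDerivation R N) (c : R) (φ ψ : N →ₗ[R] R) (X E : N)
    (hD : ∀ f, δ'.D f = δ.D f) (hA : ∀ Y, δ'.A Y = δ.A Y + c • Y - φ Y • X + ψ Y • E) {k : ℕ}
    (a : N [⋀^Fin (k + 1)]→ₗ[R] R) :
    δ'.lie a = δ.lie a - (k + 1) • c • a + wedgeOne φ (contract X a) -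
      wedgeOne ψ (contract E a) := by
  induction k with
  | zero =>
    refine ext_contract fun Y ↦ ?_
    rw [contract_lie, hA, lie_eq_of_deg_zero δ δ' hD]
    simp only [map_sub, map_add, map_nsmul, map_smul, contract_lie, contract_wedgeOne_zero,
      contract_add, contract_sub, contract_smul]
    module
  | succ k ih =>
    refine ext_contract fun Y ↦ ?_
    rw [contract_lie, hA, ih]
    simp only [map_sub, map_add, map_nsmul, map_smul, contract_lie, contract_wedgeOne,
      contract_add, contract_sub, contract_smul]
    rw [contract_contract X Y, contract_contract E Y, map_neg, map_neg]
    module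

end ModuleDerivation

variable [IsScalarTower ℝ R N] (𝒜 : SkewAlgebroid R N)

/-- The algebra of the inductive step of `IsLCS.cotangent_d`: the left side contracts the claimed
formula, the right side is what Cartan's formula gives after transport. It holds for an arbitrary
2-form, linear form and pair of vectors. -/
theorem contract_twisted_d_zero (a : N [⋀^Fin 2]→ₗ[R] R) (φ : N →ₗ[R] R) (X E : N)
    (p : N [⋀^Fin 1]→ₗ[R] R) :
    contract X ((0 + 1) • wedgeOne φ p + wedgeTwo a (contract E p) - 𝒜.d p) =
      -((𝒜.ad X).lie p - (0 + 1) • φ X • p + wedgeOne φ (contract X p) -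
        wedgeOne (contractTwo a X) (contract E p)) - -𝒜.d (contract X p) := by
  simp only [map_sub, map_add, map_nsmul, SkewAlgebroid.contract_d, contract_wedgeOne,
    contract_wedgeTwo_zero]
  module

theorem contract_twisted_d (a : N [⋀^Fin 2]→ₗ[R] R) (φ : N →ₗ[R] R) (X E : N) {k : ℕ}
    (p : N [⋀^Fin (k + 2)]→ₗ[R] R) :
    contract X ((k + 1 + 1) • wedgeOne φ p + wedgeTwo a (contract E p) - 𝒜.d p) =
      -((𝒜.ad X).lie p - (k + 1 + 1) • φ X • p + wedgeOne φ (contract X p) -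
        wedgeOne (contractTwo a X) (contract E p)) -
      ((k + 1) • wedgeOne φ (contract X p) + wedgeTwo a (contract E (contract X p)) -
        𝒜.d (contract X p)) := by
  simp only [map_sub, map_add, map_nsmul, SkewAlgebroid.contract_d, contract_wedgeOne,
    contract_wedgeTwo]
  rw [contract_contract E X, map_neg]
  module

end TwistedLie

section Transport

variable {n : ℕ} {M : Type*} [TopologicalSpace M] [ChartedSpace (EuclideanSpace ℝ (Fin n)) M]
  [IsManifold (𝓡 n) ∞ M] {Ω : Form n M 2} {lee : OneForm n M}

theorem pullback_apply {R N N' : Type*} [CommRing R] [AddCommGroup N] [Module R N] [AddCommGroup N']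
    [Module R N'] (g : N' →ₗ[R] N) {k : ℕ} (a : N [⋀^Fin k]→ₗ[R] R) :
    pullback g k a = a.compLinearMap g := rfl

theorem contractTwo_eq_flatOne (X : VF n M) : contractTwo Ω X = flatOne Ω X := by
  ext1 Y
  rw [contractTwo_apply, flatOne_apply]

theorem flatOne_leeVF (hb : Function.Bijective (flatOne Ω)) : flatOne Ω (leeVF Ω lee) = lee :=
  apply_inverseMap hb lee

theorem lee_leeVF (hb : Function.Bijective (flatOne Ω)) : lee (leeVF Ω lee) = 0 := by
  have h := contract_self (leeVF Ω lee) Ω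
  have h' : flatOne Ω (leeVF Ω lee) (leeVF Ω lee) = 0 := congrArg (fun c ↦ c ![]) h
  rwa [flatOne_leeVF hb] at h'

theorem pullback_bivector (hb : Function.Bijective (flatOne Ω)) :
    pullback (flatOne Ω) 2 (bivector Ω) = Ω := by
  ext v : 1
  change Ω (fun i ↦ inverseMap (flatOne Ω) (flatOne Ω (v i))) = Ω v
  simp only [inverseMap_apply hb]

theorem bivector_flatOne (hb : Function.Bijective (flatOne Ω)) (X Y : VF n M) :
    bivector Ω ![flatOne Ω X, flatOne Ω Y] = Ω ![X, Y] := by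
  conv_rhs => rw [← pullback_bivector hb, pullback_apply, AlternatingMap.compLinearMap_apply]
  congr 1
  funext i
  fin_cases i <;> rfl

/-- Both conventions contract the first slot, so (♭Y)(#♭X) = Ω(X, Y) = -(♭Y)(X). Hence #_Λ = -♭⁻¹,
which explains the signs (-1)^k in `flat` and `sharp`. -/
theorem sharpOne_flatOne (hb : Function.Bijective (flatOne Ω)) (X : VF n M) :
    sharpOne (bivector Ω) (flatOne Ω X) = -X := by
  refine (dual_eval_bijective hb).1 ?_
  ext1 β
  obtain ⟨Y, rfl⟩ := hb.2 β
  change flatOne Ω Y (sharpOne (bivector Ω) (flatOne Ω X)) = flatOne Ω Y (-X)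
  rw [apply_sharpOne (dual_eval_bijective hb), bivector_flatOne hb, map_neg, ← flatOne_swap,
    flatOne_apply]

theorem pullback_vec (X : VF n M) : pullback (flatOne Ω) 1 (vec X) = -degOneEquiv (flatOne Ω X) := by
  ext v : 1
  exact flatOne_swap Ω (v 0) X

theorem IsLCS.d_lee (h : IsLCS Ω lee) : (tangent n M).d (degOneEquiv lee) = 0 := by
  rw [← LJ.extDeriv_eq]
  exact h.lee_closed

theorem IsLCS.d_eq (h : IsLCS Ω lee) : (tangent n M).d Ω = wedgeOne lee Ω := by
  rw [← LJ.extDeriv_eq]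
  exact h.extDeriv_eq

/-- The transport of the cotangent algebroid operator of `♭X` to vector fields, up to sign. -/
def twistedAd (Ω : Form n M 2) (lee : OneForm n M) (X : VF n M) :
    ModuleDerivation (Fn n M) (VF n M) where
  D := deriv X
  A := (tangent n M).bracket X + (lee X • LinearMap.id - lee.smulRight X +
    (flatOne Ω X).smulRight (leeVF Ω lee)).restrictScalars ℝ
  D_mul := deriv_mul X
  A_smul f Y := by
    simp only [LinearMap.add_apply, LinearMap.coe_restrictScalars, map_smul,
      (tangent n M).leibniz]
    change _ + deriv X f • Y + _ = _ + deriv X f • Y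
    module

theorem twistedAd_A (X Y : VF n M) : (twistedAd Ω lee X).A Y =
    ((tangent n M).ad X).A Y + lee X • Y - lee Y • X + flatOne Ω X Y • leeVF Ω lee := by
  change _ + (lee X • Y - lee Y • X + flatOne Ω X Y • leeVF Ω lee) = _
  change ((tangent n M).ad X).A Y + _ = _
  abel

theorem contractTwo_wedgeOne (φ ψ : OneForm n M) (Y : VF n M) :
    contractTwo (wedgeOne φ (degOneEquiv ψ)) Y = φ Y • ψ - ψ Y • φ := by
  apply degOneEquiv.injective
  rw [degOneEquiv_contractTwo, contract_wedgeOne, wedgeOne_deg_zero, map_sub, map_smul, map_smul]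
  rfl

theorem dual_ad_neg (X : VF n M) (α : OneForm n M) :
    ((tangent n M).ad (-X)).dual α = -((tangent n M).ad X).dual α := by
  have h := dual_ad_add X (-X) α
  rw [add_neg_cancel] at h
  have h0 := dual_ad_add 0 0 α
  rw [add_zero, left_eq_add] at h0
  rw [h0] at h
  exact eq_neg_of_add_eq_zero_right h.symm

theorem contract_eq_flatOne (X : VF n M) : contract X Ω = degOneEquiv (flatOne Ω X) := by
  rw [← contractTwo_eq_flatOne, degOneEquiv_contractTwo]

theorem pullback_contract (X : VF n M) {k : ℕ} (Q : MultiVF n M (k + 1)) :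
    pullback (flatOne Ω) k (contract (flatOne Ω X) Q) = contract X (pullback (flatOne Ω) (k + 1) Q) :=
  (contract_compLinearMap (flatOne Ω) X Q).symm

variable [T2Space M]

theorem IsLCS.bijective (h : IsLCS Ω lee) : Function.Bijective (flatOne Ω) :=
  flatOne_bijective h.nondegenerate

theorem IsLCS.eval_bijective (h : IsLCS Ω lee) :
    Function.Bijective (Module.Dual.eval (Fn n M) (VF n M)) := dual_eval_bijective h.bijective

/-- Contracting dΩ = ω ∧ Ω with X and then Y, by Cartan's formula, expresses L_X ♭Y - L_Y ♭X +
d(Ω(X, Y)) as ♭[X, Y] plus the terms from ω ∧ Ω, where ω = ♭E. Since # = -♭⁻¹, the left side is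
minus the Koszul bracket. -/
theorem IsLCS.koszulBracket_flatOne (h : IsLCS Ω lee) (X Y : VF n M) :
    koszulBracket (bivector Ω) (flatOne Ω X) (flatOne Ω Y) =
      -flatOne Ω ((twistedAd Ω lee X).A Y) := by
  have h1 := congrArg (contract X) h.d_eq
  rw [SkewAlgebroid.contract_d, contract_wedgeOne, contract_eq_flatOne] at h1
  have h2 : contractTwo (((tangent n M).ad X).lie Ω) Y -
      contractTwo ((tangent n M).d (degOneEquiv (flatOne Ω X))) Y =
      lee X • contractTwo Ω Y - contractTwo (wedgeOne lee (degOneEquiv (flatOne Ω X))) Y :=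
    congrArg (fun c ↦ contractTwo c Y) h1
  rw [ModuleDerivation.contractTwo_lie, SkewAlgebroid.contractTwo_d, contractTwo_wedgeOne,
    contractTwo_eq_flatOne, contractTwo_eq_flatOne, tangent_grad] at h2
  rw [koszulBracket, sharpOne_flatOne h.bijective, sharpOne_flatOne h.bijective, dual_ad_neg,
    dual_ad_neg, bivector_flatOne h.bijective, twistedAd_A]
  simp only [map_add, map_sub, map_smul, flatOne_leeVF h.bijective]
  rw [← flatOne_apply]
  have h3 := congrArg (fun c ↦ -c - flatOne Ω (((tangent n M).ad X).A Y)) h2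
  refine Eq.trans ?_ (h3.trans ?_)
  · abel
  · module

/-- ♭ intertwines minus `twistedAd` with the operator of ♭X, on functions because #♭X = -X and on
the module by `koszulBracket_flatOne`. -/
theorem IsLCS.cotangent_lie (h : IsLCS Ω lee) (X : VF n M) {k : ℕ} (Q : MultiVF n M k) :
    pullback (flatOne Ω) k (((cotangent h.eval_bijective (bivector Ω)).ad (flatOne Ω X)).lie Q) =
      -(twistedAd Ω lee X).lie (pullback (flatOne Ω) k Q) := by
  rw [← ModuleDerivation.lie_neg]
  refine ModuleDerivation.lie_compLinearMap _ _ _ (fun f ↦ ?_) (fun Y ↦ ?_) Q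
  · change deriv (sharpOne (bivector Ω) (flatOne Ω X)) f = -deriv X f
    rw [sharpOne_flatOne h.bijective]
    ext x
    simp [deriv_apply]
  · refine (h.koszulBracket_flatOne X Y).trans ?_
    exact (map_neg (flatOne Ω) _).symm

theorem IsLCS.cotangent_d_zero (h : IsLCS Ω lee) (Q : MultiVF n M 0) :
    pullback (flatOne Ω) 1 ((cotangent h.eval_bijective (bivector Ω)).d Q) =
      -(tangent n M).d (pullback (flatOne Ω) 0 Q) := by
  refine ext_contract fun X ↦ ?_
  rw [← pullback_contract, SkewAlgebroid.contract_d_zero, h.cotangent_lie, map_neg,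
    SkewAlgebroid.contract_d_zero]
  rw [ModuleDerivation.lie_eq_of_deg_zero ((tangent n M).ad X) (twistedAd Ω lee X) fun _ ↦ rfl]

/-- Induction on the degree: contraction with ♭X becomes contraction with X, Cartan's formula
produces the twisted Lie derivative, and `lie_twist` expands it. As ♭ is onto, such contractions see
the whole differential. -/
theorem IsLCS.cotangent_d (h : IsLCS Ω lee) {k : ℕ} (Q : MultiVF n M (k + 1)) :
    pullback (flatOne Ω) (k + 2) ((cotangent h.eval_bijective (bivector Ω)).d Q) =
      (k + 1) • wedgeOne lee (pullback (flatOne Ω) (k + 1) Q) +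
      wedgeTwo Ω (contract (leeVF Ω lee) (pullback (flatOne Ω) (k + 1) Q)) -
      (tangent n M).d (pullback (flatOne Ω) (k + 1) Q) := by
  have hlie : ∀ (X : VF n M) {k : ℕ} (p : Form n M (k + 1)), (twistedAd Ω lee X).lie p =
      ((tangent n M).ad X).lie p - (k + 1) • lee X • p + wedgeOne lee (contract X p) -
        wedgeOne (contractTwo Ω X) (contract (leeVF Ω lee) p) := fun X k p ↦ by
    rw [contractTwo_eq_flatOne]
    exact ModuleDerivation.lie_twist ((tangent n M).ad X) (twistedAd Ω lee X) (lee X) lee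
      (flatOne Ω X) X (leeVF Ω lee) (fun _ ↦ rfl) (twistedAd_A X) p
  induction k with
  | zero =>
    refine ext_contract fun X ↦ ?_
    rw [← pullback_contract, SkewAlgebroid.contract_d, map_sub, h.cotangent_lie,
      h.cotangent_d_zero, pullback_contract, hlie]
    exact (contract_twisted_d_zero (tangent n M) Ω lee X _ _).symm
  | succ k ih =>
    refine ext_contract fun X ↦ ?_
    rw [← pullback_contract, SkewAlgebroid.contract_d, map_sub, h.cotangent_lie,
      ih, pullback_contract, hlie]
    exact (contract_twisted_d (tangent n M) Ω lee X _ _).symm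

/-- L_E Ω = d(i_E Ω) + i_E(ω ∧ Ω), where d(i_E Ω) = dω = 0 and i_E(ω ∧ Ω) = ω(E) Ω - ω ∧ ω = 0. -/
theorem IsLCS.lie_leeVF (h : IsLCS Ω lee) : ((tangent n M).ad (leeVF Ω lee)).lie Ω = 0 := by
  have h1 := congrArg (contract (leeVF Ω lee)) h.d_eq
  rw [SkewAlgebroid.contract_d, contract_wedgeOne, contract_eq_flatOne, flatOne_leeVF h.bijective,
    h.d_lee, lee_leeVF h.bijective] at h1
  rw [sub_zero, zero_smul, zero_sub] at h1
  rw [h1, neg_eq_zero]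
  apply ext_contract fun X ↦ ?_
  rw [contract_wedgeOne, wedgeOne_deg_zero, map_zero]
  exact sub_self _

/-- Since L_E Ω = 0, the map ♭ commutes with L_E, and so does pullback along it. -/
theorem IsLCS.pullback_schouten_leeVF (h : IsLCS Ω lee) {k : ℕ} (P : MultiVF n M k)
    (hk : k + 1 = 1 + k) :
    pullback (flatOne Ω) k (schoutenBilin hk (vec (leeVF Ω lee)) P) =
      ((tangent n M).ad (leeVF Ω lee)).lie (pullback (flatOne Ω) k P) := by
  rw [schouten_vec h.eval_bijective]
  refine ModuleDerivation.lie_compLinearMap ((tangent n M).ad (leeVF Ω lee)).transpose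
    ((tangent n M).ad (leeVF Ω lee)) (flatOne Ω) (fun f ↦ rfl) (fun Y ↦ ?_) P
  have h1 := ModuleDerivation.contractTwo_lie ((tangent n M).ad (leeVF Ω lee)) Ω Y
  rw [h.lie_leeVF, contractTwo_eq_flatOne (Ω := Ω), contractTwo_eq_flatOne (Ω := Ω)] at h1
  refine (sub_eq_zero.1 (h1.symm.trans ?_))
  ext1 Z
  rfl

end Transport

end LJ

namespace LJ

/-! ### Long exact sequence of a mapping cone -/

section Cone

variable {A B C : ℕ → Type*} [∀ k, AddCommGroup (A k)] [∀ k, Module ℝ (A k)]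
  [∀ k, AddCommGroup (B k)] [∀ k, Module ℝ (B k)] [∀ k, AddCommGroup (C k)] [∀ k, Module ℝ (C k)]

theorem cohClass_eq_iff {d : ∀ k, A k →ₗ[ℝ] A (k + 1)} {k : ℕ} {a a' : A k} (ha : d k a = 0)
    (ha' : d k a' = 0) : cohClass d k a ha = cohClass d k a' ha' ↔ a - a' ∈ coboundaries d k :=
  Submodule.Quotient.eq _

/-- Restates exactness in cohomology for representatives, so that cone coordinates can be used
directly. -/
theorem exact_inducedMap {dA : ∀ k, A k →ₗ[ℝ] A (k + 1)} {dB : ∀ k, B k →ₗ[ℝ] B (k + 1)}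
    {dC : ∀ k, C k →ₗ[ℝ] C (k + 1)} {i j l : ℕ} {f : A i →ₗ[ℝ] B j} {g : B j →ₗ[ℝ] C l}
    (hf : Induces dA dB f) (hg : Induces dB dC g)
    (h : ∀ b, dB j b = 0 → (g b ∈ coboundaries dC l ↔
      ∃ a, dA i a = 0 ∧ f a - b ∈ coboundaries dB j)) :
    Function.Exact (inducedMap hf) (inducedMap hg) := by
  intro y
  obtain ⟨⟨b, hb⟩, rfl⟩ := Submodule.Quotient.mk_surjective _ y
  have h1 : inducedMap hg (Submodule.Quotient.mk ⟨b, hb⟩) = 0 ↔ g b ∈ coboundaries dC l :=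
    Submodule.Quotient.mk_eq_zero _
  rw [h1, h b hb]
  constructor
  · rintro ⟨a, ha, hab⟩
    exact ⟨cohClass dA i a ha, (cohClass_eq_iff (hf.1 ha) hb).2 hab⟩
  · rintro ⟨x, hx⟩
    obtain ⟨⟨a, ha⟩, rfl⟩ := Submodule.Quotient.mk_surjective _ x
    exact ⟨a, ha, (cohClass_eq_iff (hf.1 ha) hb).1 hx⟩

variable {dA : ∀ k, A k →ₗ[ℝ] A (k + 1)} {dB : ∀ k, B k →ₗ[ℝ] B (k + 1)}
  {dC : ∀ k, C k →ₗ[ℝ] C (k + 1)} {F : ∀ k, A k →ₗ[ℝ] B k} {G : ∀ k, B k →ₗ[ℝ] C k}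
  {L : ∀ k, C k →ₗ[ℝ] A (k + 1)}

/-- The complex `B` is the mapping cone of the chain map `L`, in the coordinates `Φ`. -/
structure IsCone (dA : ∀ k, A k →ₗ[ℝ] A (k + 1)) (dB : ∀ k, B k →ₗ[ℝ] B (k + 1))
    (dC : ∀ k, C k →ₗ[ℝ] C (k + 1)) (F : ∀ k, A k →ₗ[ℝ] B k) (G : ∀ k, B k →ₗ[ℝ] C k)
    (L : ∀ k, C k →ₗ[ℝ] A (k + 1)) (Φ : ∀ k, B k ≃ₗ[ℝ] A k × C k) : Prop where
  apply_F : ∀ k a, Φ k (F k a) = (a, 0)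
  apply_G : ∀ k b, (Φ k b).2 = G k b
  apply_d : ∀ k b, Φ (k + 1) (dB k b) = (-dA k (Φ k b).1 + L k (G k b), dC k (G k b))
  dA_dA : ∀ k a, dA (k + 1) (dA k a) = 0
  dC_dC : ∀ k c, dC (k + 1) (dC k c) = 0
  dA_L : ∀ k c, dA (k + 1) (L k c) = L (k + 1) (dC k c)

namespace IsCone

variable {Φ : ∀ k, B k ≃ₗ[ℝ] A k × C k} (h : IsCone dA dB dC F G L Φ)

include h

theorem G_F (k : ℕ) (a : A k) : G k (F k a) = 0 := by rw [← h.apply_G, h.apply_F]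

theorem G_symm (k : ℕ) (a : A k) (c : C k) : G k ((Φ k).symm (a, c)) = c := by
  rw [← h.apply_G, LinearEquiv.apply_symm_apply]

theorem dB_symm (k : ℕ) (a : A k) (c : C k) :
    Φ (k + 1) (dB k ((Φ k).symm (a, c))) = (-dA k a + L k c, dC k c) := by
  rw [h.apply_d, h.G_symm, LinearEquiv.apply_symm_apply]

theorem F_fst (k : ℕ) (b : B k) (hb : G k b = 0) : F k (Φ k b).1 = b := by
  apply (Φ k).injective
  rw [h.apply_F]
  exact Prod.ext rfl (hb.symm.trans (h.apply_G k b).symm)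

theorem dB_F (k : ℕ) (a : A k) : dB k (F k a) = -F (k + 1) (dA k a) := by
  apply (Φ (k + 1)).injective
  rw [h.apply_d, h.G_F, h.apply_F, map_neg, h.apply_F]
  simp

theorem G_dB (k : ℕ) (b : B k) : G (k + 1) (dB k b) = dC k (G k b) := by
  rw [← h.apply_G, h.apply_d]

theorem dB_dB (k : ℕ) (b : B k) : dB (k + 1) (dB k b) = 0 := by
  apply (Φ (k + 2)).injective
  rw [h.apply_d, h.apply_d, h.G_dB, h.dC_dC]
  simp [h.dA_dA, h.dA_L]

theorem shortExact (k : ℕ) : Function.Injective (F k) ∧ Function.Exact (F k) (G k) ∧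
    Function.Surjective (G k) := by
  refine ⟨fun a a' haa ↦ ?_, fun b ↦ ⟨fun hb ↦ ⟨_, h.F_fst k b hb⟩, ?_⟩,
    fun c ↦ ⟨_, h.G_symm k 0 c⟩⟩
  · have := congrArg (Φ k) haa
    rw [h.apply_F, h.apply_F] at this
    exact congrArg Prod.fst this
  · rintro ⟨a, rfl⟩
    exact h.G_F k a

theorem induces_F (k : ℕ) : Induces dA dB (F k) := by
  constructor
  · intro a ha
    change dB k (F k a) = 0
    rw [h.dB_F, show dA k a = 0 from ha, map_zero, neg_zero]
  · cases k with
    | zero =>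
      rintro a (rfl : a = 0)
      exact map_zero (F 0)
    | succ k =>
      rintro _ ⟨a, rfl⟩
      exact ⟨-F k a, by rw [map_neg, h.dB_F, neg_neg]⟩

theorem induces_G (k : ℕ) : Induces dB dC (G k) := by
  constructor
  · intro b hb
    change dC k (G k b) = 0
    rw [← h.G_dB, show dB k b = 0 from hb, map_zero]
  · cases k with
    | zero =>
      rintro b (rfl : b = 0)
      exact map_zero (G 0)
    | succ k =>
      rintro _ ⟨b, rfl⟩
      exact ⟨G k b, (h.G_dB k b).symm⟩

theorem induces_L (k : ℕ) : Induces dC dA (l := k + 1) (L k) := by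
  constructor
  · intro c hc
    change dA (k + 1) (L k c) = 0
    rw [h.dA_L, show dC k c = 0 from hc, map_zero]
  · cases k with
    | zero =>
      rintro c (rfl : c = 0)
      rw [Submodule.mem_comap, map_zero]
      exact zero_mem _
    | succ k =>
      rintro _ ⟨c, rfl⟩
      exact ⟨L k c, h.dA_L k c⟩

theorem injective_zero : Function.Injective (inducedMap (h.induces_F 0)) := by
  rw [← LinearMap.ker_eq_bot, LinearMap.ker_eq_bot']
  intro x hx
  obtain ⟨⟨a, ha⟩, rfl⟩ := Submodule.Quotient.mk_surjective _ x
  have h1 : F 0 a = 0 := (Submodule.Quotient.mk_eq_zero _).1 hx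
  have h2 : a = 0 := (h.shortExact 0).1 (h1.trans (map_zero _).symm)
  exact (Submodule.Quotient.mk_eq_zero _).2 h2

theorem exact_F_G (k : ℕ) :
    Function.Exact (inducedMap (h.induces_F k)) (inducedMap (h.induces_G k)) := by
  refine exact_inducedMap _ _ fun b hb ↦ ⟨fun hG ↦ ?_, ?_⟩
  -- If G b = dc, subtracting the differential of the lift (0, c) kills G b; what remains comes from
  -- F. In degree 0 the only coboundary is 0 and no correction is needed.
  · have key : ∃ b' ∈ coboundaries dB k, G k (b' + b) = 0 := by
      cases k with
      | zero => exact ⟨0, zero_mem _, by rw [zero_add]; exact hG⟩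
      | succ k =>
        obtain ⟨c, hc⟩ := hG
        refine ⟨dB k ((Φ k).symm (0, -c)), ⟨_, rfl⟩, ?_⟩
        rw [map_add, h.G_dB, h.G_symm, ← hc, map_neg, neg_add_cancel]
    obtain ⟨b', hb', hz⟩ := key
    have h1 := h.F_fst k _ hz
    refine ⟨(Φ k (b' + b)).1, ?_, ?_⟩
    · apply (h.shortExact (k + 1)).1
      have h2 : dB k b' = 0 := by
        cases k with
        | zero => rw [show b' = 0 from hb', map_zero]
        | succ k =>
          obtain ⟨x, rfl⟩ := hb'
          exact h.dB_dB k x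
      rw [← neg_inj, ← h.dB_F, h1, map_add, h2, hb, map_zero, add_zero, neg_zero]
    · rwa [h1, add_sub_cancel_right]
  · rintro ⟨a, -, hab⟩
    have h1 := (h.induces_G k).2 hab
    rw [Submodule.mem_comap, map_sub, h.G_F, zero_sub] at h1
    simpa using h1

theorem exact_G_L (k : ℕ) :
    Function.Exact (inducedMap (h.induces_G k)) (inducedMap (h.induces_L k)) := by
  refine exact_inducedMap _ _ fun c hc ↦ ⟨?_, ?_⟩
  · rintro ⟨a, ha⟩
    -- The pair (a, c) is a cocycle of the cone exactly when dc = 0 and da = Lc: a lift of c is the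
    -- same as a primitive of Lc.
    refine ⟨(Φ k).symm (a, c), ?_, ?_⟩
    · apply (Φ (k + 1)).injective
      rw [h.dB_symm, ha, hc, neg_add_cancel, map_zero]
      rfl
    · rw [h.G_symm, sub_self]
      exact zero_mem _
  · rintro ⟨b, hb, hbc⟩
    have h1 := (h.induces_L k).2 hbc
    rw [Submodule.mem_comap, map_sub] at h1
    have h2 : L k (G k b) ∈ coboundaries dA (k + 1) := by
      have h3 := congrArg Prod.fst (h.apply_d k b)
      rw [hb, map_zero] at h3
      exact ⟨(Φ k b).1, (neg_add_eq_zero.1 h3.symm)⟩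
    have h4 := Submodule.sub_mem _ h2 h1
    rwa [sub_sub_cancel] at h4

theorem exact_L_F (k : ℕ) :
    Function.Exact (inducedMap (h.induces_L k)) (inducedMap (h.induces_F (k + 1))) := by
  refine exact_inducedMap _ _ fun a ha ↦ ⟨?_, ?_⟩
  · rintro ⟨b, hb⟩
    have h1 := h.apply_d k b
    rw [hb, h.apply_F] at h1
    refine ⟨G k b, (congrArg Prod.snd h1).symm, (Φ k b).1, ?_⟩
    have h2 := congrArg Prod.fst h1
    simp only at h2
    rw [h2]
    abel
  · rintro ⟨c, hc, p, hp⟩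
    refine ⟨(Φ k).symm (p, c), ?_⟩
    apply (Φ (k + 1)).injective
    rw [h.dB_symm, h.apply_F, hc, hp]
    simp

/-- In coordinates b = (p, c), the equation F a = dB b says a = -dp + Lc, so p itself is a primitive
of Lc - a. -/
theorem isConnectingHom (k : ℕ) :
    IsConnectingHom dA dB dC F G k (inducedMap (h.induces_L k)) := by
  intro b hb a ha hab
  refine (cohClass_eq_iff ((h.induces_L k).1 hb) ha).2 ⟨(Φ k b).1, ?_⟩
  have h1 := h.apply_d k b
  rw [← hab, h.apply_F] at h1
  have h2 := congrArg Prod.fst h1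
  simp only at h2
  rw [h2]
  abel

/-- Changing the sign of the middle differential replaces a by -a. -/
theorem isConnectingHom_neg (k : ℕ) :
    IsConnectingHom dA (fun j ↦ -dB j) dC F G k (-inducedMap (h.induces_L k)) := by
  intro b hb a ha hab
  have h1 := h.isConnectingHom k b hb (-a) (by rw [map_neg, ha, neg_zero])
    (by rw [map_neg, hab, LinearMap.neg_apply, neg_neg])
  rw [LinearMap.neg_apply, h1]
  exact neg_neg (cohClass dA (k + 1) a ha)

end IsCone

end Cone

end LJ

namespace LJ

universe v

/-! ### The LJ operator in cone coordinates -/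

section ConeIdentity

variable {R N : Type*} [CommRing R] [Algebra ℝ R] [AddCommGroup N] [Module R N] [Module ℝ N]
  [IsScalarTower ℝ R N] (𝒜 : SkewAlgebroid R N) (a : N [⋀^Fin 2]→ₗ[R] R) (E : N)

/-- The cancellation behind the second coordinate of σ: by Cartan's formula i_E(-dp) = -L_E p +
d(i_E p), whose first term cancels the contribution of [E, P]. In positive degree (`contract_cone`)
the terms Ω ∧ i_E q and the multiples of ω ∧ q cancel as well, leaving d_ω of q + i_E p. -/
theorem contract_cone_zero (p : N [⋀^Fin 1]→ₗ[R] R) (q : N [⋀^Fin 0]→ₗ[R] R) :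
    𝒜.d q - 0 • -wedgeOne (contractTwo a E) q + (𝒜.ad E).lie p +
      contract E (-𝒜.d p + wedgeTwo a (q + contract E p)) =
      𝒜.d (q + contract E p) + wedgeOne (contractTwo a E) (q + contract E p) := by
  rw [map_add (contract E), map_neg (contract E), SkewAlgebroid.contract_d,
    contract_wedgeTwo_zero, map_add 𝒜.d, zero_smul]
  abel

theorem contract_cone {k : ℕ} (p : N [⋀^Fin (k + 2)]→ₗ[R] R) (q : N [⋀^Fin (k + 1)]→ₗ[R] R) :
    𝒜.d q - (k + 1) • wedgeOne (contractTwo a E) q - wedgeTwo a (contract E q) -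
      (k + 1) • -wedgeOne (contractTwo a E) q + (𝒜.ad E).lie p +
      contract E (-𝒜.d p + wedgeTwo a (q + contract E p)) =
      𝒜.d (q + contract E p) + wedgeOne (contractTwo a E) (q + contract E p) := by
  rw [map_add (contract E), map_neg (contract E), SkewAlgebroid.contract_d,
    contract_wedgeTwo, map_add 𝒜.d, map_add (contract E), contract_self, add_zero, smul_neg]
  abel

end ConeIdentity

section Coordinates

variable {n : ℕ} {M : Type*} [TopologicalSpace M] [ChartedSpace (EuclideanSpace ℝ (Fin n)) M]
  [IsManifold (𝓡 n) ∞ M] {Ω : Form n M 2} {lee : OneForm n M}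

theorem pullback_wedge {p q m : ℕ} (h : p + q = m) (P : MultiVF n M p) (Q : MultiVF n M q) :
    pullback (flatOne Ω) m (wedge P Q h) =
      wedge (pullback (flatOne Ω) p P) (pullback (flatOne Ω) q Q) h :=
  wedge_compLinearMap P Q (flatOne Ω) h

theorem pullback_vec_wedge {q : ℕ} (X : VF n M) (Q : MultiVF n M q) (h : 1 + q = q + 1) :
    pullback (flatOne Ω) (q + 1) (wedge (vec X) Q h) =
      -wedgeOne (flatOne Ω X) (pullback (flatOne Ω) q Q) := by
  rw [pullback_wedge, pullback_vec]
  change wedgeL 1 q (q + 1) h (-degOneEquiv (flatOne Ω X)) _ = _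
  rw [map_neg]
  rfl

theorem pullback_bijective (hb : Function.Bijective (flatOne Ω)) (k : ℕ) :
    Function.Bijective (pullback (flatOne Ω) k) := by
  constructor
  · intro P Q hPQ
    ext α : 1
    have h1 := congrArg (fun p ↦ p fun i ↦ inverseMap (flatOne Ω) (α i)) hPQ
    change P (fun i ↦ flatOne Ω (inverseMap (flatOne Ω) (α i))) =
      Q (fun i ↦ flatOne Ω (inverseMap (flatOne Ω) (α i))) at h1
    simpa only [apply_inverseMap hb] using h1
  · intro p
    refine ⟨pullback (inverseMap (flatOne Ω)) k p, ?_⟩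
    ext v : 1
    change p (fun i ↦ inverseMap (flatOne Ω) (flatOne Ω (v i))) = p v
    simp only [inverseMap_apply hb]

/-- Each of the k slots contributes -1 from # = -♭⁻¹, and the sign (-1)^k in `sharp` compensates. -/
theorem pullback_sharp (hb : Function.Bijective (flatOne Ω)) {k : ℕ} (p : Form n M k) :
    pullback (flatOne Ω) k (sharp (bivector Ω) k p) = p := by
  ext v : 1
  change (-1 : ℤ) ^ k • p (fun i ↦ sharpOne (bivector Ω) (flatOne Ω (v i))) = p v
  simp only [sharpOne_flatOne hb]
  have h1 := p.map_smul_univ (fun _ ↦ (-1 : Fn n M)) v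
  simp only [neg_one_smul, Finset.prod_const, Finset.card_univ, Fintype.card_fin] at h1
  rw [h1, smul_eq_mul, zsmul_eq_mul, ← mul_assoc]
  push_cast
  rw [← mul_pow]
  simp

variable [T2Space M]

theorem IsLCS.pullback_schouten_zero (h : IsLCS Ω lee) (Q : MultiVF n M 0) (hk : 1 + 1 = 2 + 0) :
    pullback (flatOne Ω) 1 (schoutenBilin hk (bivector Ω) Q) =
      (tangent n M).d (pullback (flatOne Ω) 0 Q) := by
  rw [schouten_bivector h.eval_bijective, map_neg, h.cotangent_d_zero, neg_neg]

theorem IsLCS.pullback_schouten (h : IsLCS Ω lee) {k : ℕ} (Q : MultiVF n M (k + 1))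
    (hk : k + 2 + 1 = 2 + (k + 1)) :
    pullback (flatOne Ω) (k + 2) (schoutenBilin hk (bivector Ω) Q) =
      (tangent n M).d (pullback (flatOne Ω) (k + 1) Q) -
      (k + 1) • wedgeOne lee (pullback (flatOne Ω) (k + 1) Q) -
      wedgeTwo Ω (contract (leeVF Ω lee) (pullback (flatOne Ω) (k + 1) Q)) := by
  rw [schouten_bivector h.eval_bijective, map_neg, h.cotangent_d]
  abel

/-- E ∧ P pulls back to -ω ∧ p, so the term (k + 1) E ∧ P of σ exactly removes the multiple of ω ∧ p
coming from -[Λ, P]. -/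
theorem IsLCS.pullback_sigmaFst (h : IsLCS Ω lee) {k : ℕ} (P : MultiVF n M (k + 1))
    (Q : MultiVF n M k) :
    pullback (flatOne Ω) (k + 2) (sigmaFst (bivector Ω) (leeVF Ω lee) P Q) =
      -(tangent n M).d (pullback (flatOne Ω) (k + 1) P) +
      wedgeTwo Ω (pullback (flatOne Ω) k Q +
        contract (leeVF Ω lee) (pullback (flatOne Ω) (k + 1) P)) := by
  have h1 : pullback (flatOne Ω) (k + 2) (wedge (bivector Ω) Q (m := k + 2)) =
      wedgeTwo Ω (pullback (flatOne Ω) k Q) := by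
    rw [pullback_wedge, pullback_bivector h.bijective]
    rfl
  rw [sigmaFst, Nat.cast_smul_eq_nsmul, map_add, map_add, map_neg, map_nsmul, h1, schouten,
    h.pullback_schouten, pullback_vec_wedge, flatOne_leeVF h.bijective, map_add]
  simp only [smul_neg]
  abel

theorem IsLCS.pullback_sigmaSnd (h : IsLCS Ω lee) {k : ℕ} (P : MultiVF n M (k + 1))
    (Q : MultiVF n M k) :
    pullback (flatOne Ω) (k + 1) (sigmaSnd (bivector Ω) (leeVF Ω lee) P Q) +
      contract (leeVF Ω lee)
        (pullback (flatOne Ω) (k + 2) (sigmaFst (bivector Ω) (leeVF Ω lee) P Q)) =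
      (tangent n M).d (pullback (flatOne Ω) k Q +
        contract (leeVF Ω lee) (pullback (flatOne Ω) (k + 1) P)) +
      wedgeOne lee (pullback (flatOne Ω) k Q +
        contract (leeVF Ω lee) (pullback (flatOne Ω) (k + 1) P)) := by
  have h2 : contractTwo Ω (leeVF Ω lee) = lee := by
    rw [contractTwo_eq_flatOne, flatOne_leeVF h.bijective]
  rw [h.pullback_sigmaFst, sigmaSnd, Nat.cast_smul_eq_nsmul, map_add, map_sub, map_nsmul, schouten,
    schouten, h.pullback_schouten_leeVF, pullback_vec_wedge, flatOne_leeVF h.bijective]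
  have key0 := contract_cone_zero (tangent n M) Ω (leeVF Ω lee)
  have key := fun k ↦ contract_cone (tangent n M) Ω (leeVF Ω lee) (k := k)
  rw [h2] at key0
  simp only [h2] at key
  cases k with
  | zero =>
    refine Eq.trans ?_ (key0 _ _)
    congr 3
    exact h.pullback_schouten_zero Q _
  | succ k =>
    refine Eq.trans ?_ (key k _ _)
    congr 3
    exact h.pullback_schouten Q _

theorem shiftHom_bijective {S : Type*} [Semiring S] {C C' : ℕ → Type v}
    [∀ k, AddCommGroup (C k)] [∀ k, Module S (C k)] [∀ k, AddCommGroup (C' k)]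
    [∀ k, Module S (C' k)] {f : ∀ k, C k →ₗ[S] C' k} (hf : ∀ k, Function.Bijective (f k)) :
    ∀ k, Function.Bijective (shiftHom f k)
  | 0 => ⟨fun _ _ _ ↦ rfl, fun _ ↦ ⟨PUnit.unit, rfl⟩⟩
  | k + 1 => hf k

end Coordinates

end LJ

/-! ### The LJ complex as the mapping cone of α ↦ α ∧ Ω -/

namespace LJ

variable {n : ℕ} {M : Type*} [TopologicalSpace M] [ChartedSpace (EuclideanSpace ℝ (Fin n)) M]
  [IsManifold (𝓡 n) ∞ M] {Ω : Form n M 2} {lee : OneForm n M}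

/-- Lichnerowicz-Jacobi cochains in the coordinates `(P, Q) ↦ (P ∘ ♭, Q ∘ ♭ + i_E (P ∘ ♭))`. -/
def coneCoord (Ω : Form n M 2) (E : VF n M) (k : ℕ) :
    LJCochain n M k →ₗ[Fn n M] Form n M k × Shift (Form n M) k :=
  (pullback (flatOne Ω) k ∘ₗ LinearMap.fst _ _ _).prod
    (shiftHom (pullback (flatOne Ω)) k ∘ₗ LinearMap.snd _ _ _ +
      interior E k ∘ₗ pullback (flatOne Ω) k ∘ₗ LinearMap.fst _ _ _)

theorem coneCoord_apply (E : VF n M) (k : ℕ) (c : LJCochain n M k) :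
    coneCoord Ω E k c = (pullback (flatOne Ω) k c.1,
      shiftHom (pullback (flatOne Ω)) k c.2 + interior E k (pullback (flatOne Ω) k c.1)) := rfl

theorem coneCoord_bijective (hb : Function.Bijective (flatOne Ω)) (E : VF n M) (k : ℕ) :
    Function.Bijective (coneCoord Ω E k) := by
  have h1 := pullback_bijective hb k
  have h2 := shiftHom_bijective (pullback_bijective hb) k
  constructor
  · intro c c' hcc
    rw [coneCoord_apply, coneCoord_apply, Prod.mk.injEq] at hcc
    have h3 := h1.1 hcc.1
    have h4 := hcc.2
    rw [h3, add_left_inj] at h4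
    exact Prod.ext h3 (h2.1 h4)
  · rintro ⟨p, γ⟩
    obtain ⟨P, rfl⟩ := h1.2 p
    obtain ⟨Q, hQ⟩ := h2.2 (γ - interior E k (pullback (flatOne Ω) k P))
    refine ⟨(P, Q), ?_⟩
    rw [coneCoord_apply, hQ, sub_add_cancel]

/-- `coneCoord` as a linear equivalence over the reals. -/
def coneEquiv (hb : Function.Bijective (flatOne Ω)) (E : VF n M) (k : ℕ) :
    LJCochain n M k ≃ₗ[ℝ] Form n M k × Shift (Form n M) k :=
  (LinearEquiv.ofBijective (coneCoord Ω E k) (coneCoord_bijective hb E k)).restrictScalars ℝ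

theorem coneEquiv_Fbar (hb : Function.Bijective (flatOne Ω)) (E : VF n M) (k : ℕ)
    (α : Form n M k) : coneEquiv hb E k (Fbar (bivector Ω) E k α) = (α, 0) := by
  refine Prod.ext (pullback_sharp hb α) ?_
  cases k with
  | zero => rfl
  | succ k =>
    change pullback (flatOne Ω) k (-sharp (bivector Ω) k (contract E α)) +
      contract E (pullback (flatOne Ω) (k + 1) (sharp (bivector Ω) (k + 1) α)) = (0 : Form n M k)
    rw [map_neg, pullback_sharp hb, pullback_sharp hb, neg_add_cancel]

/-- The signs in Ḡ are those that undo the signs by which `flat` differs from `pullback` in the two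
consecutive degrees. -/
theorem coneEquiv_snd (hb : Function.Bijective (flatOne Ω)) (E : VF n M) (k : ℕ)
    (c : LJCochain n M k) : (coneEquiv hb E k c).2 = Gbar Ω E k c := by
  cases k with
  | zero => rfl
  | succ k =>
    obtain ⟨P, Q⟩ := c
    change MultiVF n M k at Q
    change pullback (flatOne Ω) k Q + contract E (pullback (flatOne Ω) (k + 1) P) =
      (-1 : ℤ) ^ (k + 1) • (-((-1 : ℤ) ^ k • pullback (flatOne Ω) k Q) +
        contract E ((-1 : ℤ) ^ (k + 1) • pullback (flatOne Ω) (k + 1) P))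
    rw [map_zsmul, smul_add, smul_neg, smul_smul, smul_smul, pow_succ]
    have h1 : (-1 : ℤ) ^ k * (-1) ^ k = 1 := by rw [← mul_pow]; simp
    rw [mul_neg_one, neg_mul, h1, neg_mul_neg, h1]
    simp

/-- The cross terms ω ∧ dα cancel; what remains is dω ∧ α + ω ∧ ω ∧ α = 0. -/
theorem d_lichnerowicz (h : IsLCS Ω lee) (k : ℕ) (α : Form n M k) :
    lichnerowicz lee (k + 1) (lichnerowicz lee k α) = 0 := by
  change extDeriv (k + 1) (extDeriv k α + wedgeOne lee α) +
    wedgeOne lee (extDeriv k α + wedgeOne lee α) = 0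
  rw [LJ.extDeriv_eq, LJ.extDeriv_eq, map_add, map_add, SkewAlgebroid.d_d tangent_isLie,
    SkewAlgebroid.d_wedgeOne, h.d_lee, wedgeOne_self, map_zero]
  simp

/-- d(Ω ∧ γ) = ω ∧ Ω ∧ γ + Ω ∧ dγ = Ω ∧ (dγ + ω ∧ γ): the Lee form in dΩ is exactly the twist in
d_ω. -/
theorem IsLCS.extDeriv_wedgeRight (h : IsLCS Ω lee) (k : ℕ) (γ : Shift (Form n M) k) :
    extDeriv (k + 1) (wedgeRight Ω k γ) =
      wedgeRight Ω (k + 1) (shiftMap (lichnerowicz lee) k γ) := by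
  cases k with
  | zero =>
    change extDeriv 1 0 = wedgeRight Ω 1 0
    rw [map_zero, map_zero]
  | succ k =>
    change Form n M k at γ
    change extDeriv (k + 2) (wedge γ Ω (m := k + 2)) =
      wedge (extDeriv k γ + wedgeOne lee γ) Ω (m := k + 3)
    rw [wedge_two_right, wedge_two_right, LJ.extDeriv_eq, LJ.extDeriv_eq,
      SkewAlgebroid.d_wedgeTwo, h.d_eq, wedgeThree_wedgeOne_left, map_add, wedgeTwo_wedgeOne]
    exact add_comm _ _

variable [T2Space M]

theorem IsLCS.coneEquiv_ljDifferential (h : IsLCS Ω lee) (k : ℕ) (c : LJCochain n M k) :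
    coneEquiv h.bijective (leeVF Ω lee) (k + 1)
      (ljDifferential (bivector Ω) (leeVF Ω lee) k c) =
      (-extDeriv k (pullback (flatOne Ω) k c.1) + wedgeRight Ω k (Gbar Ω (leeVF Ω lee) k c),
        shiftMap (lichnerowicz lee) k (Gbar Ω (leeVF Ω lee) k c)) := by
  rw [← coneEquiv_snd h.bijective]
  cases k with
  | zero =>
    -- In degree 0 the component Q lies in the zero space, so γ = 0; the second coordinate is L_E p
    -- - i_E dp = 0.
    obtain ⟨P, Q⟩ := c
    have h1 := h.pullback_schouten_zero P (by omega)
    refine Prod.ext ?_ ?_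
    · change pullback (flatOne Ω) 1 (-schouten (bivector Ω) P) = -extDeriv 0 _ + 0
      rw [map_neg, schouten, h1, LJ.extDeriv_eq, add_zero]
    · change pullback (flatOne Ω) 0 (schouten (vec (leeVF Ω lee)) P) +
        contract (leeVF Ω lee) (pullback (flatOne Ω) 1 (-schouten (bivector Ω) P)) = 0
      rw [map_neg, schouten, schouten, h1, h.pullback_schouten_leeVF, map_neg,
        SkewAlgebroid.contract_d_zero, add_neg_cancel]
  | succ k =>
    obtain ⟨P, Q⟩ := c
    change MultiVF n M k at Q
    refine Prod.ext ?_ ?_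
    · change pullback (flatOne Ω) (k + 2) (sigmaFst (bivector Ω) (leeVF Ω lee) P Q) =
        -extDeriv (k + 1) (pullback (flatOne Ω) (k + 1) P) +
        wedge (pullback (flatOne Ω) k Q + contract (leeVF Ω lee) (pullback (flatOne Ω) (k + 1) P))
          Ω (m := k + 2)
      rw [h.pullback_sigmaFst, LJ.extDeriv_eq, wedge_two_right]
    · refine (h.pullback_sigmaSnd P Q).trans ?_
      rw [← LJ.extDeriv_eq]
      rfl

theorem IsLCS.isCone (h : IsLCS Ω lee) :
    IsCone (extDeriv (n := n) (M := M)) (ljDifferential (bivector Ω) (leeVF Ω lee))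
      (shiftMap (lichnerowicz lee))
      (fun k ↦ (Fbar (bivector Ω) (leeVF Ω lee) k).restrictScalars ℝ)
      (fun k ↦ (Gbar Ω (leeVF Ω lee) k).restrictScalars ℝ) (wedgeRight Ω)
      (coneEquiv h.bijective (leeVF Ω lee)) where
  apply_F := coneEquiv_Fbar h.bijective (leeVF Ω lee)
  apply_G := coneEquiv_snd h.bijective (leeVF Ω lee)
  apply_d := h.coneEquiv_ljDifferential
  dA_dA k α := by
    rw [LJ.extDeriv_eq, LJ.extDeriv_eq, SkewAlgebroid.d_d tangent_isLie]
  dC_dC k c := by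
    cases k with
    | zero => exact map_zero (shiftMap (lichnerowicz lee) 1)
    | succ k => exact d_lichnerowicz h k c
  dA_L := h.extDeriv_wedgeRight

end LJ

end

theorem theorem3p9 {n : ℕ} {M : Type*} [TopologicalSpace M]
    [ChartedSpace (EuclideanSpace ℝ (Fin n)) M] [IsManifold (𝓡 n) ∞ M]
    [T2Space M] [SecondCountableTopology M] [ConnectedSpace M]
    (Ω : LJ.Form n M 2) (lee : LJ.OneForm n M) (h : LJ.IsLCS Ω lee) :
    let d := LJ.extDeriv (n := n) (M := M)
    let dω := LJ.shiftMap (LJ.lichnerowicz lee)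
    let Λ := LJ.bivector Ω
    let E := LJ.leeVF Ω lee
    let σ := LJ.ljDifferential Λ E
    let F := fun k ↦ (LJ.Fbar Λ E k).restrictScalars ℝ
    let G := fun k ↦ (LJ.Gbar Ω E k).restrictScalars ℝ
    -- the three sequences are complexes
    (∀ k α, d (k + 1) (d k α) = 0) ∧
    (∀ k c, σ (k + 1) (σ k c) = 0) ∧
    (∀ k α, dω (k + 1) (dω k α) = 0) ∧
    -- `F : (Ω^*, d) → (V^* ⊕ V^(*-1), -σ)` and `G : (V^* ⊕ V^(*-1), -σ) → (Ω^(*-1), -d_ω)` are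
    -- morphisms of complexes forming a short exact sequence
    (∀ k α, F (k + 1) (d k α) = (-σ k) (F k α)) ∧
    (∀ k c, G (k + 1) ((-σ k) c) = (-dω k) (G k c)) ∧
    (∀ k, Function.Injective (F k) ∧ Function.Exact (F k) (G k) ∧ Function.Surjective (G k)) ∧
    -- `F`, `G` and `α ↦ α ∧ Ω` induce maps in cohomology that form a long exact sequence
    ∃ (hF : ∀ k, LJ.Induces d σ (F k)) (hG : ∀ k, LJ.Induces σ dω (G k))
      (hL : ∀ k, LJ.Induces dω d (l := k + 1) (LJ.wedgeRight Ω k)),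
      Function.Injective (LJ.inducedMap (hF 0)) ∧
      ∀ k, Function.Exact (LJ.inducedMap (hF k)) (LJ.inducedMap (hG k)) ∧
        Function.Exact (LJ.inducedMap (hG k)) (LJ.inducedMap (hL k)) ∧
        Function.Exact (LJ.inducedMap (hL k)) (LJ.inducedMap (hF (k + 1))) ∧
        -- `[α] ↦ [α ∧ Ω]` is the connecting homomorphism formed with the operator `σ`, hence minus
        -- the connecting homomorphism formed with `-σ`
        LJ.IsConnectingHom d σ dω F G k (LJ.inducedMap (hL k)) ∧
        LJ.IsConnectingHom d (fun j ↦ -σ j) dω F G k (-LJ.inducedMap (hL k)) := by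
  -- In the cone F̄ anticommutes and Ḡ commutes with the differentials as given, so using -σ makes
  -- F̄ a morphism from d and Ḡ one to -d_ω.
  have hc := h.isCone
  refine ⟨hc.dA_dA, hc.dB_dB, hc.dC_dC, fun k α ↦ ?_, fun k c ↦ ?_, hc.shortExact,
    hc.induces_F, hc.induces_G, hc.induces_L, hc.injective_zero, fun k ↦
      ⟨hc.exact_F_G k, hc.exact_G_L k, hc.exact_L_F k, hc.isConnectingHom k,
        hc.isConnectingHom_neg k⟩⟩
  · rw [LinearMap.neg_apply, hc.dB_F, neg_neg]
  · rw [LinearMap.neg_apply, LinearMap.neg_apply, map_neg, hc.G_dB]
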